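/- **Setting.** Let $M$ be an oriented, time-oriented globally hyperbolic spacetime (smooth, Hausdorff, paracompact, finitely many components, metric $g$ of signature $(+,-,\dots,-)$). Let $B\to M$ be a smooth finite-rank complex vector bundle with a smooth nondegenerate (possibly indefinite) hermitian fibre metric $(\cdot,\cdot)$, antilinear in the first argument, and a smooth fibrewise antilinear involution $\mathcal C$ with $(\mathcal Cv,\mathcal Cw)=\overline{(v,w)}$. Put $\langle v,w\rangle=(\mathcal Cv,w)$, let $\langle f,h\rangle=\int_M\langle f,h\rangle_x\,d\mathrm{vol}_g$ for sections with compactly intersecting supports, and let $f^{\sharp}\in\Gamma^\infty(B^*)$ be the section $\langle f,\cdot\rangle$; write $f^{\sharp,1}=\rho f^\sharp$, where $\rho$ is the metric volume density. An RFHGHO is a partial differential operator $P$ on $\Gamma^\infty(B)$ which commutes with $\mathcal C$, is formally hermitian with respect to $\int_M(\cdot,\cdot)\,d\mathrm{vol}_g$, and has linear Green operators $E_P^\pm:\Gamma_0^\infty(B)\to\Gamma^\infty(B)$ with $PE_P^\pm f=f=E_P^\pm Pf$ and $\operatorname{supp}E_P^\pm f\subset J^\pm(\operatorname{supp}f)$.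 Put $E_P=E_P^--E_P^+$ and $E_P(f,h)=\langle f,E_Ph\rangle$. A fermionic RFHGHO is an RFHGHO together with a smooth fibrewise linear isomorphism $R:B\to B$, hermitian for the fibre metric, with $R\mathcal C=-\mathcal CR$ and $PR=RP$. The algebra $\mathscr Y(P)$ is the unital $*$-algebra generated by symbols $\Upsilon_P(f)$, $f\in\Gamma_0^\infty(B)$, complex linear in $f$, with $\Upsilon_P(f)^*=\Upsilon_P(\mathcal Cf)$, $\Upsilon_P(Pf)=0$ and $[\Upsilon_P(f),\Upsilon_P(h)]=iE_P(f,h)1$. For a fermionic RFHGHO, $\mathscr X(P)$ is generated by symbols $\Xi_P(f)$ with the same relations, except that the last is replaced by $\Xi_P(f)\Xi_P(h)+\Xi_P(h)\Xi_P(f)=iE_P(f,Rh)1$. A state $\omega$ on $\mathscr Y(P)$ has distributional $n$-point functions if for each $n$ there is a distribution $W^{(n)}\in\mathscr D'(B^{\boxtimes n})=\Gamma_0^\infty((B^*\otimes\Omega)^{\boxtimes n})'$ (with $\Omega$ the density bundle) such that $W^{(n)}(f_1^{\sharp,1}\otimes\cdots\otimes f_n^{\sharp,1})=\omega(\Upsilon_P(f_1)\cdots\Upsilon_P(f_n))$;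 write $W=W^{(2)}$. Wavefront sets (of scalar and Hilbert-space-valued distributions) are defined by: a nonzero covector $(y,l)$ is regular for $u$ if, in coordinates $X$ near $y$, there are a smooth density $\chi$ compactly supported in the chart with $\chi(y)\ne0$ and an open cone $\Gamma\ni l$ of nonzero covectors such that $\sup_{k\in \Gamma}(1+\|k\|^N)\|u(\chi e^{i k\cdot X})\|<\infty$ for all $N$; $\mathrm{WF}(u)$ is the set of non-regular nonzero covectors, and for a distributional section $u$ of a bundle $B$ one takes the union of $\mathrm{WF}(f\mapsto u(fT))$ over all smooth sections $T$ of $B^*$. Let $\mathcal V^+\subset\dot T^*M$ be a conic, relatively closed set of nonzero covectors with $\mathcal V^+\cap\mathcal V^-=\emptyset$, where $\mathcal V^-=-\mathcal V^+$. $P$ is $\mathcal V^\pm$-decomposable if the distribution in $\mathscr D'(B\boxtimes B)$ given by $f^{\sharp,1}\otimes h^{\sharp,1}\mapsto E_P(f,h)$ has wavefront set contained in $(\mathcal V^+\times\mathcal V^-)\cup(\mathcal V^-\times\mathcal V^+)$. In that case a state is $\mathcal V^+$-Hadamard if it has distributional $n$-point functions and $\mathrm{WF}(W)\subset\mathcal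 V^+\times\mathcal V^-$. A Hilbert space representation $(\mathfrak H,\pi,D)$ of a unital $*$-algebra $\mathcal A$ consists of a Hilbert space $\mathfrak H$, a dense subspace $D$ and a linear map $\pi$ from $\mathcal A$ to the linear operators $D\to D$ with $\pi(AB)=\pi(A)\pi(B)$, $\pi(1)=\mathrm{id}_D$ and $\langle\pi(A)\varphi,\psi\rangle=\langle\varphi,\pi(A^*)\psi\rangle$ for $\varphi,\psi\in D$. It is a GNS representation of a state $\omega$, with GNS vector $\varphi\in D$, if $\|\varphi\|=1$, $\omega(A)=\langle\varphi,\pi(A)\varphi\rangle$ for all $A$, and $D=\pi(\mathcal A)\varphi$. **Theorem 4.9.** Let $P$ be a $\mathcal V^\pm$-decomposable RFHGHO. 1. Let $(\mathfrak H,\pi,D)$ be a Hilbert space representation of $\mathscr Y(P)$, let $\psi\in D$ be a unit vector, and suppose that the state $\omega_\psi(A)=\langle\psi,\pi(A)\psi\rangle$ has distributional $n$-point functions. Then $f^{\sharp,1}\mapsto\pi(\Upsilon_P(f))\psi$ is an $\mathfrak H$-valued distribution, $\pi(\Upsilon_P(\cdot))\psi\in\mathscr D'(B;\mathfrak H)$,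 and $\omega_\psi$ is $\mathcal V^+$-Hadamard if and only if $$\mathrm{WF}(\pi(\Upsilon_P(\cdot))\psi)\subset\mathcal V^-.$$ 2. In particular, if $\omega$ is a $\mathcal V^+$-Hadamard state of $\mathscr Y(P)$, then this inclusion holds in the GNS representation of $\omega$, with $\psi$ the GNS vector. The same statements hold for $\mathcal V^\pm$-decomposable fermionic RFHGHOs, with $\mathscr Y(P)$ and $\Upsilon_P$ replaced by $\mathscr X(P)$ and $\Xi_P$. -/

import Mathlib

open scoped Manifold ContDiff Topology ComplexConjugate ComplexOrder
open Bundle MeasureTheory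

noncomputable section

namespace HadamardQFT

/-! ### Cotangent bundle, Lorentzian geometry and the volume measure -/

/-- The model space of a `d`-dimensional manifold. -/
abbrev Coord (d : ℕ) : Type := EuclideanSpace ℝ (Fin d)

section Spacetimes

variable (d : ℕ) (M : Type*) [TopologicalSpace M] [ChartedSpace (Coord d) M]

/-- The cotangent space at `x`. The identification of the tangent space at `x` with `Coord d` which
is built into `TangentSpace` is the one given by the preferred chart at `x`. -/
abbrev Cotangent (x : M) : Type := TangentSpace (𝓡 d) x →L[ℝ] Bundle.Trivial M ℝ x

/-- The cotangent bundle `T^*M`, with its bundle topology. -/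
abbrev CotangentBundle : Type _ := TotalSpace (Coord d →L[ℝ] ℝ) (Cotangent d M)

variable [IsManifold (𝓡 d) ∞ M]

/-- A Lorentzian metric of signature `(+,-,...,-)`, with a time-orientation (given by a nowhere
vanishing timelike one-form) and an orientation (given by a nowhere vanishing top form). -/
structure LorentzStructure where
  metric : ∀ x : M, TangentSpace (𝓡 d) x →L[ℝ] TangentSpace (𝓡 d) x →L[ℝ] ℝ
  metric_smooth : ContMDiff (𝓡 d) ((𝓡 d).prod 𝓘(ℝ, Coord d →L[ℝ] Coord d →L[ℝ] ℝ)) ∞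
    (fun x => TotalSpace.mk' (Coord d →L[ℝ] Coord d →L[ℝ] ℝ) x (metric x))
  metric_symm : ∀ x v w, metric x v w = metric x w v
  signature : ∀ x, ∃ v, 0 < metric x v v ∧ ∀ w, metric x v w = 0 → w ≠ 0 → metric x w w < 0
  timeForm : ∀ x : M, Cotangent d M x
  timeForm_smooth : ContMDiff (𝓡 d) ((𝓡 d).prod 𝓘(ℝ, Coord d →L[ℝ] ℝ)) ∞
    (fun x => TotalSpace.mk' (Coord d →L[ℝ] ℝ) x (timeForm x))
  timeForm_timelike : ∀ x, ∃ v, 0 < metric x v v ∧ ∀ w, timeForm x w = metric x v w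
  orientForm : ∀ x : M, (TangentSpace (𝓡 d) x) [⋀^Fin d]→L[ℝ] ℝ
  orientForm_smooth : ∀ X : Fin d → ∀ x : M, TangentSpace (𝓡 d) x,
    (∀ i, ContMDiff (𝓡 d) ((𝓡 d).prod 𝓘(ℝ, Coord d)) ∞
      (fun x => TotalSpace.mk' (Coord d) x (X i x))) →
    ContMDiff (𝓡 d) 𝓘(ℝ, ℝ) ∞ (fun x => orientForm x (fun i => X i x))
  orientForm_ne_zero : ∀ x, orientForm x ≠ 0

variable {d M}

namespace LorentzStructure

variable (S : LorentzStructure d M)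

/-- Future-directed causal tangent vectors. -/
def FutureCausal {x : M} (v : TangentSpace (𝓡 d) x) : Prop :=
  v ≠ 0 ∧ 0 ≤ S.metric x v v ∧ 0 < (S.timeForm x v : ℝ)

/-- There is a smooth future-directed causal curve segment from `x` to `y`. -/
def CausalStep (x y : M) : Prop :=
  ∃ γ : ℝ → M, ContMDiffOn 𝓘(ℝ, ℝ) (𝓡 d) ∞ γ (Set.Icc 0 1) ∧ γ 0 = x ∧ γ 1 = y ∧
    ∀ t ∈ Set.Icc (0 : ℝ) 1,
      S.FutureCausal (mfderivWithin 𝓘(ℝ, ℝ) (𝓡 d) γ (Set.Icc 0 1) t (1 : ℝ))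

/-- `J^+(A)`: the set `A` and all points reached from `A` by piecewise smooth future-directed
causal curves. -/
def JPlus (A : Set M) : Set M := {y | ∃ x ∈ A, Relation.ReflTransGen S.CausalStep x y}

/-- `J^-(A)`. -/
def JMinus (A : Set M) : Set M := {x | ∃ y ∈ A, Relation.ReflTransGen S.CausalStep x y}

/-- The coordinate expression `(|det g|)^{1/2}` of the metric volume density in the preferred chart
at `p`, at the point with coordinates `z`. -/
def densityInChart (p : M) (z : Coord d) : ℝ :=
  Real.sqrt |Matrix.det (Matrix.of fun a b : Fin d =>
    S.metric ((chartAt (Coord d) p).symm z)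
      (mfderiv (𝓡 d) (𝓡 d) (chartAt (Coord d) p).symm z (EuclideanSpace.single a (1 : ℝ)))
      (mfderiv (𝓡 d) (𝓡 d) (chartAt (Coord d) p).symm z (EuclideanSpace.single b (1 : ℝ))))|

/-- The metric volume measure of the domain of the preferred chart at `p`, extended by zero to a
Borel measure on `M`. -/
def chartVolume (p : M) : @Measure M (borel M) :=
  letI : MeasurableSpace M := borel M
  Measure.map (chartAt (Coord d) p).symm
    (((volume : Measure (Coord d)).restrict (chartAt (Coord d) p).target).withDensity
      (fun z => ENNReal.ofReal (S.densityInChart p z)))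

/-- The metric volume measure `dvol_g`: the least Borel measure that dominates the local volume
measures. As these agree on chart overlaps, it restricts to each of them on its chart domain. -/
def volumeMeasure : @Measure M (borel M) :=
  letI : MeasurableSpace M := borel M
  ⨆ p : M, S.chartVolume p

end LorentzStructure

variable (d M) in
/-- The structure of a globally hyperbolic spacetime on the manifold `M`. -/
structure Spacetime extends LorentzStructure d M where
  no_closed_causal_curve : ∀ x, ¬ Relation.TransGen toLorentzStructure.CausalStep x x
  isCompact_diamond : ∀ K : Set M, IsCompact K →
    IsCompact (toLorentzStructure.JPlus K ∩ toLorentzStructure.JMinus K)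

/-- The fibrewise negative of a set of covectors. -/
def negCone (V : Set (CotangentBundle d M)) : Set (CotangentBundle d M) :=
  {ξ | (⟨ξ.proj, -ξ.2⟩ : CotangentBundle d M) ∈ V}

/-- A conic, relatively closed set `V^+` of nonzero covectors which is disjoint from `-V^+`. -/
structure IsPositiveCone (V : Set (CotangentBundle d M)) : Prop where
  ne_zero : ∀ ξ ∈ V, ξ.2 ≠ 0
  conic : ∀ ξ ∈ V, ∀ t : ℝ, 0 < t → (⟨ξ.proj, t • ξ.2⟩ : CotangentBundle d M) ∈ V
  relatively_closed : ∃ A : Set (CotangentBundle d M), IsClosed A ∧ V = A ∩ {ξ | ξ.2 ≠ 0}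
  disjoint_neg : Disjoint V (negCone V)

end Spacetimes

/-! ### Sections -/

/-- The (closed) support of a section of a family of vector spaces. -/
def dsupp {X : Type*} [TopologicalSpace X] {V : X → Type*} [∀ x, Zero (V x)] (f : ∀ x, V x) :
    Set X :=
  closure {x | f x ≠ 0}

section DSupp

variable {X : Type*} [TopologicalSpace X] {V : X → Type*} [∀ x, AddCommGroup (V x)]

theorem dsupp_mono {W : X → Type*} [∀ x, Zero (W x)] {f : ∀ x, V x} {g : ∀ x, W x}
    (h : ∀ x, f x = 0 → g x = 0) : dsupp g ⊆ dsupp f :=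
  closure_mono fun x hx hf => hx (h x hf)

theorem isCompact_dsupp_mono {W : X → Type*} [∀ x, Zero (W x)] {f : ∀ x, V x} {g : ∀ x, W x}
    (hf : IsCompact (dsupp f)) (h : ∀ x, f x = 0 → g x = 0) : IsCompact (dsupp g) :=
  hf.of_isClosed_subset isClosed_closure (dsupp_mono h)

theorem dsupp_add_subset (f g : ∀ x, V x) : dsupp (f + g) ⊆ dsupp f ∪ dsupp g := by
  unfold dsupp
  rw [← closure_union]
  refine closure_mono fun x hx => ?_
  by_contra hc
  simp only [Set.mem_union, Set.mem_ofPred_eq, not_or, not_not] at hc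
  exact hx (by simp [hc.1, hc.2])

theorem isCompact_dsupp_zero : IsCompact (dsupp (0 : ∀ x, V x)) := by
  simp [dsupp]

theorem isCompact_dsupp_add {f g : ∀ x, V x} (hf : IsCompact (dsupp f))
    (hg : IsCompact (dsupp g)) : IsCompact (dsupp (f + g)) :=
  (hf.union hg).of_isClosed_subset isClosed_closure (dsupp_add_subset f g)

end DSupp

section Bundles

variable (d : ℕ) {M : Type*} [TopologicalSpace M] [ChartedSpace (Coord d) M]
  [IsManifold (𝓡 d) ∞ M]
  (F : Type*) [NormedAddCommGroup F] [NormedSpace ℂ F]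
  (E : M → Type*) [∀ x, AddCommGroup (E x)] [∀ x, Module ℂ (E x)] [∀ x, TopologicalSpace (E x)]
  [TopologicalSpace (TotalSpace F E)] [FiberBundle F E] [VectorBundle ℂ F E] [VectorBundle ℝ F E]

/-- `Γ^∞(B)`: smooth sections, as a complex vector space. -/
def Sect : Submodule ℂ (∀ x, E x) where
  carrier := {s | ContMDiff (𝓡 d) ((𝓡 d).prod 𝓘(ℝ, F)) ∞ (fun x => TotalSpace.mk' F x (s x))}
  add_mem' hs ht := ContMDiff.add_section hs ht
  zero_mem' := contMDiff_zeroSection ℝ E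
  smul_mem' c s hs := by
    intro x
    have hx := hs x
    rw [contMDiffAt_section] at hx ⊢
    have h2 : ContMDiffAt (𝓡 d) 𝓘(ℝ, F) ∞
        (fun y => c • (trivializationAt F E x ⟨y, s y⟩).2) x :=
      (contDiff_const_smul (𝕜 := ℝ) (n := ∞) (F := F) c).contMDiff.contMDiffAt.comp x hx
    refine h2.congr_of_eventuallyEq ?_
    filter_upwards [(trivializationAt F E x).open_baseSet.mem_nhds
      (mem_baseSet_trivializationAt F E x)] with y hy
    exact ((trivializationAt F E x).linear ℂ hy).2 c (s y)

/-- `Γ_0^∞(B)`: smooth sections with compact support. -/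
def Sect₀ : Submodule ℂ (Sect d F E) where
  carrier := {s | IsCompact (dsupp s.1)}
  add_mem' hs ht := isCompact_dsupp_add hs ht
  zero_mem' := isCompact_dsupp_zero
  smul_mem' c s hs := isCompact_dsupp_mono (g := c • s.1) hs fun x hx => by simp [hx]

/-! Test sections on powers of `M`. A point of `M^n` is a function `Fin n → M`, a point of
`T^*(M^n)` is a function `Fin n → T^*M`, and the fibre of `(B^*)^{⊠n}` at `x` is the space of
multilinear forms on the product of the fibres `B_{x_1}, ..., B_{x_n}`. -/

/-- The model with corners of the manifold `M^n`. -/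
abbrev powModel (d n : ℕ) := ModelWithCorners.pi (fun _ : Fin n => 𝓡 d)

/-- `Γ^∞((B^*)^{⊠n})`: those sections of `(B^*)^{⊠n}` whose contraction with arbitrary smooth
sections of `B` is smooth. -/
def CoSect (n : ℕ) :
    Submodule ℂ (∀ x : Fin n → M, MultilinearMap ℂ (fun i => E (x i)) ℂ) where
  carrier := {T | ∀ s : Fin n → Sect d F E,
    ContMDiff (powModel d n) 𝓘(ℝ, ℂ) ∞ (fun x => T x (fun i => (s i).1 (x i)))}
  add_mem' hS hT s := by simpa using! (hS s).add (hT s)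
  zero_mem' s := by simpa using contMDiff_const
  smul_mem' c T hT s :=
    (contDiff_const_smul (𝕜 := ℝ) (n := ∞) (F := ℂ) c).contMDiff.comp (hT s)

/-- `Γ_0^∞((B^*)^{⊠n})`: smooth sections with compact support. -/
def CoSect₀ (n : ℕ) : Submodule ℂ (CoSect d F E n) where
  carrier := {T | IsCompact (dsupp T.1)}
  add_mem' hs ht := isCompact_dsupp_add hs ht
  zero_mem' := isCompact_dsupp_zero
  smul_mem' c s hs := isCompact_dsupp_mono (g := c • s.1) hs fun x hx => by simp [hx]

variable {d F E}

theorem contMDiff_powProj {n : ℕ} (i : Fin n) :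
    ContMDiff (powModel d n) (𝓡 d) ∞ (fun x : Fin n → M => x i) := by
  intro x
  rw [contMDiffAt_iff]
  refine ⟨(continuous_apply i).continuousAt, ?_⟩
  have h1 : ContDiffAt ℝ ∞ (fun z : Fin n → Coord d => z i)
      (extChartAt (powModel d n) x x) := by fun_prop
  refine (h1.congr_of_eventuallyEq ?_).contDiffWithinAt
  have hT : (extChartAt (powModel d n) x).target ∈ 𝓝 (extChartAt (powModel d n) x x) := by
    have hr : (Set.range (powModel d n)) = Set.univ := by
      ext z; simp; exact ⟨z, rfl⟩
    have h := extChartAt_target_mem_nhdsWithin (I := powModel d n) x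
    rwa [hr, nhdsWithin_univ] at h
  filter_upwards [hT] with z hz
  have hi := (extChartAt (𝓡 d) (x i)).right_inv (x := z i)
  exact hi (by
    simp [extChartAt, powModel, ModelWithCorners.pi] at hz ⊢
    exact hz i trivial)

/-! ### Hermitian vector bundles -/

variable (d F E) in
/-- A (nondegenerate, not necessarily definite) smooth hermitian fibre metric, antilinear in its
first argument, and a smooth antiunitary antilinear involution. -/
structure HermitianBundle where
  herm : ∀ x, E x →ₗ⋆[ℂ] E x →ₗ[ℂ] ℂ
  herm_symm : ∀ x v w, conj (herm x v w) = herm x w v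
  herm_nondegenerate : ∀ x v, (∀ w, herm x v w = 0) → v = 0
  herm_smooth : ∀ s t : Sect d F E,
    ContMDiff (𝓡 d) 𝓘(ℝ, ℂ) ∞ (fun x => herm x (s.1 x) (t.1 x))
  conjF : ∀ x, E x →ₗ⋆[ℂ] E x
  conjF_conjF : ∀ x v, conjF x (conjF x v) = v
  conjF_smooth : ∀ s : Sect d F E, (fun x => conjF x (s.1 x)) ∈ Sect d F E
  herm_conjF : ∀ x v w, herm x (conjF x v) (conjF x w) = conj (herm x v w)

namespace HermitianBundle

variable (B : HermitianBundle d F E)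

/-- The bilinear fibre metric `⟨v, w⟩ = (𝒞 v, w)`. -/
def bil (x : M) : E x →ₗ[ℂ] E x →ₗ[ℂ] ℂ :=
  LinearMap.mk₂ ℂ (fun v w => B.herm x (B.conjF x v) w)
    (by intros; simp) (by intros; simp) (by intros; simp) (by intros; simp)

/-- The complex conjugation of smooth sections. -/
def conjS (s : Sect d F E) : Sect d F E := ⟨fun x => B.conjF x (s.1 x), B.conjF_smooth s⟩

/-- The complex conjugation of test sections. -/
def conj₀ (f : Sect₀ d F E) : Sect₀ d F E :=
  ⟨B.conjS f.1, isCompact_dsupp_mono (g := (B.conjS f.1).1) f.2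
    fun x hx => by simp [conjS, hx]⟩

theorem conj₀_conj₀ (f : Sect₀ d F E) : B.conj₀ (B.conj₀ f) = f := by
  apply Subtype.ext
  apply Subtype.ext
  funext x
  exact B.conjF_conjF x _

/-- The sesquilinear pairing `(f, h) = ∫ (f(x), h(x))_x dvol_g(x)`. -/
def sesq (S : Spacetime d M) (f h : Sect d F E) : ℂ :=
  letI : MeasurableSpace M := borel M
  ∫ x, B.herm x (f.1 x) (h.1 x) ∂S.volumeMeasure

/-- The bilinear pairing `⟨f, h⟩ = ∫ ⟨f(x), h(x)⟩_x dvol_g(x)`. -/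
def pairing (S : Spacetime d M) (f h : Sect d F E) : ℂ :=
  letI : MeasurableSpace M := borel M
  ∫ x, B.bil x (f.1 x) (h.1 x) ∂S.volumeMeasure

/-- The external product `f_1^♯ ⊗ ... ⊗ f_n^♯`, which sends `(v_1, ..., v_n)` in the fibres over
`(x_1, ..., x_n)` to `⟨f_1(x_1), v_1⟩ ⋯ ⟨f_n(x_n), v_n⟩`. -/
def sharp {n : ℕ} (f : Fin n → Sect₀ d F E) : CoSect₀ d F E n :=
  ⟨⟨fun x => (MultilinearMap.mkPiAlgebra ℂ (Fin n) ℂ).compLinearMap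
      (fun i => B.bil (x i) ((f i).1.1 (x i))), by
    intro s
    have h : ∀ i : Fin n, ContMDiff (powModel d n) 𝓘(ℝ, ℂ) ∞
        (fun x : Fin n → M => B.bil (x i) ((f i).1.1 (x i)) ((s i).1 (x i))) := fun i =>
      (B.herm_smooth (B.conjS (f i).1) (s i)).comp (contMDiff_powProj i)
    have hp : ContDiff ℝ ∞ (fun z : Fin n → ℂ => ∏ i, z i) :=
      contDiff_prod fun i _ => contDiff_apply ℝ ℂ i
    simpa using! hp.contMDiff.comp (contMDiff_pi_space.2 h)⟩, by
    have hK : IsCompact (Set.univ.pi fun i => dsupp (f i).1.1) := isCompact_univ_pi fun i => (f i).2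
    refine hK.of_isClosed_subset isClosed_closure ?_
    refine closure_minimal ?_ (isClosed_set_pi fun i _ => isClosed_closure)
    intro x hx i _
    refine subset_closure fun h0 => hx ?_
    ext v
    have : ∏ j, B.bil (x j) ((f j).1.1 (x j)) (v j) = 0 :=
      Finset.prod_eq_zero (Finset.mem_univ i) (by rw [h0]; simp)
    simpa using this⟩

end HermitianBundle

/-! ### Differential operators -/

variable [ContMDiffVectorBundle ∞ F E (𝓡 d)]

/-- Multiplication of sections by a smooth real function. -/
def mulFun (h : C^∞⟮𝓡 d, M; 𝓘(ℝ, ℝ), ℝ⟯) : Sect d F E →ₗ[ℂ] Sect d F E where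
  toFun s := ⟨fun x => h x • s.1 x, ContMDiff.smul_section h.contMDiff s.2⟩
  map_add' s t := by
    apply Subtype.ext; funext x; exact smul_add _ _ _
  map_smul' c s := by
    apply Subtype.ext; funext x; exact smul_comm _ _ _

/-- Linear partial differential operators of order at most `m` with smooth coefficients, in
Grothendieck's form: all `(m+1)`-fold commutators with multiplications by smooth functions
vanish. -/
def IsDiffOp : ℕ → (Sect d F E →ₗ[ℂ] Sect d F E) → Prop
  | 0, P => ∀ h : C^∞⟮𝓡 d, M; 𝓘(ℝ, ℝ), ℝ⟯, P ∘ₗ mulFun h - mulFun h ∘ₗ P = 0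
  | m + 1, P => ∀ h : C^∞⟮𝓡 d, M; 𝓘(ℝ, ℝ), ℝ⟯, IsDiffOp m (P ∘ₗ mulFun h - mulFun h ∘ₗ P)

theorem IsDiffOp.apply_eq_zero_aux [T2Space M] {P : Sect d F E →ₗ[ℂ] Sect d F E}
    {s : Sect d F E} {x : M} (hs : ∀ᶠ y in 𝓝 x, s.1 y = 0)
    (hP : ∀ h : C^∞⟮𝓡 d, M; 𝓘(ℝ, ℝ), ℝ⟯,
      ((P ∘ₗ mulFun h - mulFun h ∘ₗ P) s).1 x = 0) :
    (P s).1 x = 0 := by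
  obtain ⟨b, -, hb⟩ := (SmoothBumpFunction.nhds_basis_support (I := 𝓡 d)
    (c := x) (s := {y | s.1 y = 0}) hs).mem_iff.1 hs
  let h : C^∞⟮𝓡 d, M; 𝓘(ℝ, ℝ), ℝ⟯ := ⟨b, b.contMDiff⟩
  have h0 : mulFun h s = 0 := by
    apply Subtype.ext; funext y
    change b y • s.1 y = 0
    by_cases hy : b y = 0
    · rw [hy, zero_smul]
    · have hsy : s.1 y = 0 := hb hy
      rw [hsy, smul_zero]
  have h1 : ((P ∘ₗ mulFun h - mulFun h ∘ₗ P) s).1 x = -(P s).1 x := by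
    have : (P ∘ₗ mulFun h - mulFun h ∘ₗ P) s = - mulFun h (P s) := by simp [h0]
    rw [this]
    change -(b x • (P s).1 x) = _
    rw [b.eq_one, one_smul]
  have h2 := hP h
  rw [h1, neg_eq_zero] at h2
  exact h2

/-- Differential operators are local. -/
theorem IsDiffOp.apply_eq_zero [T2Space M] {m : ℕ} {P : Sect d F E →ₗ[ℂ] Sect d F E}
    (hP : IsDiffOp m P) {s : Sect d F E} {x : M} (hs : ∀ᶠ y in 𝓝 x, s.1 y = 0) :
    (P s).1 x = 0 := by
  induction m generalizing P with
  | zero => exact IsDiffOp.apply_eq_zero_aux hs fun h => by rw [hP h]; rfl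
  | succ m ih => exact IsDiffOp.apply_eq_zero_aux hs fun h => ih (hP h)

theorem IsDiffOp.isCompact_dsupp [T2Space M] {m : ℕ} {P : Sect d F E →ₗ[ℂ] Sect d F E}
    (hP : IsDiffOp m P) {s : Sect d F E} (hs : IsCompact (dsupp s.1)) :
    IsCompact (dsupp (P s).1) := by
  refine hs.of_isClosed_subset isClosed_closure (closure_minimal ?_ isClosed_closure)
  intro x hx
  by_contra hc
  refine hx (hP.apply_eq_zero ?_)
  filter_upwards [isClosed_closure.isOpen_compl.mem_nhds hc] with y hy
  by_contra hne
  exact hy (subset_closure hne)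

/-! ### Green-hyperbolic operators -/

/-- A real, formally hermitian Green-hyperbolic operator, with its retarded (`Ep`) and advanced
(`Em`) Green operators, which are uniquely determined. As the operator coincides with its formal
transpose, no separate condition on the transpose is needed. -/
structure RFHGHO [T2Space M] (S : Spacetime d M) (B : HermitianBundle d F E) where
  P : Sect d F E →ₗ[ℂ] Sect d F E
  isDiffOp : ∃ m, IsDiffOp m P
  real : ∀ f, P (B.conjS f) = B.conjS (P f)
  formally_hermitian : ∀ f h : Sect d F E, IsCompact (dsupp f.1 ∩ dsupp h.1) →
    B.sesq S f (P h) = B.sesq S (P f) h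
  Ep : Sect₀ d F E →ₗ[ℂ] Sect d F E
  Em : Sect₀ d F E →ₗ[ℂ] Sect d F E
  P_Ep : ∀ f, P (Ep f) = f.1
  P_Em : ∀ f, P (Em f) = f.1
  Ep_P : ∀ f h : Sect₀ d F E, h.1 = P f.1 → Ep h = f.1
  Em_P : ∀ f h : Sect₀ d F E, h.1 = P f.1 → Em h = f.1
  supp_Ep : ∀ f, dsupp (Ep f).1 ⊆ S.JPlus (dsupp f.1.1)
  supp_Em : ∀ f, dsupp (Em f).1 ⊆ S.JMinus (dsupp f.1.1)

/-- A fermionic RFHGHO: a RFHGHO with a smooth fibrewise linear isomorphism `R` that is hermitian,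
anticommutes with complex conjugation and commutes with the operator. -/
structure FermionicRFHGHO [T2Space M] (S : Spacetime d M) (B : HermitianBundle d F E)
    extends RFHGHO S B where
  R : ∀ x, E x ≃ₗ[ℂ] E x
  R_smooth : ∀ s : Sect d F E, (fun x => R x (s.1 x)) ∈ Sect d F E
  R_hermitian : ∀ x v w, B.herm x v (R x w) = B.herm x (R x v) w
  R_conj : ∀ x v, R x (B.conjF x v) = -B.conjF x (R x v)
  R_comm : ∀ s : Sect d F E, P ⟨fun x => R x (s.1 x), R_smooth s⟩ =
    ⟨fun x => R x ((P s).1 x), R_smooth (P s)⟩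

namespace RFHGHO

variable [T2Space M] {S : Spacetime d M} {B : HermitianBundle d F E} (P : RFHGHO S B)

/-- The restriction of the operator to test sections. -/
def P₀ (f : Sect₀ d F E) : Sect₀ d F E := ⟨P.P f.1, P.isDiffOp.choose_spec.isCompact_dsupp f.2⟩

/-- The advanced-minus-retarded operator `E_P = E_P^- - E_P^+`. -/
def green : Sect₀ d F E →ₗ[ℂ] Sect d F E := P.Em - P.Ep

/-- The bilinear form `E_P(f, h) = ⟨f, E_P h⟩`. -/
def form (f h : Sect₀ d F E) : ℂ := B.pairing S f.1 (P.green h)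

end RFHGHO

/-- The action of `R` on test sections. -/
def FermionicRFHGHO.R₀ [T2Space M] {S : Spacetime d M} {B : HermitianBundle d F E}
    (Q : FermionicRFHGHO S B) (f : Sect₀ d F E) : Sect₀ d F E :=
  ⟨⟨fun x => Q.R x (f.1.1 x), Q.R_smooth f.1⟩,
    isCompact_dsupp_mono (g := fun x => Q.R x (f.1.1 x)) f.2 fun x hx => by simp [hx]⟩

end Bundles

/-! ### Field algebras -/

/-- Data for a field algebra on a space of test functions: a conjugation, an operator expressing
the equation of motion, a sign (`1` for commutators and `-1` for anticommutators) and a form. -/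
structure FieldData (V : Type*) where
  conjV : V → V
  conjV_conjV : ∀ f, conjV (conjV f) = f
  eom : V → V
  sign : ℤ
  form : V → V → ℂ

/-- The opposite of a complex algebra, with scalars acting through complex conjugation. -/
def OppConj (A : Type*) : Type _ := Aᵐᵒᵖ

instance (A : Type*) [Ring A] : Ring (OppConj A) := inferInstanceAs (Ring Aᵐᵒᵖ)

instance (A : Type*) [Ring A] [Algebra ℂ A] : Algebra ℂ (OppConj A) :=
  ((algebraMap ℂ Aᵐᵒᵖ).comp (starRingEnd ℂ)).toAlgebra' fun c x =>
    Algebra.commutes (A := Aᵐᵒᵖ) (conj c) x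

namespace FieldData

variable {V : Type*} (D : FieldData V)

/-- The antilinear antimultiplicative map of the free algebra that extends the conjugation of
the generators. -/
def starHom : FreeAlgebra ℂ V →ₐ[ℂ] OppConj (FreeAlgebra ℂ V) :=
  FreeAlgebra.lift ℂ (fun f => (MulOpposite.op (FreeAlgebra.ι ℂ (D.conjV f)) :
    (FreeAlgebra ℂ V)ᵐᵒᵖ))

/-- The star operation of the free algebra with `(ι f)^* = ι (𝒞 f)`. -/
def freeStar (a : FreeAlgebra ℂ V) : FreeAlgebra ℂ V :=
  MulOpposite.unop (show (FreeAlgebra ℂ V)ᵐᵒᵖ from D.starHom a)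

theorem freeStar_ι (f : V) : D.freeStar (FreeAlgebra.ι ℂ f) = FreeAlgebra.ι ℂ (D.conjV f) :=
  congrArg (fun a : OppConj (FreeAlgebra ℂ V) => MulOpposite.unop (α := FreeAlgebra ℂ V) a)
    (FreeAlgebra.lift_ι_apply (R := ℂ) (A := OppConj (FreeAlgebra ℂ V)) _ f)

theorem freeStar_add (a b : FreeAlgebra ℂ V) :
    D.freeStar (a + b) = D.freeStar a + D.freeStar b := by
  simp only [freeStar, map_add]; rfl

theorem freeStar_mul (a b : FreeAlgebra ℂ V) :
    D.freeStar (a * b) = D.freeStar b * D.freeStar a := by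
  simp only [freeStar, map_mul]; rfl

theorem freeStar_algebraMap (c : ℂ) :
    D.freeStar (algebraMap ℂ _ c) = algebraMap ℂ _ (conj c) := by
  simp only [freeStar, AlgHom.commutes]; rfl

theorem freeStar_freeStar (a : FreeAlgebra ℂ V) : D.freeStar (D.freeStar a) = a := by
  induction a with
  | grade0 c => simp [freeStar_algebraMap]
  | grade1 f => simp [freeStar_ι, D.conjV_conjV]
  | mul a b ha hb => rw [freeStar_mul, freeStar_mul, ha, hb]
  | add a b ha hb => rw [freeStar_add, freeStar_add, ha, hb]

/-- The free algebra on the symbols `Φ(f)` as a star ring with `Φ(f)^* = Φ(𝒞 f)`. -/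
@[reducible]
def freeStarRing : StarRing (FreeAlgebra ℂ V) where
  star := D.freeStar
  star_involutive := D.freeStar_freeStar
  star_mul := D.freeStar_mul
  star_add := D.freeStar_add

variable [AddCommGroup V] [Module ℂ V]

/-- The relations of the field algebra: complex linearity, the equation of motion, and the
(anti)commutation relations, together with the adjoints of all of these. -/
inductive Rel : FreeAlgebra ℂ V → FreeAlgebra ℂ V → Prop
  | add (f h : V) :
      Rel (FreeAlgebra.ι ℂ (f + h)) (FreeAlgebra.ι ℂ f + FreeAlgebra.ι ℂ h)
  | smul (c : ℂ) (f : V) : Rel (FreeAlgebra.ι ℂ (c • f)) (c • FreeAlgebra.ι ℂ f)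
  | eom (f : V) : Rel (FreeAlgebra.ι ℂ (D.eom f)) 0
  | comm (f h : V) :
      Rel (FreeAlgebra.ι ℂ f * FreeAlgebra.ι ℂ h - D.sign • (FreeAlgebra.ι ℂ h * FreeAlgebra.ι ℂ f))
        (algebraMap ℂ _ (Complex.I * D.form f h))
  | star (a b : FreeAlgebra ℂ V) : Rel a b → Rel (D.freeStar a) (D.freeStar b)

/-- The field algebra: the unital `*`-algebra generated by the symbols `Φ(f)` subject to the
relations. -/
def Alg : Type _ := RingQuot D.Rel

instance : Ring D.Alg := inferInstanceAs (Ring (RingQuot D.Rel))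

instance : Algebra ℂ D.Alg := inferInstanceAs (Algebra ℂ (RingQuot D.Rel))

instance : StarRing D.Alg :=
  @RingQuot.starRing (FreeAlgebra ℂ V) _ D.freeStarRing D.Rel fun a b h => Rel.star a b h

/-- The quotient map. -/
def quot : FreeAlgebra ℂ V →ₐ[ℂ] D.Alg := RingQuot.mkAlgHom ℂ D.Rel

/-- The generators `Φ(f)` of the field algebra. -/
def field (f : V) : D.Alg := D.quot (FreeAlgebra.ι ℂ f)

theorem star_quot (a : FreeAlgebra ℂ V) : star (D.quot a) = D.quot (D.freeStar a) := by
  have h (b : FreeAlgebra ℂ V) : D.quot b = (⟨Quot.mk _ b⟩ : RingQuot D.Rel) := by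
    have h1 : D.quot b = RingQuot.mkRingHom D.Rel b :=
      DFunLike.congr_fun (RingQuot.mkAlgHom_coe ℂ D.Rel) b
    rw [h1, RingQuot.mkRingHom_def]
    rfl
  rw [h, h]
  rfl

theorem star_field (f : V) : star (D.field f) = D.field (D.conjV f) := by
  rw [field, star_quot, freeStar_ι, field]

instance : StarModule ℂ D.Alg where
  star_smul c a := by
    obtain ⟨b, rfl⟩ : ∃ b, D.quot b = a := RingQuot.mkAlgHom_surjective ℂ D.Rel a
    rw [← map_smul, star_quot, star_quot, ← map_smul, Algebra.smul_def, freeStar_mul,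
      freeStar_algebraMap, ← Algebra.commutes, ← Algebra.smul_def]
    rfl

end FieldData
section Fields

variable {d : ℕ} {M : Type*} [TopologicalSpace M] [ChartedSpace (Coord d) M]
  [IsManifold (𝓡 d) ∞ M] [T2Space M]
  {F : Type*} [NormedAddCommGroup F] [NormedSpace ℂ F]
  {E : M → Type*} [∀ x, AddCommGroup (E x)] [∀ x, Module ℂ (E x)] [∀ x, TopologicalSpace (E x)]
  [TopologicalSpace (TotalSpace F E)] [FiberBundle F E] [VectorBundle ℂ F E] [VectorBundle ℝ F E]
  [ContMDiffVectorBundle ∞ F E (𝓡 d)]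
  {S : Spacetime d M} {B : HermitianBundle d F E}

/-- The data of the bosonic field algebra `𝒴(P)`: `[Υ(f), Υ(h)] = i E_P(f, h)`. -/
def RFHGHO.bosonic (P : RFHGHO S B) : FieldData (Sect₀ d F E) where
  conjV := B.conj₀
  conjV_conjV := B.conj₀_conj₀
  eom := P.P₀
  sign := 1
  form := P.form

/-- The data of the fermionic field algebra `𝒳(P)`: `{Ξ(f), Ξ(h)} = i E_P(f, R h)`. -/
def FermionicRFHGHO.fermionic (Q : FermionicRFHGHO S B) : FieldData (Sect₀ d F E) where
  conjV := B.conj₀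
  conjV_conjV := B.conj₀_conj₀
  eom := Q.P₀
  sign := -1
  form f h := Q.form f (Q.R₀ h)

end Fields

/-! ### States and Hilbert space representations -/

section States

/-- A state on a unital `*`-algebra: a normalised positive linear functional. -/
structure State (A : Type*) [Ring A] [Algebra ℂ A] [StarRing A] where
  toFun : A →ₗ[ℂ] ℂ
  map_one : toFun 1 = 1
  nonneg : ∀ a, 0 ≤ toFun (star a * a)

/-- A Hilbert space representation of a unital `*`-algebra on a dense domain `D`. -/
structure HilbertRep (A : Type*) [Ring A] [Algebra ℂ A] [StarRing A]
    (H : Type*) [NormedAddCommGroup H] [InnerProductSpace ℂ H] where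
  D : Submodule ℂ H
  dense : Dense (D : Set H)
  rep : A →ₗ[ℂ] (D →ₗ[ℂ] D)
  map_mul : ∀ a b ψ, rep (a * b) ψ = rep a (rep b ψ)
  map_one : rep 1 = LinearMap.id
  adjoint : ∀ (a : A) (φ ψ : D), inner ℂ (rep a φ : H) (ψ : H) = inner ℂ (φ : H) (rep (star a) ψ : H)

variable {A : Type*} [Ring A] [Algebra ℂ A] [StarRing A]
  {H : Type*} [NormedAddCommGroup H] [InnerProductSpace ℂ H]

/-- The vector state `ω_ψ(a) = ⟨ψ, π(a) ψ⟩`. -/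
def HilbertRep.vectorState (ρ : HilbertRep A H) (ψ : ρ.D) (hψ : ‖(ψ : H)‖ = 1) : State A where
  toFun := (innerₛₗ ℂ (ψ : H)) ∘ₗ ρ.D.subtype ∘ₗ (LinearMap.applyₗ ψ) ∘ₗ ρ.rep
  map_one := by simp [ρ.map_one, inner_self_eq_norm_sq_to_K, hψ]
  nonneg a := by
    have h2 := ρ.adjoint a ψ (ρ.rep a ψ)
    rw [← ρ.map_mul] at h2
    change 0 ≤ inner ℂ (ψ : H) (ρ.rep (star a * a) ψ : H)
    rw [← h2, inner_self_eq_norm_sq_to_K]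
    exact_mod_cast (RCLike.ofReal_nonneg (K := ℂ)).2 (sq_nonneg ‖(ρ.rep a ψ : H)‖)

/-- `(H, rep, D, φ)` is a GNS representation of `w`, with GNS vector `φ`. -/
structure HilbertRep.IsGNS (ρ : HilbertRep A H) (φ : ρ.D) (w : State A) : Prop where
  norm_eq_one : ‖(φ : H)‖ = 1
  apply_eq : ∀ a, w.toFun a = inner ℂ (φ : H) (ρ.rep a φ : H)
  cyclic : ∀ χ : ρ.D, ∃ a, ρ.rep a φ = χ

end States

/-! ### Distributions and wavefront sets -/

section Distributions

variable (d : ℕ) {M : Type*} [TopologicalSpace M] [ChartedSpace (Coord d) M]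
  [IsManifold (𝓡 d) ∞ M]
  (F : Type*) [NormedAddCommGroup F] [NormedSpace ℂ F]
  (E : M → Type*) [∀ x, AddCommGroup (E x)] [∀ x, Module ℂ (E x)] [∀ x, TopologicalSpace (E x)]
  [TopologicalSpace (TotalSpace F E)] [FiberBundle F E] [VectorBundle ℂ F E] [VectorBundle ℝ F E]

/-- The product coordinates on `M^n` given by the preferred charts at `y_1, ..., y_n`. -/
def coords {n : ℕ} (y x : Fin n → M) : Fin n → Coord d := fun i => chartAt (Coord d) (y i) (x i)

/-- The domain of the product coordinates. -/
def coordDomain {n : ℕ} (y : Fin n → M) : Set (Fin n → M) :=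
  {x | ∀ i, x i ∈ (chartAt (Coord d) (y i)).source}

/-- The coordinate expression of the component of `T` along the local frame vectors that
correspond to `v_1, ..., v_n` in the preferred trivializations at `y_1, ..., y_n`. -/
def localRep {n : ℕ} (y : Fin n → M)
    (T : ∀ x : Fin n → M, MultilinearMap ℂ (fun i => E (x i)) ℂ) (v : Fin n → F)
    (z : Fin n → Coord d) : ℂ :=
  T (fun i => (chartAt (Coord d) (y i)).symm (z i))
    (fun i => (trivializationAt F E (y i)).symm ((chartAt (Coord d) (y i)).symm (z i)) (v i))

/-- `𝒟'(B^{⊠n}; H)`: continuous linear maps from test sections of `(B^*)^{⊠n}` to `H`. Densities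
on `M^n` are written as functions times the metric volume density, so that a test section `T`
stands for the density-valued test section `T ⊗ (ρ ⊠ ... ⊠ ρ)`. Continuity is expressed by bounds
in terms of the sup norms of finitely many derivatives, for test sections with support in a fixed
compact subset of the domain of product coordinates and product trivializations. -/
structure Distr (n : ℕ) (H : Type*) [NormedAddCommGroup H] [NormedSpace ℂ H] where
  toFun : CoSect₀ d F E n →ₗ[ℂ] H
  continuous : ∀ (y : Fin n → M) (K : Set (Fin n → M)), IsCompact K →
    K ⊆ coordDomain d y ∩ {x | ∀ i, x i ∈ (trivializationAt F E (y i)).baseSet} →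
    ∃ (C : ℝ) (N : ℕ), ∀ T : CoSect₀ d F E n, dsupp T.1.1 ⊆ K → ∀ b : ℝ, 0 ≤ b →
      (∀ m ≤ N, ∀ x ∈ K, ∀ v : Fin n → F, (∀ i, ‖v i‖ ≤ 1) →
        ‖iteratedFDeriv ℝ m (localRep d F E y T.1.1 v) (coords d y x)‖ ≤ b) →
      ‖toFun T‖ ≤ C * b

variable {d F E}

/-- Smooth functions `χ` on `M^n` with compact support in the product coordinate domain at `y`. -/
structure Cutoff (d : ℕ) {M : Type*} [TopologicalSpace M] [ChartedSpace (Coord d) M] {n : ℕ}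
    (y : Fin n → M) where
  toFun : (Fin n → M) → ℂ
  smooth : ContMDiff (powModel d n) 𝓘(ℝ, ℂ) ∞ toFun
  compact : HasCompactSupport toFun
  support : tsupport toFun ⊆ coordDomain d y

/-- The oscillating function `e_k(x) = exp(i ∑_j k_j(X_j(x_j)))` in the product coordinates. -/
def wave {n : ℕ} (y : Fin n → M) (k : Fin n → (Coord d →L[ℝ] ℝ)) (x : Fin n → M) : ℂ :=
  Complex.exp (Complex.I * ((∑ j, k j (coords d y x j) : ℝ) : ℂ))

theorem Cutoff.contMDiff_mul_wave {n : ℕ} {y : Fin n → M} (χ : Cutoff d y)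
    (k : Fin n → (Coord d →L[ℝ] ℝ)) :
    ContMDiff (powModel d n) 𝓘(ℝ, ℂ) ∞ (fun x => χ.toFun x * wave y k x) := by
  refine contMDiff_of_tsupport fun x hx => ?_
  have hxd : x ∈ coordDomain d y := χ.support (tsupport_mul_subset_left hx)
  have hc : ∀ j : Fin n, ContMDiffAt (powModel d n) 𝓘(ℝ, Coord d) ∞
      (fun x : Fin n → M => coords d y x j) x := fun j =>
    ContMDiffAt.comp x (contMDiffOn_chart.contMDiffAt
      ((chartAt (Coord d) (y j)).open_source.mem_nhds (hxd j)))
      (contMDiff_powProj j).contMDiffAt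
  have hw : ContDiff ℝ ∞ (fun z : Fin n → Coord d =>
      Complex.exp (Complex.I * ((∑ j, k j (z j) : ℝ) : ℂ))) :=
    (contDiff_const.mul (Complex.ofRealCLM.contDiff.comp
      (g := fun r : ℝ => (r : ℂ)) (by fun_prop))).cexp
  have h1 : ContMDiffAt (powModel d n) 𝓘(ℝ, ℂ) ∞ (wave y k) x :=
    hw.contMDiff.contMDiffAt.comp x (contMDiffAt_pi_space.2 hc)
  have hm : ContDiff ℝ ∞ (fun p : ℂ × ℂ => p.1 * p.2) := contDiff_mul
  exact hm.contMDiff.contMDiffAt.comp x (χ.smooth.contMDiffAt.prodMk_space h1)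

/-- The test section `χ e_k T` for a smooth section `T` of `(B^*)^{⊠n}`. -/
def Cutoff.testSection {n : ℕ} {y : Fin n → M} (χ : Cutoff d y) (k : Fin n → (Coord d →L[ℝ] ℝ))
    (T : CoSect d F E n) : CoSect₀ d F E n :=
  ⟨⟨fun x => (χ.toFun x * wave y k x) • T.1 x, fun s => by
    have hm : ContDiff ℝ ∞ (fun p : ℂ × ℂ => p.1 * p.2) := contDiff_mul
    exact hm.contMDiff.comp ((χ.contMDiff_mul_wave k).prodMk_space (T.2 s))⟩,
    IsCompact.of_isClosed_subset χ.compact isClosed_closure <| closure_mono fun x hx => by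
      intro h0
      exact hx (by simp [h0])⟩

namespace Distr

variable {n : ℕ} {H : Type*} [NormedAddCommGroup H] [NormedSpace ℂ H]

/-- `ξ` is a regular directed point of the `H`-valued scalar distribution `f ↦ u(f T)`. -/
def RegularDirected (u : Distr d F E n H) (T : CoSect d F E n)
    (ξ : Fin n → CotangentBundle d M) : Prop :=
  ∃ χ : Cutoff d (fun i => (ξ i).proj), χ.toFun (fun i => (ξ i).proj) ≠ 0 ∧
    ∃ V : Set (Fin n → (Coord d →L[ℝ] ℝ)), IsOpen V ∧ (∀ k ∈ V, ∀ t : ℝ, 0 < t → t • k ∈ V) ∧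
      0 ∉ V ∧ (fun i => (ξ i).2) ∈ V ∧
      ∀ N : ℕ, ∃ C : ℝ, ∀ k ∈ V, (1 + ‖k‖ ^ N) * ‖u.toFun (χ.testSection k T)‖ ≤ C

/-- The wavefront set of an `H`-valued distributional section of `B^{⊠n}`, as a set of nonzero
elements of `T^*(M^n)`: the union over all smooth sections `T` of `(B^*)^{⊠n}` of the wavefront
sets of the scalar distributions `f ↦ u(f T)`. -/
def WF (u : Distr d F E n H) : Set (Fin n → CotangentBundle d M) :=
  {ξ | (∃ i, (ξ i).2 ≠ 0) ∧ ∃ T : CoSect d F E n, ¬ u.RegularDirected T ξ}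

/-- `u(f_1^♯ ⊗ ... ⊗ f_n^♯) = c(f_1, ..., f_n)` for all test sections `f_i` of `B`. -/
def Represents (u : Distr d F E n H) (B : HermitianBundle d F E)
    (c : (Fin n → Sect₀ d F E) → H) : Prop :=
  ∀ f, u.toFun (B.sharp f) = c f

end Distr

/-! ### Decomposability and Hadamard states -/

/-- The set `V × W` in `T^*(M × M)`. -/
def conePair (V W : Set (CotangentBundle d M)) : Set (Fin 2 → CotangentBundle d M) :=
  {ξ | ξ 0 ∈ V ∧ ξ 1 ∈ W}

/-- `V^±`-decomposability: the two-point distribution of `E_P` has its wavefront set in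
`(V^+ × V^-) ∪ (V^- × V^+)`. -/
def RFHGHO.IsDecomposable [ContMDiffVectorBundle ∞ F E (𝓡 d)] [T2Space M]
    {S : Spacetime d M} {B : HermitianBundle d F E} (P : RFHGHO S B)
    (V : Set (CotangentBundle d M)) : Prop :=
  ∃ u : Distr d F E 2 ℂ, u.Represents B (fun f => P.form (f 0) (f 1)) ∧
    u.WF ⊆ conePair V (negCone V) ∪ conePair (negCone V) V

namespace State

variable {D : FieldData (Sect₀ d F E)} (w : State D.Alg) (B : HermitianBundle d F E)

/-- The `n`-point correlators `ω(Φ(f_1) ⋯ Φ(f_n))`. -/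
def correlator (n : ℕ) (f : Fin n → Sect₀ d F E) : ℂ :=
  w.toFun (List.ofFn fun i => D.field (f i)).prod

/-- The state has distributional `n`-point functions. -/
def HasDistributionalNPoint : Prop :=
  ∀ n : ℕ, ∃ u : Distr d F E n ℂ, u.Represents B (w.correlator n)

/-- The state is `V^+`-Hadamard: it has distributional `n`-point functions and the wavefront set
of its two-point function is contained in `V^+ × V^-`. -/
def IsHadamard (V : Set (CotangentBundle d M)) : Prop :=
  w.HasDistributionalNPoint B ∧
    ∃ u : Distr d F E 2 ℂ, u.Represents B (w.correlator 2) ∧ u.WF ⊆ conePair V (negCone V)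

end State

/-- The `H`-valued map `f ↦ π(Φ(f)) ψ`. -/
def HilbertRep.fieldVector {D : FieldData (Sect₀ d F E)} {H : Type*} [NormedAddCommGroup H]
    [InnerProductSpace ℂ H] (ρ : HilbertRep D.Alg H) (ψ : ρ.D) (f : Fin 1 → Sect₀ d F E) : H :=
  (ρ.rep (D.field (f 0)) ψ : H)

/-- The subset of `T^*(M^1)` that corresponds to `V ⊆ T^*M`. -/
def coneOne (V : Set (CotangentBundle d M)) : Set (Fin 1 → CotangentBundle d M) := {ξ | ξ 0 ∈ V}

end Distributions

end HadamardQFT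
end

noncomputable section

set_option linter.unusedSectionVars false

namespace HadamardQFT

/-! ### Fourier series of compactly supported smooth functions -/

section FourierSeries

open Filter

variable {ι : Type*} [Fintype ι]

/-! Write u(f) = π(Φ(f))ψ. Since Φ(𝒞f)^* = Φ(f), the two-point function satisfies W(f, h) = ⟨u(𝒞f),
u(h)⟩ (`IsTwoPoint`). On the diagonal this reads ‖u(f)‖² = W(𝒞f, f), so the continuity bound of W on
external products yields, after a square root, one for u (`exists_vectorDistr`). Conjugation turns
the wave e_k into e_{-k}; hence W tested at frequencies (k₀, k₁) is an inner product of u tested at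
-k₀ with u tested at k₁ (`IsTwoPoint.toFun_testSection`).

If W is regular at ((p, -ζ), (p, ζ)), which holds whenever ζ is nonzero and not in V^-, restricting
to frequencies (-k, k) gives rapid decay of the square of the norm of u near ζ
(`IsTwoPoint.wF_vector_subset`).

Conversely, let WF(u) ⊆ V^-. By Cauchy–Schwarz, W is bounded by a product of two norms. One rapidly
decreasing factor with nonzero frequency component beats the polynomial growth of the other in a
suitable cone (`RapidNear.mul_polyBounded`). This settles every covector outside V^+ × V^- except
those with one zero component and the other in the allowed cone. For these the (anti)commutation
relation exchanges the two slots, where the product estimate does apply, at the cost of E_P, whose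
wavefront set contains no covector with a zero component (`IsTwoPoint.wF_subset`).

Two technical points carry the argument. Regularity provides one cutoff χ only, and it must pass to
every cutoff χ' with support where χ ≠ 0 (`rapidNear_of_tsupport_subset`): χ'/χ is a superposition
of plane waves with rapidly decreasing coefficients (`exists_hasSum_planeWave`), so testing with χ'
superposes translates in frequency of testing with χ, and this preserves rapid decay near a
direction (`RapidNear.of_tsum_translates`). Moreover, W is related to u on external products only,
so general sections of (B^*)^{⊠n} are first reduced to external products by local coframes
(`regularDirected_of_coProd`), and product cutoffs are used. -/

theorem summable_intVec_norm_pow_inv (n : ℕ) (hn : Fintype.card ι < n) :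
    Summable fun m : ι → ℤ => (‖m‖⁻¹ : ℝ) ^ n := by
  classical
  let b := (Pi.basisFun ℝ ι).restrictScalars ℤ
  have hr : Module.finrank ℤ (Submodule.span ℤ (Set.range (Pi.basisFun ℝ ι))) =
      Fintype.card ι := Module.finrank_eq_card_basis b
  have h := ZLattice.summable_norm_pow_inv
    (Submodule.span ℤ (Set.range (Pi.basisFun ℝ ι))) n (by rw [hr]; exact hn)
  have h2 := (b.equivFun.symm.toEquiv.summable_iff).2 h
  refine h2.congr fun m => ?_
  have h3 : ((b.equivFun.symm m : Submodule.span ℤ (Set.range (Pi.basisFun ℝ ι))) : ι → ℝ) =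
      fun i => (m i : ℝ) := by
    rw [Module.Basis.equivFun_symm_apply]
    ext i
    simp [b, Finset.sum_apply, Pi.single_apply]
  have h4 : ‖(fun i => (m i : ℝ) : ι → ℝ)‖ = ‖m‖ := by
    refine le_antisymm ?_ ?_ <;> refine (pi_norm_le_iff_of_nonneg (norm_nonneg _)).2 fun i => ?_
    · simpa [Int.norm_eq_abs] using norm_le_pi_norm m i
    · simpa [Int.norm_eq_abs] using norm_le_pi_norm (fun i => (m i : ℝ) : ι → ℝ) i
  simp only [Function.comp_apply, LinearEquiv.coe_toEquiv]
  rw [← h4, ← h3]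
  rfl

/-- The continuous function on the torus obtained from a function supported in a small cube. -/
theorem continuous_torusPeriodization {f : (ι → ℝ) → ℂ} (hf : Continuous f)
    (hs : ∀ w, f w ≠ 0 → ∀ j, |w j| ≤ 1 / 4) :
    Continuous fun t : UnitAddTorus ι =>
      f fun j => (AddCircle.equivIco (1 : ℝ) (-(1 / 2)) (t j) : ℝ) := by
  rw [continuous_iff_continuousAt]
  intro t
  -- The representative in [-1/2, 1/2) jumps only at the class of -1/2. A point with a coordinate
  -- there has a neighbourhood on which `f` vanishes, because the image `K` of [-1/4, 1/4] is closed
  -- and misses that class.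
  by_cases ht : ∀ j, t j ≠ ((-(1 / 2) : ℝ) : UnitAddCircle)
  · refine hf.continuousAt.comp (f := fun t : UnitAddTorus ι => fun j =>
      (AddCircle.equivIco (1 : ℝ) (-(1 / 2)) (t j) : ℝ)) (continuousAt_pi.2 fun j => ?_)
    exact continuousAt_subtype_val.comp (f := fun t : UnitAddTorus ι =>
      AddCircle.equivIco (1 : ℝ) (-(1 / 2)) (t j))
      (ContinuousAt.comp (f := fun t : UnitAddTorus ι => t j)
        (AddCircle.continuousAt_equivIco (1 : ℝ) (-(1 / 2)) (ht j))
        (continuous_apply j).continuousAt)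
  · push Not at ht
    obtain ⟨j, hj⟩ := ht
    let K : Set UnitAddCircle := (fun x : ℝ => (x : UnitAddCircle)) '' Set.Icc (-(1 / 4)) (1 / 4)
    have hK : IsClosed K :=
      (isCompact_Icc.image (AddCircle.continuous_mk' (1 : ℝ))).isClosed
    have hjK : t j ∉ K := by
      rintro ⟨x, hx, hxt⟩
      have h1 := congrArg (fun s => (AddCircle.equivIco (1 : ℝ) (-(1 / 2)) s : ℝ)) (hxt.trans hj)
      simp only at h1
      rw [AddCircle.equivIco_coe_of_mem (p := 1) (a := (-(1 / 2) : ℝ)) (y := x)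
        ⟨by linarith [hx.1], by linarith [hx.2]⟩,
        AddCircle.equivIco_coe_of_mem (p := 1) (a := (-(1 / 2) : ℝ)) (y := (-(1 / 2) : ℝ))
        ⟨le_rfl, by norm_num⟩] at h1
      linarith [hx.1]
    have hev : ∀ᶠ s : UnitAddTorus ι in 𝓝 t, s j ∉ K :=
      (continuous_apply j).continuousAt.eventually (hK.isOpen_compl.mem_nhds hjK)
    have hz : ∀ s : UnitAddTorus ι, s j ∉ K →
        f (fun j => (AddCircle.equivIco (1 : ℝ) (-(1 / 2)) (s j) : ℝ)) = 0 := by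
      intro s hsK
      by_contra hne
      have h2 := abs_le.1 (hs _ hne j)
      exact hsK ⟨_, ⟨h2.1, h2.2⟩, AddCircle.coe_equivIco⟩
    exact continuousAt_const.congr (f := fun _ => (0 : ℂ))
      (hev.mono fun s hsK => (hz s hsK).symm)

theorem mFourier_coe (m : ι → ℤ) (w : ι → ℝ) :
    UnitAddTorus.mFourier m (fun i => (w i : UnitAddCircle)) =
      Complex.exp (Complex.I * ((2 * Real.pi * ∑ i, m i * w i : ℝ) : ℂ)) := by
  change ∏ i, fourier (m i) (w i : UnitAddCircle) = _
  simp_rw [fourier_coe_apply]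
  rw [← Complex.exp_sum]
  congr 1
  push_cast
  rw [Finset.mul_sum, Finset.mul_sum]
  refine Finset.sum_congr rfl fun i _ => ?_
  ring

open UnitAddTorus in
-- The support lies inside one fundamental cube, so integrating over the torus is integrating over
-- the whole space.
theorem mFourierCoeff_torusPeriodization {f : (ι → ℝ) → ℂ}
    (hs : ∀ w, f w ≠ 0 → ∀ j, |w j| ≤ 1 / 4) (m : ι → ℤ) :
    mFourierCoeff (fun t : UnitAddTorus ι =>
      f fun j => (AddCircle.equivIco (1 : ℝ) (-(1 / 2)) (t j) : ℝ)) m =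
    ∫ w : ι → ℝ, Complex.exp (Complex.I * ((-(2 * Real.pi * ∑ i, m i * w i) : ℝ) : ℂ)) * f w := by
  rw [mFourierCoeff_eq_integral _ _ fun _ => -(1 / 2)]
  have hset : MeasurableSet {x : ι → ℝ | ∀ i, x i ∈ Set.Ioc (-(1 / 2) : ℝ) (-(1 / 2) + 1)} :=
    MeasurableSet.univ_pi' fun i => measurableSet_Ioc
  rw [← integral_indicator hset]
  have hae : ∀ᵐ w : ι → ℝ, True := Filter.Eventually.of_forall fun _ => trivial
  refine integral_congr_ae (hae.mono fun w _ => ?_)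
  by_cases hw : w ∈ {x : ι → ℝ | ∀ i, x i ∈ Set.Ioc (-(1 / 2) : ℝ) (-(1 / 2) + 1)}
  · rw [Set.indicator_of_mem hw]
    simp only [mFourier_coe, Pi.neg_apply, smul_eq_mul]
    congr 1
    · congr 3
      simp [Finset.sum_neg_distrib]
    -- The integral runs over (-1/2, 1/2] while representatives are taken in [-1/2, 1/2). They
    -- disagree only on the faces w_j = 1/2, where both values of `f` vanish.
    · by_cases hw2 : ∀ i, w i ∈ Set.Ico (-(1 / 2) : ℝ) (-(1 / 2) + 1)
      · congr 1
        ext i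
        exact AddCircle.equivIco_coe_of_mem (p := 1) (a := (-(1 / 2) : ℝ)) (hw2 i)
      · push Not at hw2
        obtain ⟨j, hj⟩ := hw2
        have hwj : w j = 1 / 2 := by
          by_contra hne
          refine hj ⟨(hw j).1.le, lt_of_le_of_ne (hw j).2 fun h => hne (by rw [h]; norm_num)⟩
        have hcoe : ((w j : ℝ) : UnitAddCircle) = ((-(1 / 2) : ℝ) : UnitAddCircle) := by
          rw [hwj]
          have : ((1 / 2 : ℝ) : UnitAddCircle) = (((-(1 / 2) : ℝ) + 1 : ℝ) : UnitAddCircle) := by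
            norm_num
          rw [this]
          exact AddCircle.coe_add_period (1 : ℝ) _
        have h1 : f w = 0 := by
          by_contra hne
          have := hs w hne j
          rw [hwj] at this
          norm_num [abs_of_pos] at this
        rw [h1]
        by_contra hne
        have := hs _ hne j
        simp only [hcoe] at this
        rw [AddCircle.equivIco_coe_of_mem (p := 1) (a := (-(1 / 2) : ℝ)) (y := (-(1 / 2) : ℝ))
          ⟨le_rfl, by norm_num⟩] at this
        norm_num [abs_of_neg] at this
  · rw [Set.indicator_of_notMem hw]
    have : f w = 0 := by
      by_contra hne
      refine hw fun i => ?_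
      have := abs_le.1 (hs w hne i)
      constructor <;> linarith [this.1, this.2]
    simp [this]

open FourierTransform in
-- The coefficients are the values of a Schwartz function, the Fourier transform of `f`, at integer
-- points, so they decrease rapidly; a continuous function on the torus with summable coefficients
-- is the pointwise sum of its Fourier series.
theorem hasSum_fourierSeries_cube (f : SchwartzMap (EuclideanSpace ℝ ι) ℂ)
    (hs : ∀ w, f w ≠ 0 → ∀ j, |w j| ≤ 1 / 4) :
    ∃ c : (ι → ℤ) → ℂ, (∀ N : ℕ, Summable fun m => ‖c m‖ * (1 + ‖m‖) ^ N) ∧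
      ∀ w : EuclideanSpace ℝ ι, (∀ j, |w j| ≤ 1 / 4) →
        HasSum (fun m => c m * Complex.exp (Complex.I * ((2 * Real.pi * ∑ i, m i * w i : ℝ) : ℂ)))
          (f w) := by
  let z : (ι → ℤ) → EuclideanSpace ℝ ι := fun m => WithLp.toLp 2 fun i => (m i : ℝ)
  have hz : ∀ m, ‖m‖ ≤ ‖z m‖ := by
    intro m
    refine (pi_norm_le_iff_of_nonneg (norm_nonneg _)).2 fun i => ?_
    have := PiLp.norm_apply_le (z m) i
    simpa [z, Int.norm_eq_abs] using this
  let g : (ι → ℝ) → ℂ := fun w => f (WithLp.toLp 2 w)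
  have hg : Continuous g := f.continuous.comp (PiLp.continuous_toLp 2 _)
  have hgs : ∀ w, g w ≠ 0 → ∀ j, |w j| ≤ 1 / 4 := fun w hw j => hs _ hw j
  have hc : ∀ m : ι → ℤ, UnitAddTorus.mFourierCoeff (fun t : UnitAddTorus ι =>
      g fun j => (AddCircle.equivIco (1 : ℝ) (-(1 / 2)) (t j) : ℝ)) m = 𝓕 f (z m) := by
    intro m
    rw [mFourierCoeff_torusPeriodization hgs, SchwartzMap.fourier_coe, Real.fourier_eq,
      ← (PiLp.volume_preserving_toLp ι).integral_comp
        (MeasurableEquiv.toLp 2 (ι → ℝ)).measurableEmbedding]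
    refine integral_congr_ae (Filter.Eventually.of_forall fun w => ?_)
    simp only [g, z, Circle.smul_def, Real.fourierChar_apply, smul_eq_mul]
    congr 2
    have : inner ℝ (WithLp.toLp 2 w) (WithLp.toLp 2 fun i => (m i : ℝ)) = ∑ i, m i * w i := by
      simp [PiLp.inner_apply, mul_comm]
    rw [this]
    push_cast
    ring
  have hsum : ∀ N : ℕ, Summable fun m => ‖𝓕 f (z m)‖ * (1 + ‖m‖) ^ N := by
    intro N
    set n := Fintype.card ι + 1
    -- Of the decay order `N + n`, the part `N` pays for the weight and `n`, one more than the
    -- dimension, makes the lattice sum converge.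
    obtain ⟨C1, hC1⟩ := (𝓕 f).decay' (N + n) 0
    obtain ⟨C0, hC0⟩ := (𝓕 f).decay' 0 0
    have hC1' : ∀ x, ‖x‖ ^ (N + n) * ‖𝓕 f x‖ ≤ C1 := fun x => by simpa using! hC1 x
    have hb := (summable_intVec_norm_pow_inv (ι := ι) n (by omega)).mul_left (2 ^ N * C1)
    refine Summable.of_norm_bounded_eventually hb ?_
    -- The majorant vanishes at m = 0, so the comparison is made off this one point.
    have h0 : ∀ᶠ m : ι → ℤ in Filter.cofinite, m ≠ 0 := by
      simp [Filter.eventually_cofinite]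
    filter_upwards [h0] with m hm
    have hm1 : 1 ≤ ‖m‖ := by
      obtain ⟨i, hi⟩ := Function.ne_iff.1 hm
      refine le_trans ?_ (norm_le_pi_norm m i)
      rw [Int.norm_eq_abs]
      exact_mod_cast Int.one_le_abs hi
    have hmpos : 0 < ‖m‖ := by linarith
    rw [Real.norm_of_nonneg (by positivity)]
    have h1 : (1 + ‖m‖) ^ N ≤ 2 ^ N * ‖m‖ ^ N := by
      rw [← mul_pow]; gcongr; linarith
    have h2 : ‖m‖ ^ (N + n) * ‖𝓕 f (z m)‖ ≤ C1 := le_trans (by gcongr; exact hz m) (hC1' (z m))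
    calc ‖𝓕 f (z m)‖ * (1 + ‖m‖) ^ N ≤ ‖𝓕 f (z m)‖ * (2 ^ N * ‖m‖ ^ N) := by gcongr
      _ = 2 ^ N * (‖m‖ ^ (N + n) * ‖𝓕 f (z m)‖) * ‖m‖⁻¹ ^ n := by
          rw [pow_add, inv_pow]; field_simp
      _ ≤ _ := by gcongr
  refine ⟨fun m => 𝓕 f (z m), hsum, fun w hw => ?_⟩
  let G : C(UnitAddTorus ι, ℂ) := ⟨_, continuous_torusPeriodization hg hgs⟩
  have hG : ∀ m, UnitAddTorus.mFourierCoeff G m = 𝓕 f (z m) := hc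
  have hS : Summable (UnitAddTorus.mFourierCoeff G) := by
    refine Summable.of_norm ?_
    simpa [hG] using! hsum 0
  have h := UnitAddTorus.hasSum_mFourier_series_apply_of_summable hS
    (fun i => (w i : UnitAddCircle))
  have hGw : G (fun i => (w i : UnitAddCircle)) = f w := by
    change f _ = f w
    congr 1
    ext i
    have := abs_le.1 (hw i)
    exact AddCircle.equivIco_coe_of_mem (p := 1) (a := (-(1 / 2) : ℝ))
      ⟨by linarith [this.1], by linarith [this.2]⟩
  rw [hGw] at h
  refine h.congr_fun fun m => ?_
  rw [hG, mFourier_coe, smul_eq_mul]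

end FourierSeries

/-! ### Rapid decay near a direction -/

section RapidDecay

variable {W W' : Type*} [NormedAddCommGroup W] [NormedSpace ℝ W] [NormedAddCommGroup W']
  [NormedSpace ℝ W']

/-- `g` decays rapidly in some open cone around `ξ`. -/
def RapidNear (g : W → ℝ) (ξ : W) : Prop :=
  ∃ V : Set W, IsOpen V ∧ (∀ k ∈ V, ∀ t : ℝ, 0 < t → t • k ∈ V) ∧ 0 ∉ V ∧ ξ ∈ V ∧
    ∀ N : ℕ, ∃ C : ℝ, ∀ k ∈ V, (1 + ‖k‖) ^ N * g k ≤ C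

/-- `g` grows at most polynomially. -/
def PolyBounded (g : W → ℝ) : Prop := ∃ (C : ℝ) (N : ℕ), ∀ k, g k ≤ C * (1 + ‖k‖) ^ N

theorem one_add_pow_le_mul {r : ℝ} (hr : 0 ≤ r) (N : ℕ) : (1 + r) ^ N ≤ 2 ^ N * (1 + r ^ N) := by
  rcases le_total r 1 with h | h
  · calc (1 + r) ^ N ≤ 2 ^ N := by gcongr; linarith
      _ ≤ _ := le_mul_of_one_le_right (by positivity) (by linarith [pow_nonneg hr N])
  · calc (1 + r) ^ N ≤ (2 * r) ^ N := by gcongr; linarith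
      _ = 2 ^ N * r ^ N := mul_pow _ _ _
      _ ≤ _ := by gcongr; linarith

theorem one_add_pow_le {r : ℝ} (hr : 0 ≤ r) (N : ℕ) : 1 + r ^ N ≤ 2 * (1 + r) ^ N := by
  have h1 : 1 ≤ (1 + r) ^ N := one_le_pow₀ (by linarith)
  have h2 : r ^ N ≤ (1 + r) ^ N := by gcongr; linarith
  linarith

/-- The two weights agree up to constants depending on `N`. The form (1 + ‖k‖)^N is kept because 1 +
‖k + e‖ ≤ (1 + ‖k‖)(1 + ‖e‖). -/
theorem rapidNear_iff {g : W → ℝ} (hg : ∀ k, 0 ≤ g k) {ξ : W} :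
    RapidNear g ξ ↔ ∃ V : Set W, IsOpen V ∧ (∀ k ∈ V, ∀ t : ℝ, 0 < t → t • k ∈ V) ∧
      0 ∉ V ∧ ξ ∈ V ∧ ∀ N : ℕ, ∃ C : ℝ, ∀ k ∈ V, (1 + ‖k‖ ^ N) * g k ≤ C := by
  constructor
  · rintro ⟨V, h1, h2, h3, h4, h5⟩
    refine ⟨V, h1, h2, h3, h4, fun N => ?_⟩
    obtain ⟨C, hC⟩ := h5 N
    refine ⟨2 * C, fun k hk => ?_⟩
    calc (1 + ‖k‖ ^ N) * g k ≤ 2 * (1 + ‖k‖) ^ N * g k := by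
          gcongr
          · exact hg k
          · exact one_add_pow_le (norm_nonneg k) N
      _ = 2 * ((1 + ‖k‖) ^ N * g k) := by ring
      _ ≤ _ := by gcongr; exact hC k hk
  · rintro ⟨V, h1, h2, h3, h4, h5⟩
    refine ⟨V, h1, h2, h3, h4, fun N => ?_⟩
    obtain ⟨C, hC⟩ := h5 N
    refine ⟨2 ^ N * C, fun k hk => ?_⟩
    calc (1 + ‖k‖) ^ N * g k ≤ 2 ^ N * (1 + ‖k‖ ^ N) * g k := by
          gcongr
          · exact hg k
          · exact one_add_pow_le_mul (norm_nonneg k) N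
      _ = 2 ^ N * ((1 + ‖k‖ ^ N) * g k) := by ring
      _ ≤ _ := by gcongr; exact hC k hk

namespace RapidNear

variable {g h : W → ℝ} {ξ : W}

theorem ne_zero (hg : RapidNear g ξ) : ξ ≠ 0 := by
  obtain ⟨V, -, -, h3, h4, -⟩ := hg
  rintro rfl
  exact h3 h4

theorem mono (hg : RapidNear g ξ) (hh : ∀ k, h k ≤ g k) : RapidNear h ξ := by
  obtain ⟨V, h1, h2, h3, h4, h5⟩ := hg
  refine ⟨V, h1, h2, h3, h4, fun N => ?_⟩
  obtain ⟨C, hC⟩ := h5 N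
  exact ⟨C, fun k hk => le_trans (by gcongr; exact hh k) (hC k hk)⟩

theorem zero (hξ : ξ ≠ 0) : RapidNear (fun _ : W => 0) ξ :=
  ⟨{k | k ≠ 0}, isOpen_ne, fun _ hk _ ht => smul_ne_zero ht.ne' hk, by simp, hξ,
    fun _ => ⟨0, by simp⟩⟩

theorem add (hg : RapidNear g ξ) (hh : RapidNear h ξ) : RapidNear (fun k => g k + h k) ξ := by
  obtain ⟨V, h1, h2, h3, h4, h5⟩ := hg
  obtain ⟨V', h1', h2', h3', h4', h5'⟩ := hh
  refine ⟨V ∩ V', h1.inter h1', fun k hk t ht => ⟨h2 k hk.1 t ht, h2' k hk.2 t ht⟩,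
    fun h0 => h3 h0.1, ⟨h4, h4'⟩, fun N => ?_⟩
  obtain ⟨C, hC⟩ := h5 N
  obtain ⟨C', hC'⟩ := h5' N
  refine ⟨C + C', fun k hk => ?_⟩
  rw [mul_add]
  exact add_le_add (hC k hk.1) (hC' k hk.2)

theorem sum {ι : Type*} (s : Finset ι) {f : ι → W → ℝ} (hξ : ξ ≠ 0)
    (hf : ∀ i ∈ s, RapidNear (f i) ξ) : RapidNear (fun k => ∑ i ∈ s, f i k) ξ := by
  classical
  induction s using Finset.induction_on with
  | empty => simpa using zero hξ
  | insert i s hi ih =>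
    simp_rw [Finset.sum_insert hi]
    exact (hf i (by simp)).add (ih fun j hj => hf j (by simp [hj]))

/-- Decay of order 2N of the square is decay of order N. -/
theorem of_sq (hg : RapidNear (fun k => g k ^ 2) ξ) : RapidNear g ξ := by
  obtain ⟨V, h1, h2, h3, h4, h5⟩ := hg
  refine ⟨V, h1, h2, h3, h4, fun N => ?_⟩
  obtain ⟨C, hC⟩ := h5 (2 * N)
  refine ⟨√C, fun k hk => Real.le_sqrt_of_sq_le ?_⟩
  calc ((1 + ‖k‖) ^ N * g k) ^ 2 = (1 + ‖k‖) ^ (2 * N) * g k ^ 2 := by ring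
    _ ≤ C := hC k hk

theorem comp_isometry {g : W' → ℝ} (L : W →ₗᵢ[ℝ] W') (hg : RapidNear g (L ξ)) :
    RapidNear (fun k => g (L k)) ξ := by
  obtain ⟨V, h1, h2, h3, h4, h5⟩ := hg
  refine ⟨L ⁻¹' V, h1.preimage L.continuous, fun k hk t ht => ?_, by simpa using h3, h4,
    fun N => ?_⟩
  · change L (t • k) ∈ V
    rw [map_smul]
    exact h2 _ hk t ht
  · obtain ⟨C, hC⟩ := h5 N
    exact ⟨C, fun k hk => by simpa using hC (L k) hk⟩

/-- As p ξ ≠ 0, the directions near ξ satisfy ‖x‖ ≤ c ‖p x‖. Rapid decay in p x is then rapid decay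
in x, and the growth of the other factor costs only finitely many orders. -/
theorem mul_polyBounded {X : Type*} [NormedAddCommGroup X] [NormedSpace ℝ X] {a : W' → ℝ}
    (p : X →L[ℝ] W) (q : X →L[ℝ] W') {ξ : X} (hq : ∀ x, ‖q x‖ ≤ ‖x‖) (ha : PolyBounded a)
    (hg0 : ∀ k, 0 ≤ g k) (hg : RapidNear g (p ξ)) :
    RapidNear (fun x => a (q x) * g (p x)) ξ := by
  have hpξ : 0 < ‖p ξ‖ := norm_pos_iff.2 hg.ne_zero
  obtain ⟨V, h1, h2, h3, h4, h5⟩ := hg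
  obtain ⟨C, P, hC⟩ := ha
  have hC0 : 0 ≤ |C| := abs_nonneg C
  -- The summand 1 makes ‖ξ‖ < c ‖p ξ‖ strict, so that ξ lies in the open cone.
  set c := ‖ξ‖ / ‖p ξ‖ + 1 with hc
  have hc1 : 1 ≤ c := by rw [hc]; have : 0 ≤ ‖ξ‖ / ‖p ξ‖ := by positivity
                         linarith
  refine ⟨{x | p x ∈ V ∧ ‖x‖ < c * ‖p x‖},
    (h1.preimage p.continuous).inter (isOpen_lt continuous_norm (by fun_prop)),
    fun x hx t ht => ⟨?_, ?_⟩, fun h0 => h3 (by simpa using h0.1), ⟨h4, ?_⟩, fun N => ?_⟩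
  · rw [map_smul]
    exact h2 _ hx.1 t ht
  · rw [map_smul, norm_smul, norm_smul, Real.norm_of_nonneg ht.le]
    nlinarith [hx.2]
  · rw [hc, add_mul, div_mul_cancel₀ _ hpξ.ne']
    linarith
  · obtain ⟨C', hC'⟩ := h5 (N + P)
    refine ⟨|C| * (c ^ (N + P) * C'), fun x hx => ?_⟩
    have hx1 : 1 + ‖x‖ ≤ c * (1 + ‖p x‖) := by nlinarith [hx.2]
    calc (1 + ‖x‖) ^ N * (a (q x) * g (p x))
        ≤ (1 + ‖x‖) ^ N * ((|C| * (1 + ‖x‖) ^ P) * g (p x)) := by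
          gcongr
          · exact hg0 _
          · refine (hC _).trans ?_
            gcongr
            · exact le_abs_self C
            · exact hq x
      _ = |C| * ((1 + ‖x‖) ^ (N + P) * g (p x)) := by rw [pow_add]; ring
      _ ≤ |C| * ((c * (1 + ‖p x‖)) ^ (N + P) * g (p x)) := by
          gcongr
          exact hg0 _
      _ = |C| * (c ^ (N + P) * ((1 + ‖p x‖) ^ (N + P) * g (p x))) := by rw [mul_pow]; ring
      _ ≤ _ := by gcongr; exact hC' _ hx.1

/-- Rapid decay near a direction is inherited by superpositions of translates with rapidly
decreasing coefficients. -/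
theorem of_tsum_translates {ι : Type*} {c : ι → ℝ} {η : ι → W} (hc0 : ∀ m, 0 ≤ c m)
    (hc : ∀ N : ℕ, Summable fun m => c m * (1 + ‖η m‖) ^ N) (hg0 : ∀ k, 0 ≤ g k)
    (hgp : PolyBounded g) (hg : RapidNear g ξ)
    (hh : ∀ k S, HasSum (fun m => c m * g (k + η m)) S → h k ≤ S) : RapidNear h ξ := by
  have hξ : 0 < ‖ξ‖ := norm_pos_iff.2 hg.ne_zero
  obtain ⟨V, h1, h2, h3, h4, h5⟩ := hg
  obtain ⟨C, P, hC⟩ := hgp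
  obtain ⟨r, hr, hball⟩ := Metric.isOpen_iff.1 h1 ξ h4
  -- If a positive multiple of k is within ε of ξ, its norm is at most ‖ξ‖ + ε. A shift of k by less
  -- than δ‖k‖ then moves the multiple by less than ε and keeps it in the ball of radius r = 2ε,
  -- hence in `V`.
  set ε := r / 2 with hε
  have hεp : 0 < ε := by positivity
  set δ := ε / (‖ξ‖ + ε) with hδ
  have hδp : 0 < δ := by positivity
  have hV0 : ∀ k, (∃ t : ℝ, 0 < t ∧ ‖t • k - ξ‖ < ε) → ∀ e : W, ‖e‖ < δ * ‖k‖ → k + e ∈ V := by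
    rintro k ⟨t, ht, htk⟩ e he
    have h6 : ‖t • k‖ ≤ ‖ξ‖ + ε := by
      have := norm_le_insert' (t • k) ξ
      linarith
    have h7 : t • (k + e) ∈ V := by
      apply hball
      rw [Metric.mem_ball, dist_eq_norm, smul_add]
      have h8 : ‖t • e‖ < ε := by
        rw [norm_smul, Real.norm_of_nonneg ht.le]
        rw [norm_smul, Real.norm_of_nonneg ht.le] at h6
        calc t * ‖e‖ < t * (δ * ‖k‖) := by gcongr
          _ = δ * (t * ‖k‖) := by ring
          _ ≤ δ * (‖ξ‖ + ε) := by gcongr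
          _ = ε := by rw [hδ]; field_simp
      calc ‖t • k + t • e - ξ‖ = ‖(t • k - ξ) + t • e‖ := by congr 1; abel
        _ ≤ ‖t • k - ξ‖ + ‖t • e‖ := norm_add_le _ _
        _ < r := by linarith
    have h9 := h2 _ h7 t⁻¹ (by positivity)
    rwa [smul_smul, inv_mul_cancel₀ ht.ne', one_smul] at h9
  refine ⟨({k | ∃ t : ℝ, 0 < t ∧ ‖t • k - ξ‖ < ε} ∩ V), ?_, ?_, fun h0 => h3 h0.2,
    ⟨⟨1, one_pos, by simpa using hεp⟩, h4⟩, fun N => ?_⟩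
  · refine IsOpen.inter ?_ h1
    have : {k : W | ∃ t : ℝ, 0 < t ∧ ‖t • k - ξ‖ < ε} =
        ⋃ t : ℝ, ⋃ _ : 0 < t, {k | ‖t • k - ξ‖ < ε} := by ext k; simp
    rw [this]
    exact isOpen_iUnion fun t => isOpen_iUnion fun _ => isOpen_lt (by fun_prop) continuous_const
  · rintro k ⟨⟨s, hs, hsk⟩, hkV⟩ t ht
    refine ⟨⟨s * t⁻¹, by positivity, ?_⟩, h2 k hkV t ht⟩
    rwa [smul_smul, mul_assoc, inv_mul_cancel₀ ht.ne', mul_one]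
  · obtain ⟨C', hC'⟩ := h5 N
    set A := |C'| + |C| * (δ⁻¹ + 1) ^ (N + P) with hA
    -- Two regimes. Shifts small compared with k stay in `V`, where `g` decays. For large shifts ‖k‖
    -- ≤ δ⁻¹‖e‖, so both the weight and the polynomial growth of `g` become powers of 1 + ‖e‖. These
    -- powers are absorbed by the coefficients.
    have key : ∀ k ∈ {k | ∃ t : ℝ, 0 < t ∧ ‖t • k - ξ‖ < ε} ∩ V, ∀ e : W,
        (1 + ‖k‖) ^ N * g (k + e) ≤ A * (1 + ‖e‖) ^ (N + P + P) := by
      intro k hk e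
      have hone : 1 ≤ 1 + ‖e‖ := by linarith [norm_nonneg e]
      by_cases he : ‖e‖ < δ * ‖k‖
      · have hke := hV0 k hk.1 e he
        have h6 : 1 + ‖k‖ ≤ (1 + ‖k + e‖) * (1 + ‖e‖) := by
          have h7 : ‖k‖ ≤ ‖k + e‖ + ‖e‖ := by
            simpa using norm_sub_le (k + e) e
          nlinarith [mul_nonneg (norm_nonneg (k + e)) (norm_nonneg e)]
        calc (1 + ‖k‖) ^ N * g (k + e)
            ≤ ((1 + ‖k + e‖) * (1 + ‖e‖)) ^ N * g (k + e) := by gcongr; exact hg0 _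
          _ = ((1 + ‖k + e‖) ^ N * g (k + e)) * (1 + ‖e‖) ^ N := by rw [mul_pow]; ring
          _ ≤ A * (1 + ‖e‖) ^ (N + P + P) := by
              gcongr
              · exact (hC' _ hke).trans ((le_abs_self _).trans (by
                  rw [hA]; exact le_add_of_nonneg_right (by positivity)))
              · omega
      · push Not at he
        have h6 : ‖k‖ ≤ δ⁻¹ * ‖e‖ := by rw [inv_mul_eq_div, le_div_iff₀ hδp]; linarith
        have h7 : 1 + ‖k‖ ≤ (δ⁻¹ + 1) * (1 + ‖e‖) := by
          have : 0 < δ⁻¹ := by positivity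
          nlinarith [norm_nonneg e]
        have h8 : 1 + ‖k + e‖ ≤ (1 + ‖k‖) * (1 + ‖e‖) := by
          nlinarith [norm_add_le k e, mul_nonneg (norm_nonneg k) (norm_nonneg e)]
        calc (1 + ‖k‖) ^ N * g (k + e)
            ≤ (1 + ‖k‖) ^ N * (|C| * ((1 + ‖k‖) * (1 + ‖e‖)) ^ P) := by
              gcongr
              refine (hC _).trans ?_
              gcongr
              exact le_abs_self C
          _ = |C| * (1 + ‖k‖) ^ (N + P) * (1 + ‖e‖) ^ P := by rw [mul_pow, pow_add]; ring
          _ ≤ |C| * ((δ⁻¹ + 1) * (1 + ‖e‖)) ^ (N + P) * (1 + ‖e‖) ^ P := by gcongr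
          _ = |C| * (δ⁻¹ + 1) ^ (N + P) * (1 + ‖e‖) ^ (N + P + P) := by
              rw [mul_pow, pow_add (1 + ‖e‖) (N + P) P]; ring
          _ ≤ _ := by
              gcongr
              rw [hA]
              exact le_add_of_nonneg_left (abs_nonneg _)
    refine ⟨∑' m, A * (c m * (1 + ‖η m‖) ^ (N + P + P)), fun k hk => ?_⟩
    have hpos : 0 < (1 + ‖k‖) ^ N := by positivity
    have hterm : ∀ m, (1 + ‖k‖) ^ N * (c m * g (k + η m)) ≤
        A * (c m * (1 + ‖η m‖) ^ (N + P + P)) := by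
      intro m
      have := mul_le_mul_of_nonneg_left (key k hk (η m)) (hc0 m)
      linarith
    have hsum := (hc (N + P + P)).mul_left A
    have hsum2 : Summable fun m => (1 + ‖k‖) ^ N * (c m * g (k + η m)) :=
      Summable.of_nonneg_of_le (fun m => mul_nonneg hpos.le (mul_nonneg (hc0 m) (hg0 _)))
        hterm hsum
    have hsum3 : Summable fun m => c m * g (k + η m) :=
      (summable_mul_left_iff hpos.ne').1 hsum2
    calc (1 + ‖k‖) ^ N * h k ≤ (1 + ‖k‖) ^ N * ∑' m, c m * g (k + η m) := by
          gcongr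
          exact hh k _ hsum3.hasSum
      _ = ∑' m, (1 + ‖k‖) ^ N * (c m * g (k + η m)) := tsum_mul_left.symm
      _ ≤ _ := hsum2.tsum_le_tsum hterm hsum

end RapidNear

end RapidDecay

/-! ### Functionals on smooth functions and plane waves -/

section PlaneWaves

variable {V : Type*} [NormedAddCommGroup V] [NormedSpace ℝ V]

/-- The plane wave `exp(i k(z))`. -/
def planeWave (k : V →L[ℝ] ℝ) (z : V) : ℂ := Complex.exp (Complex.I * (k z : ℂ))

theorem contDiff_planeWave (k : V →L[ℝ] ℝ) : ContDiff ℝ ∞ (planeWave k) :=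
  (contDiff_const.mul (Complex.ofRealCLM.contDiff.comp k.contDiff)).cexp

theorem planeWave_add (k l : V →L[ℝ] ℝ) (z : V) :
    planeWave (k + l) z = planeWave k z * planeWave l z := by
  simp [planeWave, mul_add, Complex.exp_add]

theorem norm_planeWave (k : V →L[ℝ] ℝ) (z : V) : ‖planeWave k z‖ = 1 := by
  rw [planeWave, mul_comm, Complex.norm_exp_ofReal_mul_I]

/-- The derivative of a plane wave is the wave times the constant form i k, so each derivative costs
one factor ‖k‖. -/
theorem norm_iteratedFDeriv_planeWave_le (k : V →L[ℝ] ℝ) (n : ℕ) (z : V) :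
    ‖iteratedFDeriv ℝ n (planeWave k) z‖ ≤ ‖k‖ ^ n := by
  induction n with
  | zero => simp [norm_planeWave]
  | succ n ih =>
    let A : V →L[ℝ] ℂ := Complex.I • (Complex.ofRealCLM ∘L k)
    have hA : ‖A‖ ≤ ‖k‖ := by
      refine ContinuousLinearMap.opNorm_le_bound _ (norm_nonneg _) fun v => ?_
      simpa [A] using k.le_opNorm v
    let L : ℂ →L[ℝ] (V →L[ℝ] ℂ) := (ContinuousLinearMap.lsmul ℝ ℂ (E := V →L[ℝ] ℂ)).flip A
    have hL : ‖L‖ ≤ ‖k‖ := by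
      refine ContinuousLinearMap.opNorm_le_bound _ (norm_nonneg _) fun v => ?_
      simp only [L, ContinuousLinearMap.flip_apply, ContinuousLinearMap.lsmul_apply, norm_smul]
      rw [mul_comm]
      gcongr
    have hd : fderiv ℝ (planeWave k) = L ∘ planeWave k := by
      funext z
      have h1 : HasFDerivAt (fun z : V => Complex.I * (k z : ℂ)) A z := A.hasFDerivAt
      exact h1.cexp.fderiv
    rw [← norm_iteratedFDeriv_fderiv, hd]
    have := L.norm_iteratedFDeriv_comp_left (f := planeWave k) (x := z) (N := ∞)
      (contDiff_planeWave k).contDiffAt (n := n) (by exact_mod_cast le_top)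
    refine this.trans ?_
    rw [pow_succ']
    gcongr

variable [FiniteDimensional ℝ V]

/-- After rescaling, both `K` and the support of `φ` lie in the cube where the Fourier series
represents the function. The frequencies depend linearly on the lattice point, so rapid decay of the
coefficients also holds against weights in η. -/
theorem exists_hasSum_planeWave {φ : V → ℂ} (hφ : ContDiff ℝ ∞ φ) (hs : HasCompactSupport φ)
    {K : Set V} (hK : IsCompact K) :
    ∃ (c : (Fin (Module.finrank ℝ V) → ℤ) → ℂ)
      (η : (Fin (Module.finrank ℝ V) → ℤ) → (V →L[ℝ] ℝ)),
      (∀ N : ℕ, Summable fun m => ‖c m‖ * (1 + ‖η m‖) ^ N) ∧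
      ∀ z ∈ K, HasSum (fun m => c m * planeWave (η m) z) (φ z) := by
  let e := toEuclidean (E := V)
  obtain ⟨R, hRp, hR⟩ := ((hK.union hs).image e.continuous).isBounded.exists_pos_norm_le
  have hRK : ∀ z ∈ K, ‖e z‖ ≤ R := fun z hz => hR _ ⟨z, Or.inl hz, rfl⟩
  have hRs : ∀ z, φ z ≠ 0 → ‖e z‖ ≤ R := fun z hz => hR _ ⟨z, Or.inr (subset_tsupport _ hz), rfl⟩
  have h4R : (4 * R) ≠ 0 := by positivity
  -- `R` bounds `K` and the support of `φ` in Euclidean coordinates; dividing by 4R brings both into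
  -- the cube |w_j| ≤ 1/4.
  let L : EuclideanSpace ℝ (Fin (Module.finrank ℝ V)) ≃L[ℝ] V :=
    (ContinuousLinearEquiv.smulLeft (Units.mk0 (4 * R) h4R)).trans e.symm
  have hL : ∀ w, L w = e.symm ((4 * R) • w) := fun w => rfl
  let f : SchwartzMap (EuclideanSpace ℝ (Fin (Module.finrank ℝ V))) ℂ :=
    HasCompactSupport.toSchwartzMap (f := φ ∘ L) (hs.comp_homeomorph L.toHomeomorph)
      (hφ.comp L.contDiff)
  have hf : ∀ w, f w = φ (L w) := fun w => rfl
  obtain ⟨c, hc, hsum⟩ := hasSum_fourierSeries_cube f (by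
    intro w hw j
    have h1 := hRs (L w) (by rwa [hf] at hw)
    rw [hL, ContinuousLinearEquiv.apply_symm_apply, norm_smul,
      Real.norm_of_nonneg (by positivity)] at h1
    have h2 : ‖w j‖ ≤ ‖w‖ := PiLp.norm_apply_le w j
    rw [Real.norm_eq_abs] at h2
    nlinarith)
  let η : (Fin (Module.finrank ℝ V) → ℤ) → (V →L[ℝ] ℝ) := fun m =>
    (2 * Real.pi * (4 * R)⁻¹) • ∑ i, (m i : ℝ) • ((EuclideanSpace.proj i :
      EuclideanSpace ℝ (Fin (Module.finrank ℝ V)) →L[ℝ] ℝ) ∘L (e : V →L[ℝ] _))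
  set B := (2 * Real.pi * (4 * R)⁻¹) * ∑ i, ‖((EuclideanSpace.proj i :
      EuclideanSpace ℝ (Fin (Module.finrank ℝ V)) →L[ℝ] ℝ) ∘L (e : V →L[ℝ] _))‖ with hB
  have hB0 : 0 ≤ B := by positivity
  have hη : ∀ m, ‖η m‖ ≤ B * ‖m‖ := by
    intro m
    rw [norm_smul, Real.norm_of_nonneg (by positivity), hB, mul_assoc (2 * Real.pi * (4 * R)⁻¹)]
    refine mul_le_mul_of_nonneg_left ?_ (by positivity)
    refine (norm_sum_le _ _).trans ?_
    rw [Finset.sum_mul]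
    refine Finset.sum_le_sum fun i _ => ?_
    rw [norm_smul, mul_comm]
    gcongr
    simpa [Int.norm_eq_abs] using norm_le_pi_norm m i
  refine ⟨c, η, fun N => ?_, fun z hz => ?_⟩
  · refine Summable.of_nonneg_of_le (fun m => by positivity) (fun m => ?_)
      ((hc N).mul_left ((1 + B) ^ N))
    have h1 : 1 + ‖η m‖ ≤ (1 + B) * (1 + ‖m‖) := by nlinarith [hη m, norm_nonneg m]
    calc ‖c m‖ * (1 + ‖η m‖) ^ N ≤ ‖c m‖ * ((1 + B) * (1 + ‖m‖)) ^ N := by gcongr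
      _ = _ := by rw [mul_pow]; ring
  · have h := hsum (L.symm z) (by
      intro j
      have h1 : L.symm z = (4 * R)⁻¹ • e z := by
        apply L.injective
        rw [L.apply_symm_apply, hL, smul_smul, mul_inv_cancel₀ h4R, one_smul, e.symm_apply_apply]
      have h2 : ‖(e z) j‖ ≤ ‖e z‖ := PiLp.norm_apply_le (e z) j
      have h3 := hRK z hz
      rw [Real.norm_eq_abs] at h2
      rw [h1, PiLp.smul_apply, smul_eq_mul, abs_mul, abs_of_pos (by positivity),
        inv_mul_le_iff₀ (by positivity)]
      linarith)
    rw [hf, L.apply_symm_apply] at h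
    refine h.congr_fun fun m => ?_
    have h1 : L.symm z = (4 * R)⁻¹ • e z := by
      apply L.injective
      rw [L.apply_symm_apply, hL, smul_smul, mul_inv_cancel₀ h4R, one_smul, e.symm_apply_apply]
    rw [h1, planeWave]
    congr 4
    simp only [η, smul_apply, sum_apply, smul_eq_mul,
      PiLp.smul_apply, ContinuousLinearMap.comp_apply, PiLp.proj_apply,
      ContinuousLinearEquiv.coe_coe, Finset.mul_sum]
    refine Finset.sum_congr rfl fun i _ => ?_
    ring

end PlaneWaves

section Functionals

variable (V : Type*) [NormedAddCommGroup V] [NormedSpace ℝ V]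

/-- Smooth complex-valued functions on a normed space. -/
def smoothFun : Submodule ℂ (V → ℂ) where
  carrier := {g | ContDiff ℝ ∞ g}
  add_mem' {f g} hf hg := ContDiff.add (𝕜 := ℝ) (n := ∞) (f := f) (g := g) hf hg
  zero_mem' := contDiff_const (𝕜 := ℝ) (n := ∞) (E := V) (c := (0 : ℂ))
  smul_mem' c f hf := ContDiff.mul (𝕜 := ℝ) (n := ∞) (f := fun _ => c) (g := f) contDiff_const hf

variable {V} {H : Type*} [NormedAddCommGroup H] [NormedSpace ℂ H]

/-- A functional on smooth functions which is bounded by finitely many derivatives and depends only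
on the values on `K`. -/
structure IsLocalFunctional (Λ : smoothFun V →ₗ[ℂ] H) (K : Set V) : Prop where
  congr : ∀ f g : smoothFun V, (∀ z ∈ K, f.1 z = g.1 z) → Λ f = Λ g
  bound : ∃ (C : ℝ) (N : ℕ), ∀ (g : smoothFun V) (b : ℝ), 0 ≤ b →
    (∀ m ≤ N, ∀ z, ‖iteratedFDeriv ℝ m g.1 z‖ ≤ b) → ‖Λ g‖ ≤ C * b

/-- Plane waves as smooth functions. -/
def planeWaveFun (k : V →L[ℝ] ℝ) : smoothFun V := ⟨planeWave k, contDiff_planeWave k⟩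

theorem pow_le_one_add_pow {r : ℝ} (hr : 0 ≤ r) {j N : ℕ} (h : j ≤ N) : r ^ j ≤ (1 + r) ^ N :=
  (pow_le_pow_left₀ hr (by linarith) j).trans (pow_le_pow_right₀ (by linarith) h)

/-- The order of the functional bounds the degree of growth, since m derivatives of e_k cost ‖k‖^m.
-/
theorem IsLocalFunctional.polyBounded {Λ : smoothFun V →ₗ[ℂ] H} {K : Set V}
    (hΛ : IsLocalFunctional Λ K) : PolyBounded fun k => ‖Λ (planeWaveFun k)‖ := by
  obtain ⟨C, N, hC⟩ := hΛ.bound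
  refine ⟨C, N, fun k => hC _ _ (by positivity) fun m hm z => ?_⟩
  exact (norm_iteratedFDeriv_planeWave_le k m z).trans (pow_le_one_add_pow (norm_nonneg k) hm)

/-- A functional of order N passes through the series because the tails tend to zero in the norm of
N derivatives, uniformly on the whole space. -/
theorem IsLocalFunctional.hasSum_planeWave {Λ : smoothFun V →ₗ[ℂ] H} {K : Set V}
    (hΛ : IsLocalFunctional Λ K) {ι : Type*} {c : ι → ℂ} {η : ι → (V →L[ℝ] ℝ)}
    (hc : ∀ N : ℕ, Summable fun m => ‖c m‖ * (1 + ‖η m‖) ^ N) {φ : V → ℂ}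
    (hφ : ∀ z ∈ K, HasSum (fun m => c m * planeWave (η m) z) (φ z)) (k : V →L[ℝ] ℝ)
    (g : smoothFun V) (hg : ∀ z ∈ K, g.1 z = φ z * planeWave k z) :
    HasSum (fun m => c m • Λ (planeWaveFun (k + η m))) (Λ g) := by
  obtain ⟨C, N, hC⟩ := hΛ.bound
  let v : ℕ → ι → ℝ := fun N m => ‖c m‖ * (1 + ‖k + η m‖) ^ N
  have hv : ∀ N, Summable (v N) := by
    intro N
    refine Summable.of_nonneg_of_le (fun m => by positivity) (fun m => ?_)
      ((hc N).mul_left ((1 + ‖k‖) ^ N))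
    have h8 : 1 + ‖k + η m‖ ≤ (1 + ‖k‖) * (1 + ‖η m‖) := by
      nlinarith [norm_add_le k (η m), mul_nonneg (norm_nonneg k) (norm_nonneg (η m))]
    calc v N m ≤ ‖c m‖ * ((1 + ‖k‖) * (1 + ‖η m‖)) ^ N := by simp only [v]; gcongr
      _ = _ := by rw [mul_pow]; ring
  let f : ι → V → ℂ := fun m z => c m * planeWave (k + η m) z
  have hf : ∀ m, ContDiff ℝ ∞ (f m) := fun m => contDiff_const.mul (contDiff_planeWave _)
  have hfb : ∀ (j N : ℕ) (m : ι) (z : V), j ≤ N → ‖iteratedFDeriv ℝ j (f m) z‖ ≤ v N m := by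
    intro j N m z hj
    have h1 : iteratedFDeriv ℝ j (f m) z = c m • iteratedFDeriv ℝ j (planeWave (k + η m)) z := by
      have := iteratedFDeriv_const_smul_apply (𝕜 := ℝ) (i := j) (a := c m) (x := z)
        (f := planeWave (k + η m))
        ((contDiff_planeWave _).of_le (by exact_mod_cast le_top)).contDiffAt
      exact this
    rw [h1, norm_smul]
    simp only [v]
    gcongr
    exact (norm_iteratedFDeriv_planeWave_le _ j z).trans (pow_le_one_add_pow (norm_nonneg _) hj)
  have hsub : ∀ (s : Finset ι) (N : ℕ), Summable fun m : {m // m ∉ s} => v N m :=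
    fun s N => (hv N).subtype _
  -- The tail is a global smooth function that equals the remainder of `g` on `K` only; locality of
  -- `Λ` makes this enough.
  let G : Finset ι → V → ℂ := fun s z => ∑' m : {m // m ∉ s}, f m z
  have hG : ∀ s, ContDiff ℝ ∞ (G s) := fun s =>
    contDiff_tsum (N := ⊤) (f := fun (m : {m // m ∉ s}) z => f m z)
      (v := fun j m => v j m) (fun m => hf m) (fun j _ => hsub s j)
      (fun j m z _ => hfb j j m z le_rfl)
  have hGb : ∀ s, ∀ j ≤ N, ∀ z, ‖iteratedFDeriv ℝ j (G s) z‖ ≤ ∑' m : {m // m ∉ s}, v N m := by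
    intro s j hj z
    have h1 := iteratedFDeriv_tsum_apply (𝕜 := ℝ) (N := ⊤)
      (f := fun (m : {m // m ∉ s}) z => f m z)
      (v := fun j m => v j m) (fun m => hf m)
      (fun j _ => hsub s j) (fun j m z _ => hfb j j m z le_rfl) (k := j) le_top z
    simp only [G]
    rw [h1]
    exact tsum_of_norm_bounded (hsub s N).hasSum fun m => hfb j N m z hj
  have hdiff : ∀ s : Finset ι,
      Λ g - ∑ m ∈ s, c m • Λ (planeWaveFun (k + η m)) = Λ ⟨G s, hG s⟩ := by
    intro s
    simp_rw [← map_smul, ← map_sum, ← map_sub]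
    refine hΛ.congr _ _ fun z hz => ?_
    have h1 : HasSum (fun m => f m z) (g.1 z) := by
      rw [hg z hz]
      refine ((hφ z hz).mul_right (planeWave k z)).congr_fun fun m => ?_
      simp only [f, planeWave_add]
      ring
    have h2 := h1.summable.sum_add_tsum_subtype_compl s
    rw [h1.tsum_eq] at h2
    have h3 : ((g - ∑ m ∈ s, c m • planeWaveFun (k + η m) : smoothFun V) : V → ℂ) z =
        g.1 z - ∑ m ∈ s, f m z := by
      simp [f, planeWaveFun, Finset.sum_apply]
    rw [h3, ← h2]
    simp [G]
  have hlim : Filter.Tendsto (fun s : Finset ι => C * ∑' m : {m // m ∉ s}, v N m)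
      Filter.atTop (𝓝 0) := by
    simpa using (tendsto_tsum_compl_atTop_zero (v N)).const_mul C
  rw [HasSum]
  rw [tendsto_iff_norm_sub_tendsto_zero]
  refine squeeze_zero (fun s => norm_nonneg _) (fun s => ?_) hlim
  rw [norm_sub_rev]
  rw [hdiff s]
  exact hC _ _ (tsum_nonneg fun m => by positivity) (hGb s)

end Functionals

/-! ### Bounds for derivatives of products and compositions -/

section DerivativeBounds

variable {V V' : Type*} [NormedAddCommGroup V] [NormedSpace ℝ V] [NormedAddCommGroup V']
  [NormedSpace ℝ V'] {G : Type*} [NormedAddCommGroup G] [NormedSpace ℝ G]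

theorem exists_norm_iteratedFDeriv_le {O K : Set V} (hO : IsOpen O) {A : V → G}
    (hA : ContDiffOn ℝ ∞ A O) (hK : IsCompact K) (hKO : K ⊆ O) (N : ℕ) :
    ∃ B : ℝ, 0 ≤ B ∧ ∀ m ≤ N, ∀ z ∈ K, ‖iteratedFDeriv ℝ m A z‖ ≤ B := by
  have h1 : ∀ m : ℕ, ∃ B : ℝ, 0 ≤ B ∧ ∀ z ∈ K, ‖iteratedFDeriv ℝ m A z‖ ≤ B := by
    intro m
    have hc := hA.continuousOn_iteratedFDerivWithin (m := m) (by exact_mod_cast le_top)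
      hO.uniqueDiffOn
    obtain ⟨B, hB⟩ := hK.exists_bound_of_continuousOn (hc.mono hKO)
    refine ⟨|B|, abs_nonneg B, fun z hz => ?_⟩
    rw [← iteratedFDerivWithin_of_isOpen m hO (hKO hz)]
    exact (hB z hz).trans (le_abs_self B)
  choose B hB0 hB using h1
  refine ⟨∑ m ∈ Finset.range (N + 1), B m, Finset.sum_nonneg fun m _ => hB0 m,
    fun m hm z hz => (hB m z hz).trans ?_⟩
  exact Finset.single_le_sum (f := B) (fun m _ => hB0 m) (Finset.mem_range.2 (by omega))

theorem norm_iteratedFDeriv_mul_le_of_le {O : Set V} (hO : IsOpen O) {A B : V → ℂ}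
    (hA : ContDiffOn ℝ ∞ A O) (hB : ContDiffOn ℝ ∞ B O) {z : V} (hz : z ∈ O) {N : ℕ} {a b : ℝ}
    (ha : ∀ m ≤ N, ‖iteratedFDeriv ℝ m A z‖ ≤ a) (hb : ∀ m ≤ N, ‖iteratedFDeriv ℝ m B z‖ ≤ b) :
    ∀ m ≤ N, ‖iteratedFDeriv ℝ m (fun y => A y * B y) z‖ ≤ 2 ^ N * (a * b) := by
  intro m hm
  have ha0 : 0 ≤ a := (norm_nonneg _).trans (ha 0 (Nat.zero_le _))
  have hb0 : 0 ≤ b := (norm_nonneg _).trans (hb 0 (Nat.zero_le _))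
  have h := norm_iteratedFDerivWithin_mul_le hA hB hO.uniqueDiffOn hz (n := m)
    (by exact_mod_cast le_top)
  simp only [iteratedFDerivWithin_of_isOpen _ hO hz] at h
  refine h.trans ?_
  calc ∑ i ∈ Finset.range (m + 1), (m.choose i : ℝ) * ‖iteratedFDeriv ℝ i A z‖ *
        ‖iteratedFDeriv ℝ (m - i) B z‖
      ≤ ∑ i ∈ Finset.range (m + 1), (m.choose i : ℝ) * (a * b) := by
        refine Finset.sum_le_sum fun i hi => ?_
        rw [mul_assoc]
        gcongr
        · exact ha i (by have := Finset.mem_range.1 hi; omega)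
        · exact hb _ (by omega)
    _ = 2 ^ m * (a * b) := by
        rw [← Finset.sum_mul]
        congr 1
        exact_mod_cast Nat.sum_range_choose m
    _ ≤ _ := by
        gcongr
        norm_num

/-- The constant depends on κ, the compact set and the order, but not on `g`; this allows
coordinates to be changed in continuity estimates. -/
theorem exists_norm_iteratedFDeriv_comp_le {O K : Set V} (hO : IsOpen O) {κ : V → V'}
    (hκ : ContDiffOn ℝ ∞ κ O) (hK : IsCompact K) (hKO : K ⊆ O) (N : ℕ) :
    ∃ C : ℝ, 0 ≤ C ∧ ∀ g : V' → ℂ, ContDiff ℝ ∞ g → ∀ z ∈ K, ∀ b : ℝ,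
      (∀ m ≤ N, ‖iteratedFDeriv ℝ m g (κ z)‖ ≤ b) →
      ∀ m ≤ N, ‖iteratedFDeriv ℝ m (g ∘ κ) z‖ ≤ C * b := by
  obtain ⟨B, hB0, hB⟩ := exists_norm_iteratedFDeriv_le hO hκ hK hKO N
  refine ⟨N.factorial * (1 + B) ^ N, by positivity, fun g hg z hz b hb m hm => ?_⟩
  have hb0 : 0 ≤ b := (norm_nonneg _).trans (hb 0 (Nat.zero_le _))
  have h := norm_iteratedFDerivWithin_comp_le (n := m) (hg.contDiffOn (s := Set.univ)) hκ
    (by exact_mod_cast le_top) uniqueDiffOn_univ hO.uniqueDiffOn (Set.mapsTo_univ _ _) (hKO hz)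
    -- Taking `D` at least 1 gives B ≤ D ≤ D^i for every i ≥ 1, the form of bound required for the
    -- i-th derivative of κ.
    (C := b) (D := 1 + B)
    (fun i hi => by rw [iteratedFDerivWithin_univ]; exact hb i (by omega))
    (fun i hi hi' => by
      rw [iteratedFDerivWithin_of_isOpen i hO (hKO hz)]
      calc ‖iteratedFDeriv ℝ i κ z‖ ≤ 1 + B := (hB i (by omega) z hz).trans (by linarith)
        _ ≤ _ := le_self_pow₀ (by linarith) (by omega))
  rw [iteratedFDerivWithin_of_isOpen m hO (hKO hz)] at h
  calc _ ≤ m.factorial * b * (1 + B) ^ m := h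
    _ ≤ N.factorial * b * (1 + B) ^ N := by
        gcongr
        linarith
    _ = _ := by ring

end DerivativeBounds

/-! ### Powers of a manifold -/

section Powers

variable {d : ℕ} {M : Type*} [TopologicalSpace M] [ChartedSpace (Coord d) M] {n : ℕ}

/-- The inverse of the product coordinates. -/
def coordsInv (y : Fin n → M) (z : Fin n → Coord d) : Fin n → M :=
  fun i => (chartAt (Coord d) (y i)).symm (z i)

/-- The range of the product coordinates. -/
def coordRange (y : Fin n → M) : Set (Fin n → Coord d) :=
  {z | ∀ i, z i ∈ (chartAt (Coord d) (y i)).target}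

theorem isOpen_coordDomain (y : Fin n → M) : IsOpen (coordDomain d y) := by
  have : coordDomain d y = Set.univ.pi fun i => (chartAt (Coord d) (y i)).source := by
    ext x; simp [coordDomain]
  rw [this]
  exact isOpen_set_pi Set.finite_univ fun i _ => (chartAt (Coord d) (y i)).open_source

theorem isOpen_coordRange (y : Fin n → M) : IsOpen (coordRange (d := d) y) := by
  have : coordRange (d := d) y = Set.univ.pi fun i => (chartAt (Coord d) (y i)).target := by
    ext x; simp [coordRange]
  rw [this]
  exact isOpen_set_pi Set.finite_univ fun i _ => (chartAt (Coord d) (y i)).open_target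

theorem mem_coordDomain_self (y : Fin n → M) : y ∈ coordDomain d y :=
  fun i => mem_chart_source (Coord d) (y i)

theorem coordsInv_coords {y x : Fin n → M} (hx : x ∈ coordDomain d y) :
    coordsInv (d := d) y (coords d y x) = x :=
  funext fun i => (chartAt (Coord d) (y i)).left_inv (hx i)

theorem coords_coordsInv {y : Fin n → M} {z : Fin n → Coord d} (hz : z ∈ coordRange y) :
    coords d y (coordsInv y z) = z :=
  funext fun i => (chartAt (Coord d) (y i)).right_inv (hz i)

theorem coords_mem {y x : Fin n → M} (hx : x ∈ coordDomain d y) :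
    coords d y x ∈ coordRange y :=
  fun i => (chartAt (Coord d) (y i)).map_source (hx i)

theorem contMDiffAt_powMk {N' H' : Type*} {E' : Type*} [NormedAddCommGroup E']
    [NormedSpace ℝ E'] [TopologicalSpace H'] {I : ModelWithCorners ℝ E' H'} [TopologicalSpace N']
    [ChartedSpace H' N'] {f : N' → Fin n → M} {x : N'}
    (hf : ∀ i, ContMDiffAt I (𝓡 d) ∞ (fun y => f y i) x) :
    ContMDiffAt I (powModel d n) ∞ f x := by
  rw [contMDiffAt_iff]
  refine ⟨continuousAt_pi.2 fun i => (hf i).continuousAt, ?_⟩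
  rw [contDiffWithinAt_pi]
  intro i
  exact ((contMDiffAt_iff).1 (hf i)).2

variable [IsManifold (𝓡 d) ∞ M]

theorem contMDiffAt_coords {y x : Fin n → M} (hx : x ∈ coordDomain d y) :
    ContMDiffAt (powModel d n) 𝓘(ℝ, Fin n → Coord d) ∞ (coords d y) x := by
  refine contMDiffAt_pi_space.2 fun j => ?_
  exact ContMDiffAt.comp x (contMDiffOn_chart.contMDiffAt
      ((chartAt (Coord d) (y j)).open_source.mem_nhds (hx j)))
      (contMDiff_powProj j).contMDiffAt

theorem contMDiffAt_coordsInv {y : Fin n → M} {z : Fin n → Coord d} (hz : z ∈ coordRange y) :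
    ContMDiffAt 𝓘(ℝ, Fin n → Coord d) (powModel d n) ∞ (coordsInv y) z := by
  refine contMDiffAt_powMk fun i => ?_
  have h1 : ContMDiffAt 𝓘(ℝ, Fin n → Coord d) 𝓘(ℝ, Coord d) ∞
      (fun z : Fin n → Coord d => z i) z :=
    (contDiff_apply ℝ (Coord d) i).contMDiff.contMDiffAt
  exact ContMDiffAt.comp z (contMDiffOn_chart_symm.contMDiffAt
    ((chartAt (Coord d) (y i)).open_target.mem_nhds (hz i))) h1

theorem contDiffAt_comp_coordsInv {G : Type*} [NormedAddCommGroup G] [NormedSpace ℝ G]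
    {y : Fin n → M} {z : Fin n → Coord d} (hz : z ∈ coordRange y) {a : (Fin n → M) → G}
    (ha : ContMDiffAt (powModel d n) 𝓘(ℝ, G) ∞ a (coordsInv y z)) :
    ContDiffAt ℝ ∞ (fun z => a (coordsInv y z)) z :=
  (ContMDiffAt.comp z ha (contMDiffAt_coordsInv hz)).contDiffAt

variable [T2Space M]

theorem exists_bump {x : M} {U : Set M} (hU : U ∈ 𝓝 x) :
    ∃ b : M → ℝ, ContMDiff (𝓡 d) 𝓘(ℝ, ℝ) ∞ b ∧ HasCompactSupport b ∧ tsupport b ⊆ U ∧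
      ∀ᶠ y in 𝓝 x, b y = 1 := by
  obtain ⟨b, -, hb⟩ := (SmoothBumpFunction.nhds_basis_tsupport (I := 𝓡 d) x).mem_iff.1 hU
  exact ⟨b, b.contMDiff, b.hasCompactSupport, hb, b.eventuallyEq_one⟩

/-- Smooth compactly supported cutoffs on a power of a manifold which equal one near a point. -/
theorem exists_powBump {x : Fin n → M} {U : Set (Fin n → M)} (hU : U ∈ 𝓝 x) :
    ∃ b : (Fin n → M) → ℂ, ContMDiff (powModel d n) 𝓘(ℝ, ℂ) ∞ b ∧ HasCompactSupport b ∧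
      tsupport b ⊆ U ∧ ∀ᶠ y in 𝓝 x, b y = 1 := by
  rw [nhds_pi, Filter.mem_pi'] at hU
  obtain ⟨I, t, ht, htU⟩ := hU
  have hb := fun i => exists_bump (d := d) (ht i)
  choose b hb1 hb2 hb3 hb4 using hb
  have hsupp : tsupport (fun y : Fin n → M => ∏ i, (b i (y i) : ℂ)) ⊆
      Set.univ.pi fun i => tsupport (b i) := by
    refine closure_minimal ?_ (isClosed_set_pi fun i _ => isClosed_tsupport _)
    intro y hy i _
    refine subset_tsupport _ fun h0 => hy ?_
    exact Finset.prod_eq_zero (Finset.mem_univ i) (by rw [h0]; simp)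
  refine ⟨fun y => ∏ i, (b i (y i) : ℂ), ?_, ?_, ?_, ?_⟩
  · have hp : ContDiff ℝ ∞ (fun z : Fin n → ℝ => ∏ i, (z i : ℂ)) :=
      contDiff_prod fun i _ => Complex.ofRealCLM.contDiff.comp (contDiff_apply ℝ ℝ i)
    exact hp.contMDiff.comp (contMDiff_pi_space.2 fun i =>
      (hb1 i).comp (contMDiff_powProj (d := d) i))
  · exact (isCompact_univ_pi fun i => (hb2 i)).of_isClosed_subset isClosed_closure hsupp
  · exact fun y hy => htU fun i _ => hb3 i (hsupp hy i trivial)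
  · have : ∀ i, ∀ᶠ y : Fin n → M in 𝓝 x, b i (y i) = 1 := fun i =>
      (continuous_apply i).continuousAt.eventually (hb4 i)
    filter_upwards [Filter.eventually_all.2 this] with y hy
    simp [hy]

theorem exists_cutoff {y : Fin n → M} {U : Set (Fin n → M)} (hU : U ∈ 𝓝 y) :
    ∃ χ : Cutoff d y, χ.toFun y = 1 ∧ tsupport χ.toFun ⊆ U := by
  obtain ⟨b, h1, h2, h3, h4⟩ := exists_powBump (d := d)
    (Filter.inter_mem hU ((isOpen_coordDomain (d := d) y).mem_nhds (mem_coordDomain_self y)))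
  exact ⟨⟨b, h1, h2, fun x hx => (h3 hx).2⟩, h4.self_of_nhds, fun x hx => (h3 hx).1⟩

/-- The product of a cutoff with a smooth function. -/
def Cutoff.mul {y : Fin n → M} (χ : Cutoff d y) (a : (Fin n → M) → ℂ)
    (ha : ContMDiff (powModel d n) 𝓘(ℝ, ℂ) ∞ a) : Cutoff d y where
  toFun x := χ.toFun x * a x
  smooth := (contDiff_mul (𝕜 := ℝ) (𝔸 := ℂ) (n := ∞)).contMDiff.comp (χ.smooth.prodMk_space ha)
  compact := χ.compact.mul_right
  support := (tsupport_mul_subset_left).trans χ.support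

/-- The coordinates are smooth on their domain only, but the support of χ lies inside it. -/
theorem Cutoff.contMDiff_mul_comp_coords {y : Fin n → M} (χ : Cutoff d y)
    {g : (Fin n → Coord d) → ℂ} (hg : ContDiff ℝ ∞ g) :
    ContMDiff (powModel d n) 𝓘(ℝ, ℂ) ∞ (fun x => χ.toFun x * g (coords d y x)) := by
  refine contMDiff_of_tsupport fun x hx => ?_
  have hxd : x ∈ coordDomain d y := χ.support (tsupport_mul_subset_left hx)
  have hw : ContMDiffAt (powModel d n) 𝓘(ℝ, ℂ) ∞ (fun x => g (coords d y x)) x :=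
    hg.contMDiff.contMDiffAt.comp x (contMDiffAt_coords hxd)
  exact (contDiff_mul (𝕜 := ℝ) (𝔸 := ℂ) (n := ∞)).contMDiff.contMDiffAt.comp x
    (χ.smooth.contMDiffAt.prodMk_space hw)

end Powers

/-! ### Local frames and local representations -/

section LocalRep

variable {d : ℕ} {M : Type*} [TopologicalSpace M] [ChartedSpace (Coord d) M]
  [IsManifold (𝓡 d) ∞ M] [T2Space M]
  {F : Type*} [NormedAddCommGroup F] [NormedSpace ℂ F]
  {E : M → Type*} [∀ x, AddCommGroup (E x)] [∀ x, Module ℂ (E x)] [∀ x, TopologicalSpace (E x)]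
  [TopologicalSpace (TotalSpace F E)] [FiberBundle F E] [VectorBundle ℂ F E] [VectorBundle ℝ F E]
  [ContMDiffVectorBundle ∞ F E (𝓡 d)] {n : ℕ}

variable (d) in
-- A bump function extends the germ of a local frame vector to a global section. This matters
-- because smoothness of `CoSect` is tested on global sections only.
theorem exists_sect_eq_symm {p x : M} (hx : x ∈ (trivializationAt F E p).baseSet) (v : F) :
    ∃ s : Sect d F E, ∀ᶠ y in 𝓝 x, s.1 y = (trivializationAt F E p).symm y v := by
  set e := trivializationAt F E p
  obtain ⟨b, hb1, -, hb3, hb4⟩ := exists_bump (d := d) (e.open_baseSet.mem_nhds hx)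
  have hs : ContMDiffOn (𝓡 d) ((𝓡 d).prod 𝓘(ℝ, F)) ∞
      (fun y => TotalSpace.mk' F y (e.symm y v)) e.baseSet := by
    rw [e.contMDiffOn_section_baseSet_iff]
    refine (contMDiffOn_const (c := v)).congr fun y hy => ?_
    rw [e.apply_mk_symm hy]
  refine ⟨⟨fun y => b y • e.symm y v,
    ContMDiffOn.smul_section_of_tsupport hb1.contMDiffOn e.open_baseSet hb3 hs⟩, ?_⟩
  filter_upwards [hb4] with y hy
  simp [hy]

variable (d F E) in
/-- The points at which both the product coordinates and the product trivialization at `p` are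
defined. -/
def niceDomain (p : Fin n → M) : Set (Fin n → M) :=
  coordDomain d p ∩ {x | ∀ i, x i ∈ (trivializationAt F E (p i)).baseSet}

theorem isOpen_niceDomain (p : Fin n → M) : IsOpen (niceDomain d F E p) := by
  refine (isOpen_coordDomain p).inter ?_
  have : {x : Fin n → M | ∀ i, x i ∈ (trivializationAt F E (p i)).baseSet} =
      Set.univ.pi fun i => (trivializationAt F E (p i)).baseSet := by
    ext x; simp
  rw [this]
  exact isOpen_set_pi Set.finite_univ fun i _ => (trivializationAt F E (p i)).open_baseSet

theorem mem_niceDomain_self (p : Fin n → M) : p ∈ niceDomain d F E p :=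
  ⟨mem_coordDomain_self p, fun i => mem_baseSet_trivializationAt F E (p i)⟩

variable (d F E) in
/-- The image of `niceDomain` in coordinates. -/
def niceRange (p : Fin n → M) : Set (Fin n → Coord d) :=
  coordRange p ∩ coordsInv p ⁻¹' niceDomain d F E p

theorem isOpen_inter_preimage_coordsInv (p : Fin n → M) {U : Set (Fin n → M)} (hU : IsOpen U) :
    IsOpen (coordRange p ∩ coordsInv (d := d) p ⁻¹' U) :=
  ContinuousOn.isOpen_inter_preimage (fun _ hz =>
    (contMDiffAt_coordsInv hz).continuousAt.continuousWithinAt) (isOpen_coordRange p) hU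

theorem isOpen_niceRange (p : Fin n → M) : IsOpen (niceRange d F E p) :=
  isOpen_inter_preimage_coordsInv p (isOpen_niceDomain p)

theorem coords_mem_niceRange {p x : Fin n → M} (hx : x ∈ niceDomain d F E p) :
    coords d p x ∈ niceRange d F E p := by
  refine ⟨coords_mem hx.1, ?_⟩
  rw [Set.mem_preimage, coordsInv_coords hx.1]
  exact hx

theorem contMDiffAt_frame (T : CoSect d F E n) (p : Fin n → M) (v : Fin n → F) {x : Fin n → M}
    (hx : ∀ i, x i ∈ (trivializationAt F E (p i)).baseSet) :
    ContMDiffAt (powModel d n) 𝓘(ℝ, ℂ) ∞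
      (fun x => T.1 x fun i => (trivializationAt F E (p i)).symm (x i) (v i)) x := by
  choose s hs using fun i => exists_sect_eq_symm d (hx i) (v i)
  have h1 : ∀ᶠ y : Fin n → M in 𝓝 x, ∀ i, (s i).1 (y i) =
      (trivializationAt F E (p i)).symm (y i) (v i) :=
    Filter.eventually_all.2 fun i => (continuous_apply i).continuousAt.eventually (hs i)
  refine (T.2 s).contMDiffAt.congr_of_eventuallyEq ?_
  filter_upwards [h1] with y hy
  congr 1
  funext i
  exact (hy i).symm

theorem contDiffOn_localRep (T : CoSect d F E n) (p : Fin n → M) (v : Fin n → F) :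
    ContDiffOn ℝ ∞ (localRep d F E p T.1 v) (niceRange d F E p) := fun _ hz =>
  (contDiffAt_comp_coordsInv (a := fun x => T.1 x fun i =>
    (trivializationAt F E (p i)).symm (x i) (v i)) hz.1
    (contMDiffAt_frame T p v hz.2.2)).contDiffWithinAt

variable [FiniteDimensional ℂ F]

/-- The expansion of a local representation with respect to a basis of the typical fibre. -/
theorem localRep_eq_sum {ι : Type*} [Fintype ι] (bF : Module.Basis ι ℂ F)
    (T : ∀ x : Fin n → M, MultilinearMap ℂ (fun i => E (x i)) ℂ) (p : Fin n → M) (v : Fin n → F)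
    {z : Fin n → Coord d} (hz : z ∈ niceRange d F E p) :
    localRep d F E p T v z =
      ∑ J : Fin n → ι, (∏ i, bF.repr (v i) (J i)) * localRep d F E p T (fun i => bF (J i)) z := by
  have hb : ∀ i, coordsInv p z i ∈ (trivializationAt F E (p i)).baseSet := hz.2.2
  have h1 : ∀ v : Fin n → F, localRep d F E p T v z =
      ((T (coordsInv p z)).compLinearMap fun i =>
        (trivializationAt F E (p i)).symmₗ ℂ (coordsInv p z i)) v := by
    intro v
    simp only [localRep, MultilinearMap.compLinearMap_apply]
    change T (coordsInv p z) _ = T (coordsInv p z) _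
    congr 1
    funext i
    exact ((trivializationAt F E (p i)).symmₗ_apply (R := ℂ) (hb i) (v i)).symm
  rw [h1]
  have h2 : v = fun i => ∑ j, bF.repr (v i) j • bF j := by
    funext i
    exact (bF.sum_repr (v i)).symm
  conv_lhs => rw [h2]
  rw [MultilinearMap.map_sum]
  refine Finset.sum_congr rfl fun J _ => ?_
  rw [MultilinearMap.map_smul_univ, h1, smul_eq_mul]

theorem exists_norm_repr_le {ι : Type*} [Fintype ι]
    (bF : Module.Basis ι ℂ F) : ∃ c : ℝ, 0 ≤ c ∧ ∀ v j, ‖bF.repr v j‖ ≤ c * ‖v‖ := by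
  refine ⟨∑ j, ‖(bF.coord j).toContinuousLinearMap‖, Finset.sum_nonneg fun j _ => norm_nonneg _,
    fun v j => ?_⟩
  refine ((bF.coord j).toContinuousLinearMap.le_opNorm v).trans ?_
  gcongr
  exact Finset.single_le_sum (f := fun j => ‖(bF.coord j).toContinuousLinearMap‖)
    (fun j _ => norm_nonneg _) (Finset.mem_univ j)

/-- The derivatives of local representations are controlled by those along a basis. -/
theorem exists_norm_iteratedFDeriv_localRep_le {ι : Type*} [Fintype ι] (bF : Module.Basis ι ℂ F)
    (n : ℕ) :
    ∃ C : ℝ, 0 ≤ C ∧ ∀ (T : CoSect d F E n) (p : Fin n → M), ∀ z ∈ niceRange d F E p,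
      ∀ (m : ℕ) (b : ℝ), (∀ J : Fin n → ι,
        ‖iteratedFDeriv ℝ m (localRep d F E p T.1 fun i => bF (J i)) z‖ ≤ b) →
      ∀ v : Fin n → F, (∀ i, ‖v i‖ ≤ 1) →
        ‖iteratedFDeriv ℝ m (localRep d F E p T.1 v) z‖ ≤ C * b := by
  classical
  obtain ⟨c, hc0, hc⟩ := exists_norm_repr_le bF
  refine ⟨(Fintype.card (Fin n → ι)) * c ^ n, by positivity, fun T p z hz m b hb v hv => ?_⟩
  have h1 : localRep d F E p T.1 v =ᶠ[𝓝 z] fun z => ∑ J : Fin n → ι,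
      (∏ i, bF.repr (v i) (J i)) • localRep d F E p T.1 (fun i => bF (J i)) z := by
    filter_upwards [(isOpen_niceRange p).mem_nhds hz] with z' hz'
    exact localRep_eq_sum bF T.1 p v hz'
  have hsm : ∀ J : Fin n → ι, ContDiffAt ℝ m (localRep d F E p T.1 fun i => bF (J i)) z :=
    fun J => ((contDiffOn_localRep T p _).contDiffAt ((isOpen_niceRange p).mem_nhds hz)).of_le
      (by exact_mod_cast le_top)
  rw [(h1.iteratedFDeriv ℝ m).self_of_nhds, iteratedFDeriv_fun_sum_apply fun J _ =>
    (hsm J).const_smul _]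
  refine (norm_sum_le _ _).trans ?_
  have hterm : ∀ J : Fin n → ι, ‖iteratedFDeriv ℝ m (fun z => (∏ i, bF.repr (v i) (J i)) •
      localRep d F E p T.1 (fun i => bF (J i)) z) z‖ ≤ c ^ n * b := by
    intro J
    rw [iteratedFDeriv_const_smul_apply' (hsm J), norm_smul]
    gcongr
    · rw [norm_prod]
      calc ∏ i, ‖bF.repr (v i) (J i)‖ ≤ ∏ _i : Fin n, c := by
            refine Finset.prod_le_prod (fun i _ => norm_nonneg _) fun i _ => ?_
            exact (hc _ _).trans (mul_le_of_le_one_right hc0 (hv i))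
        _ = c ^ n := by simp
    · exact hb J
  refine (Finset.sum_le_sum fun J _ => hterm J).trans ?_
  simp [mul_assoc]

end LocalRep

/-! ### Localization of distributions -/

section Localization

variable {d : ℕ} {M : Type*} [TopologicalSpace M] [ChartedSpace (Coord d) M]
  [IsManifold (𝓡 d) ∞ M] [T2Space M]
  {F : Type*} [NormedAddCommGroup F] [NormedSpace ℂ F]
  {E : M → Type*} [∀ x, AddCommGroup (E x)] [∀ x, Module ℂ (E x)] [∀ x, TopologicalSpace (E x)]
  [TopologicalSpace (TotalSpace F E)] [FiberBundle F E] [VectorBundle ℂ F E] [VectorBundle ℝ F E]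
  {n : ℕ} {H : Type*} [NormedAddCommGroup H] [NormedSpace ℂ H]

/-- The product of a section of `(B^*)^{⊠n}` with a smooth function. -/
def coMul (T : CoSect d F E n) (a : (Fin n → M) → ℂ)
    (ha : ContMDiff (powModel d n) 𝓘(ℝ, ℂ) ∞ a) : CoSect d F E n :=
  ⟨fun x => a x • T.1 x, fun s =>
    (contDiff_mul (𝕜 := ℝ) (𝔸 := ℂ) (n := ∞)).contMDiff.comp (ha.prodMk_space (T.2 s))⟩

/-- The product of a section of `(B^*)^{⊠n}` with a compactly supported smooth function. -/
def coMul₀ (T : CoSect d F E n) (a : (Fin n → M) → ℂ)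
    (ha : ContMDiff (powModel d n) 𝓘(ℝ, ℂ) ∞ a) (hc : HasCompactSupport a) : CoSect₀ d F E n :=
  ⟨coMul T a ha, IsCompact.of_isClosed_subset hc isClosed_closure <|
    closure_mono fun x hx h0 => hx (by simp [coMul, h0])⟩

theorem CoSect₀.ext {S T : CoSect₀ d F E n} (h : ∀ x, S.1.1 x = T.1.1 x) : S = T :=
  Subtype.ext (Subtype.ext (funext h))

/-- The functional `g ↦ u(χ (g ∘ X) T)`, where `X` are the product coordinates. -/
def cutFunctional (u : Distr d F E n H) {y : Fin n → M} (χ : Cutoff d y) (T : CoSect d F E n) :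
    smoothFun (Fin n → Coord d) →ₗ[ℂ] H :=
  u.toFun ∘ₗ
  { toFun := fun g => coMul₀ T (fun x => χ.toFun x * g.1 (coords d y x))
      (χ.contMDiff_mul_comp_coords g.2) χ.compact.mul_right
    map_add' := fun f g => CoSect₀.ext fun x => by
      simp [coMul₀, coMul, mul_add, add_smul]
    map_smul' := fun c g => CoSect₀.ext fun x => by
      simp [coMul₀, coMul, smul_smul, mul_left_comm] }

theorem cutFunctional_eq (u : Distr d F E n H) {y : Fin n → M} (χ : Cutoff d y)
    (T : CoSect d F E n) (g : smoothFun (Fin n → Coord d)) (S : CoSect₀ d F E n)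
    (hS : ∀ x, S.1.1 x = (χ.toFun x * g.1 (coords d y x)) • T.1 x) :
    cutFunctional u χ T g = u.toFun S :=
  congrArg u.toFun (CoSect₀.ext fun x => (hS x).symm)

/-- Families of covectors as covectors of the product. -/
def sumDual (d n : ℕ) : (Fin n → (Coord d →L[ℝ] ℝ)) →ₗ[ℝ] ((Fin n → Coord d) →L[ℝ] ℝ) where
  toFun k := ∑ j, k j ∘L ContinuousLinearMap.proj j
  map_add' k l := by ext; simp [Finset.sum_add_distrib]
  map_smul' c k := by ext; simp [Finset.mul_sum]

theorem norm_sumDual_le (k : Fin n → (Coord d →L[ℝ] ℝ)) : ‖sumDual d n k‖ ≤ n * ‖k‖ := by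
  change ‖∑ j, k j ∘L (ContinuousLinearMap.proj j : (Fin n → Coord d) →L[ℝ] Coord d)‖ ≤ _
  refine (norm_sum_le _ _).trans ?_
  have : ∀ j ∈ Finset.univ, ‖k j ∘L (ContinuousLinearMap.proj j :
      (Fin n → Coord d) →L[ℝ] Coord d)‖ ≤ ‖k‖ := by
    intro j _
    refine ContinuousLinearMap.opNorm_le_bound _ (norm_nonneg _) fun v => ?_
    refine ((k j).le_opNorm _).trans ?_
    gcongr
    · exact norm_le_pi_norm k j
    · exact norm_le_pi_norm v j
  refine (Finset.sum_le_sum this).trans ?_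
  simp

/-- Restrict η to the coordinate axes. The norm bound lets weights in η dominate weights in the
family of covectors. -/
theorem exists_sumDual_eq (η : (Fin n → Coord d) →L[ℝ] ℝ) :
    ∃ k, sumDual d n k = η ∧ ‖k‖ ≤ ‖η‖ := by
  refine ⟨fun j => η ∘L ContinuousLinearMap.single ℝ (fun _ => Coord d) j, ?_, ?_⟩
  · ext z
    simp only [sumDual, LinearMap.coe_mk, AddHom.coe_mk, sum_apply,
      ContinuousLinearMap.comp_apply, ContinuousLinearMap.proj_apply,
      ContinuousLinearMap.single_apply]
    rw [← map_sum, Finset.univ_sum_single]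
  · refine (pi_norm_le_iff_of_nonneg (norm_nonneg _)).2 fun j => ?_
    refine ContinuousLinearMap.opNorm_le_bound _ (norm_nonneg _) fun v => ?_
    refine (η.le_opNorm _).trans ?_
    gcongr
    refine (pi_norm_le_iff_of_nonneg (norm_nonneg _)).2 fun i => ?_
    change ‖(Pi.single j v : Fin n → Coord d) i‖ ≤ ‖v‖
    by_cases h : i = j
    · subst h; simp
    · simp [h]

theorem wave_eq_planeWave (y : Fin n → M) (k : Fin n → (Coord d →L[ℝ] ℝ)) (x : Fin n → M) :
    wave y k x = planeWave (sumDual d n k) (coords d y x) := by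
  simp [wave, planeWave, sumDual]

theorem toFun_testSection_eq (u : Distr d F E n H) {y : Fin n → M} (χ : Cutoff d y)
    (T : CoSect d F E n) (k : Fin n → (Coord d →L[ℝ] ℝ)) :
    u.toFun (χ.testSection k T) = cutFunctional u χ T (planeWaveFun (sumDual d n k)) := by
  refine (cutFunctional_eq u χ T _ _ fun x => ?_).symm
  simp [Cutoff.testSection, planeWaveFun, wave_eq_planeWave]

/-- `cutFunctional` is bounded by finitely many derivatives. -/
def CutBounded (u : Distr d F E n H) {y : Fin n → M} (χ : Cutoff d y) (T : CoSect d F E n) :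
    Prop :=
  ∃ (C : ℝ) (N : ℕ), ∀ (g : smoothFun (Fin n → Coord d)) (b : ℝ), 0 ≤ b →
    (∀ m ≤ N, ∀ z, ‖iteratedFDeriv ℝ m g.1 z‖ ≤ b) → ‖cutFunctional u χ T g‖ ≤ C * b

theorem CutBounded.of_add (u : Distr d F E n H) {y : Fin n → M} {χ χ₁ χ₂ : Cutoff d y}
    (T : CoSect d F E n) (h : ∀ x, χ.toFun x = χ₁.toFun x + χ₂.toFun x)
    (h₁ : CutBounded u χ₁ T) (h₂ : CutBounded u χ₂ T) : CutBounded u χ T := by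
  obtain ⟨C₁, N₁, hC₁⟩ := h₁
  obtain ⟨C₂, N₂, hC₂⟩ := h₂
  refine ⟨C₁ + C₂, max N₁ N₂, fun g b hb0 hb => ?_⟩
  have : cutFunctional u χ T g = cutFunctional u χ₁ T g + cutFunctional u χ₂ T g := by
    simp only [cutFunctional, LinearMap.comp_apply, ← map_add]
    congr 1
    refine CoSect₀.ext fun x => ?_
    simp [coMul₀, coMul, h, add_mul, add_smul]
  rw [this, add_mul]
  refine (norm_add_le _ _).trans (add_le_add ?_ ?_)
  · exact hC₁ g b hb0 fun m hm z => hb m (hm.trans (le_max_left _ _)) z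
  · exact hC₂ g b hb0 fun m hm z => hb m (hm.trans (le_max_right _ _)) z

variable [ContMDiffVectorBundle ∞ F E (𝓡 d)] [FiniteDimensional ℂ F]

/-- The continuity estimate of `u` lives in the coordinates at `p`, whereas `g` is a function of the
coordinates at `y`. The transition map has bounded derivatives on the compact support, so the
seminorms compare. -/
theorem CutBounded.of_tsupport_subset (u : Distr d F E n H) {y : Fin n → M} (χ : Cutoff d y)
    (T : CoSect d F E n) (p : Fin n → M) (hp : tsupport χ.toFun ⊆ niceDomain d F E p) :
    CutBounded u χ T := by
  let bF := Module.finBasis ℂ F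
  obtain ⟨C, N, hC⟩ := u.continuous p (tsupport χ.toFun) χ.compact hp
  obtain ⟨C₁, hC₁0, hC₁⟩ := exists_norm_iteratedFDeriv_localRep_le (d := d) (E := E) bF n
  let T' : CoSect d F E n := coMul T χ.toFun χ.smooth
  let O := coordRange p ∩ coordsInv (d := d) p ⁻¹' (niceDomain d F E p ∩ coordDomain d y)
  have hO : IsOpen O := isOpen_inter_preimage_coordsInv p
    ((isOpen_niceDomain p).inter (isOpen_coordDomain y))
  have hOn : O ⊆ niceRange d F E p := fun z hz => ⟨hz.1, hz.2.1⟩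
  let κ : (Fin n → Coord d) → (Fin n → Coord d) := fun z => coords d y (coordsInv p z)
  have hκ : ContDiffOn ℝ ∞ κ O := fun z hz =>
    (contDiffAt_comp_coordsInv hz.1 (contMDiffAt_coords hz.2.2)).contDiffWithinAt
  let K := coords d p '' tsupport χ.toFun
  have hK : IsCompact K := χ.compact.image_of_continuousOn fun x hx =>
    (contMDiffAt_coords (hp hx).1).continuousAt.continuousWithinAt
  have hKO : K ⊆ O := by
    rintro _ ⟨x, hx, rfl⟩
    refine ⟨coords_mem (hp hx).1, ?_⟩
    rw [Set.mem_preimage, coordsInv_coords (hp hx).1]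
    exact ⟨hp hx, χ.support hx⟩
  obtain ⟨C₂, hC₂0, hC₂⟩ := exists_norm_iteratedFDeriv_comp_le hO hκ hK hKO N
  have hA : ∀ v, ContDiffOn ℝ ∞ (localRep d F E p T'.1 v) O := fun v =>
    (contDiffOn_localRep T' p v).mono hOn
  choose a ha0 ha using fun J : Fin n → Fin (Module.finrank ℂ F) =>
    exists_norm_iteratedFDeriv_le hO (hA fun i => bF (J i)) hK hKO N
  have hasum : ∀ J, a J ≤ ∑ J, a J := fun J =>
    Finset.single_le_sum (f := a) (fun J _ => ha0 J) (Finset.mem_univ J)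
  have ha1 : 0 ≤ ∑ J, a J := Finset.sum_nonneg fun J _ => ha0 J
  refine ⟨|C| * (C₁ * (2 ^ N * ((∑ J, a J) * C₂))), N, fun g b hb0 hb => ?_⟩
  set S := coMul₀ T (fun x => χ.toFun x * g.1 (coords d y x))
      (χ.contMDiff_mul_comp_coords g.2) χ.compact.mul_right with hS
  -- The factor coming from χ T is fixed; only g ∘ κ varies. Leibniz and the chain rule then give a
  -- bound linear in the seminorm of `g`.
  have hloc : ∀ v, localRep d F E p S.1.1 v =
      fun z => localRep d F E p T'.1 v z * (g.1 ∘ κ) z := by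
    intro v
    funext z
    simp only [localRep, hS, coMul₀, coMul, T', smul_apply, smul_eq_mul, Function.comp_apply, κ]
    exact mul_right_comm _ _ _
  have hSs : dsupp S.1.1 ⊆ tsupport χ.toFun := closure_mono fun x hx h0 =>
    hx (by simp [hS, coMul₀, coMul, h0])
  have key := hC S hSs (C₁ * (2 ^ N * ((∑ J, a J) * (C₂ * b)))) (by positivity) (by
    intro m hm x hx v hv
    have hxK : coords d p x ∈ K := ⟨x, hx, rfl⟩
    refine hC₁ S.1 p _ (hOn (hKO hxK)) m _ (fun J => ?_) v hv
    rw [hloc]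
    refine (norm_iteratedFDeriv_mul_le_of_le hO (hA _)
      (ContDiff.comp_contDiffOn (g := g.1) g.2 hκ) (hKO hxK)
      (fun m hm => (ha J m hm _ hxK).trans (hasum J))
      (hC₂ g.1 g.2 _ hxK b fun m hm => hb m hm _) m hm))
  calc ‖cutFunctional u χ T g‖ = ‖u.toFun S‖ := rfl
    _ ≤ C * (C₁ * (2 ^ N * ((∑ J, a J) * (C₂ * b)))) := key
    _ ≤ |C| * (C₁ * (2 ^ N * ((∑ J, a J) * (C₂ * b)))) := by
        gcongr
        exact le_abs_self C
    _ = _ := by ring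

/-- The support of χ lies in one coordinate domain but need not lie in one trivialization domain.
Finitely many nice domains cover it, and χ is split as χ β_p + χ (1 - β_p), one point of the cover
at a time. -/
theorem cutBounded (u : Distr d F E n H) {y : Fin n → M} (χ : Cutoff d y) (T : CoSect d F E n) :
    CutBounded u χ T := by
  choose β hβ1 hβ2 hβ3 hβ4 using fun p : Fin n → M => exists_powBump (d := d)
    ((isOpen_niceDomain (d := d) (F := F) (E := E) p).mem_nhds (mem_niceDomain_self p))
  -- The sets where β_p = 1, for p in `t`, cover the nonvanishing set of χ. Multiplying by 1 - β_p
  -- kills χ where β_p = 1, so `p` can be dropped; with no point left, χ is zero.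
  have hind : ∀ (t : Finset (Fin n → M)) (χ : Cutoff d y),
      (∀ x, χ.toFun x ≠ 0 → ∃ p ∈ t, β p x = 1) → CutBounded u χ T := by
    classical
    intro t
    induction t using Finset.induction_on with
    | empty =>
      intro χ hχ
      have h0 : ∀ x, χ.toFun x = 0 := fun x => by
        by_contra h
        simpa using hχ x h
      refine ⟨0, 0, fun g b _ _ => ?_⟩
      have : cutFunctional u χ T g = u.toFun 0 := cutFunctional_eq u χ T g 0 fun x => by simp [h0]
      simp [this]
    | insert p t hp ih =>
      intro χ hχ
      refine CutBounded.of_add u T (χ₁ := χ.mul (β p) (hβ1 p))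
        (χ₂ := χ.mul (fun x => 1 - β p x) (contMDiff_const.sub (hβ1 p)))
        (fun x => by simp only [Cutoff.mul]; ring)
        (CutBounded.of_tsupport_subset u _ T p (tsupport_mul_subset_right.trans (hβ3 p)))
        (ih _ fun x hx => ?_)
      have hx1 : χ.toFun x ≠ 0 := left_ne_zero_of_mul hx
      have hx2 : 1 - β p x ≠ 0 := right_ne_zero_of_mul hx
      obtain ⟨q, hq, hqx⟩ := hχ x hx1
      rcases Finset.mem_insert.1 hq with rfl | hq
      · exact absurd (by rw [hqx, sub_self]) hx2
      · exact ⟨q, hq, hqx⟩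
  obtain ⟨t, ht⟩ := χ.compact.elim_nhds_subcover (fun p => {x | β p x = 1}) fun p _ => hβ4 p
  refine hind t χ fun x hx => ?_
  have := ht.2 (subset_tsupport _ hx)
  simpa using this

theorem isLocalFunctional_cutFunctional (u : Distr d F E n H) {y : Fin n → M} (χ : Cutoff d y)
    (T : CoSect d F E n) :
    IsLocalFunctional (cutFunctional u χ T) (coords d y '' tsupport χ.toFun) where
  bound := cutBounded u χ T
  congr f g h := by
    refine cutFunctional_eq u χ T f _ fun x => ?_
    by_cases hx : x ∈ tsupport χ.toFun
    · simp [coMul₀, coMul, h _ ⟨x, hx, rfl⟩]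
    · simp [coMul₀, coMul, image_eq_zero_of_notMem_tsupport hx]

theorem polyBounded_testSection (u : Distr d F E n H) {y : Fin n → M} (χ : Cutoff d y)
    (T : CoSect d F E n) : PolyBounded fun k => ‖u.toFun (χ.testSection k T)‖ := by
  obtain ⟨C, N, hC⟩ := (isLocalFunctional_cutFunctional u χ T).polyBounded
  refine ⟨|C| * (n + 1) ^ N, N, fun k => ?_⟩
  simp only [toFun_testSection_eq]
  refine (hC _).trans ?_
  rw [mul_assoc, ← mul_pow]
  have h1 := norm_sumDual_le (d := d) k
  gcongr
  · exact le_abs_self C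
  · nlinarith [norm_nonneg k, (Nat.cast_nonneg n : (0 : ℝ) ≤ n)]

/-- Regularity in a direction is inherited by all cutoffs with smaller support. -/
theorem rapidNear_of_tsupport_subset (u : Distr d F E n H) {y : Fin n → M} {χ χ' : Cutoff d y}
    (T : CoSect d F E n) {ξ : Fin n → (Coord d →L[ℝ] ℝ)}
    (h : RapidNear (fun k => ‖u.toFun (χ.testSection k T)‖) ξ)
    (hs : tsupport χ'.toFun ⊆ {x | χ.toFun x ≠ 0}) :
    RapidNear (fun k => ‖u.toFun (χ'.testSection k T)‖) ξ := by
  classical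
  let K' := coords d y '' tsupport χ'.toFun
  have hK' : IsCompact K' := χ'.compact.image_of_continuousOn fun x hx =>
    (contMDiffAt_coords (χ'.support hx)).continuousAt.continuousWithinAt
  have hK : IsCompact (coords d y '' tsupport χ.toFun) :=
    χ.compact.image_of_continuousOn fun x hx =>
      (contMDiffAt_coords (χ.support hx)).continuousAt.continuousWithinAt
  -- The quotient χ'/χ in coordinates, extended by zero. It is smooth because χ does not vanish on
  -- the support of χ', and χ' = χ · (φ ∘ X) everywhere.
  let φ : (Fin n → Coord d) → ℂ := fun z => if z ∈ K' then
    χ'.toFun (coordsInv y z) * (χ.toFun (coordsInv y z))⁻¹ else 0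
  have hφ0 : ∀ z ∈ coordRange y,
      φ z = χ'.toFun (coordsInv y z) * (χ.toFun (coordsInv y z))⁻¹ := by
    intro z hz
    by_cases hzK : z ∈ K'
    · simp [φ, hzK]
    · have : coordsInv y z ∉ tsupport χ'.toFun := fun h1 =>
        hzK ⟨_, h1, coords_coordsInv hz⟩
      simp [φ, hzK, image_eq_zero_of_notMem_tsupport this]
  have hφc : HasCompactSupport φ := HasCompactSupport.intro hK' fun z hz => by simp [φ, hz]
  have hφs : ContDiff ℝ ∞ φ := by
    rw [contDiff_iff_contDiffAt]
    intro z
    by_cases hz : z ∈ K'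
    · obtain ⟨x, hx, rfl⟩ := hz
      have hz := coords_mem (χ'.support hx)
      have h1 := contDiffAt_comp_coordsInv (y := y) hz χ'.smooth.contMDiffAt
      have h2 := contDiffAt_comp_coordsInv (y := y) hz χ.smooth.contMDiffAt
      have h3 : χ.toFun (coordsInv y (coords d y x)) ≠ 0 := by
        rw [coordsInv_coords (χ'.support hx)]
        exact hs hx
      refine (h1.mul (h2.inv h3)).congr_of_eventuallyEq ?_
      filter_upwards [(isOpen_coordRange y).mem_nhds hz] with z' hz'
      exact hφ0 z' hz'
    · refine (contDiffAt_const (c := (0 : ℂ))).congr_of_eventuallyEq ?_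
      filter_upwards [hK'.isClosed.isOpen_compl.mem_nhds hz] with z' hz'
      simp [φ, show z' ∉ K' from hz']
  have hχ : ∀ x, χ'.toFun x = χ.toFun x * φ (coords d y x) := by
    intro x
    by_cases hx : x ∈ coordDomain d y
    · rw [hφ0 _ (coords_mem hx), coordsInv_coords hx]
      by_cases h0 : χ.toFun x = 0
      · have : x ∉ tsupport χ'.toFun := fun h1 => hs h1 h0
        simp [h0, image_eq_zero_of_notMem_tsupport this]
      · field_simp
    · have h1 : x ∉ tsupport χ'.toFun := fun h1 => hx (χ'.support h1)
      have h2 : x ∉ tsupport χ.toFun := fun h2 => hx (χ.support h2)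
      simp [image_eq_zero_of_notMem_tsupport h1, image_eq_zero_of_notMem_tsupport h2]
  obtain ⟨c, η, hcη, hsum⟩ := exists_hasSum_planeWave hφs hφc hK
  choose e he1 he2 using fun m => exists_sumDual_eq (η m)
  -- Testing with χ' at frequency k is the sum over m of c_m times testing with χ at frequency k +
  -- η_m.
  refine RapidNear.of_tsum_translates (c := fun m => ‖c m‖) (η := e) (fun m => norm_nonneg _)
    (fun N => Summable.of_nonneg_of_le (fun m => by positivity) (fun m => ?_) (hcη N))
    (fun k => norm_nonneg _) (polyBounded_testSection u χ T) h fun k S hS => ?_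
  · gcongr
    exact he2 m
  · let g : smoothFun (Fin n → Coord d) :=
      ⟨fun z => φ z * planeWave (sumDual d n k) z, hφs.mul (contDiff_planeWave _)⟩
    have h1 := (isLocalFunctional_cutFunctional u χ T).hasSum_planeWave hcη hsum
      (sumDual d n k) g fun z _ => rfl
    have h2 : cutFunctional u χ T g = u.toFun (χ'.testSection k T) :=
      cutFunctional_eq u χ T g _ fun x => by
        simp only [Cutoff.testSection, g, hχ, wave_eq_planeWave, mul_assoc]
    rw [← h2, ← h1.tsum_eq]
    refine tsum_of_norm_bounded hS fun m => ?_
    rw [norm_smul, toFun_testSection_eq, map_add, he1]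

theorem regularDirected_iff (u : Distr d F E n H) (T : CoSect d F E n)
    (ξ : Fin n → CotangentBundle d M) :
    u.RegularDirected T ξ ↔ ∃ χ : Cutoff d (fun i => (ξ i).proj),
      χ.toFun (fun i => (ξ i).proj) ≠ 0 ∧
      RapidNear (fun k : Fin n → (Coord d →L[ℝ] ℝ) => ‖u.toFun (χ.testSection k T)‖)
        (fun i => (ξ i).2) := by
  constructor
  · rintro ⟨χ, hχ, h⟩
    exact ⟨χ, hχ, (rapidNear_iff fun k => norm_nonneg _).2 h⟩
  · rintro ⟨χ, hχ, h⟩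
    exact ⟨χ, hχ, (rapidNear_iff fun k => norm_nonneg _).1 h⟩

/-- Near a regular directed point all cutoffs with sufficiently small support can be used. -/
theorem exists_nhds_rapidNear {u : Distr d F E n H} {T : CoSect d F E n}
    {ξ : Fin n → CotangentBundle d M} (h : u.RegularDirected T ξ) :
    ∃ U ∈ 𝓝 (fun i => (ξ i).proj), ∀ χ : Cutoff d (fun i => (ξ i).proj),
      tsupport χ.toFun ⊆ U →
      RapidNear (fun k : Fin n → (Coord d →L[ℝ] ℝ) => ‖u.toFun (χ.testSection k T)‖)
        (fun i => (ξ i).2) := by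
  obtain ⟨χ, hχ, h⟩ := (regularDirected_iff u T ξ).1 h
  exact ⟨{x | χ.toFun x ≠ 0}, (isOpen_ne_fun χ.smooth.continuous continuous_const).mem_nhds hχ,
    fun χ' hχ' => rapidNear_of_tsupport_subset u T h hχ'⟩

end Localization

/-! ### Sections of the dual bundle and their external products -/

section Dual

variable {d : ℕ} {M : Type*} [TopologicalSpace M] [ChartedSpace (Coord d) M]
  [IsManifold (𝓡 d) ∞ M]
  {F : Type*} [NormedAddCommGroup F] [NormedSpace ℂ F]
  {E : M → Type*} [∀ x, AddCommGroup (E x)] [∀ x, Module ℂ (E x)] [∀ x, TopologicalSpace (E x)]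
  [TopologicalSpace (TotalSpace F E)] [FiberBundle F E] [VectorBundle ℂ F E] [VectorBundle ℝ F E]
  {n : ℕ}

/-- The linear form at `q` given by a section of the dual bundle. -/
def coLin (T : CoSect d F E 1) (q : M) : E q →ₗ[ℂ] ℂ :=
  (MultilinearMap.ofSubsingleton ℂ (E q) ℂ (0 : Fin 1)).symm (T.1 fun _ => q)

theorem coLin_apply (T : CoSect d F E 1) (q : M) (v : E q) :
    coLin T q v = T.1 (fun _ => q) (fun _ => v) := rfl

theorem apply_eq_coLin (T : CoSect d F E 1) (x : Fin 1 → M) (v : ∀ i, E (x i)) :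
    T.1 x v = coLin T (x 0) (v 0) := by
  obtain ⟨q, rfl⟩ : ∃ q, x = fun _ => q := ⟨x 0, funext fun i => by rw [Subsingleton.elim i 0]⟩
  rw [coLin_apply]
  congr 1
  funext i
  obtain rfl := Subsingleton.elim i 0
  rfl

theorem contMDiff_powDiag : ContMDiff (𝓡 d) (powModel d n) ∞ (fun (q : M) (_ : Fin n) => q) :=
  fun _ => contMDiffAt_powMk fun _ => contMDiffAt_id

theorem contMDiff_coLin (T : CoSect d F E 1) (s : Sect d F E) :
    ContMDiff (𝓡 d) 𝓘(ℝ, ℂ) ∞ (fun q => coLin T q (s.1 q)) :=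
  (T.2 fun _ => s).comp contMDiff_powDiag

/-- A section of the dual bundle from a family of linear forms. -/
def mkCo (τ : ∀ q, E q →ₗ[ℂ] ℂ)
    (hτ : ∀ s : Sect d F E, ContMDiff (𝓡 d) 𝓘(ℝ, ℂ) ∞ (fun q => τ q (s.1 q))) :
    CoSect d F E 1 :=
  ⟨fun x => (MultilinearMap.mkPiAlgebra ℂ (Fin 1) ℂ).compLinearMap (fun i => τ (x i)), fun s => by
    simpa using! (hτ (s 0)).comp (contMDiff_powProj (d := d) (0 : Fin 1))⟩

theorem coLin_mkCo (τ : ∀ q, E q →ₗ[ℂ] ℂ)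
    (hτ : ∀ s : Sect d F E, ContMDiff (𝓡 d) 𝓘(ℝ, ℂ) ∞ (fun q => τ q (s.1 q))) (q : M) (v : E q) :
    coLin (mkCo τ hτ) q v = τ q v := by
  rw [coLin_apply]
  simp [mkCo]

/-- The external product of sections of the dual bundle. -/
def coProd (T : Fin n → CoSect d F E 1) : CoSect d F E n :=
  ⟨fun x => (MultilinearMap.mkPiAlgebra ℂ (Fin n) ℂ).compLinearMap (fun i => coLin (T i) (x i)), by
    intro s
    have h : ∀ i : Fin n, ContMDiff (powModel d n) 𝓘(ℝ, ℂ) ∞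
        (fun x : Fin n → M => coLin (T i) (x i) ((s i).1 (x i))) := fun i =>
      (contMDiff_coLin (T i) (s i)).comp (contMDiff_powProj i)
    have hp : ContDiff ℝ ∞ (fun z : Fin n → ℂ => ∏ i, z i) :=
      contDiff_prod fun i _ => contDiff_apply ℝ ℂ i
    simpa using! hp.contMDiff.comp (contMDiff_pi_space.2 h)⟩

theorem coProd_apply (T : Fin n → CoSect d F E 1) (x : Fin n → M) (v : ∀ i, E (x i)) :
    (coProd T).1 x v = ∏ i, coLin (T i) (x i) (v i) := by
  simp [coProd]

variable [T2Space M] [ContMDiffVectorBundle ∞ F E (𝓡 d)] [FiniteDimensional ℂ F]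

theorem contMDiffAt_repr {ι : Type*} [Fintype ι] (bF : Module.Basis ι ℂ F) {p q : M}
    (hq : q ∈ (trivializationAt F E p).baseSet) (s : Sect d F E) (j : ι) :
    ContMDiffAt (𝓡 d) 𝓘(ℝ, ℂ) ∞
      (fun q => bF.repr ((trivializationAt F E p).linearMapAt ℂ q (s.1 q)) j) q := by
  set e := trivializationAt F E p
  have h1 := (e.contMDiffAt_section_iff (IB := 𝓡 d) (n := ∞) (s := s.1) hq).1 (s.2 q)
  have h2 : ContDiff ℝ ∞ (fun v : F => bF.repr v j) :=
    ((bF.coord j).toContinuousLinearMap.restrictScalars ℝ).contDiff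
  refine (h2.contMDiff.contMDiffAt.comp q h1).congr_of_eventuallyEq ?_
  filter_upwards [e.open_baseSet.mem_nhds hq] with q' hq'
  change bF.repr (e.linearMapAt ℂ q' (s.1 q')) j = bF.repr (e ⟨q', s.1 q'⟩).2 j
  rw [Trivialization.coe_linearMapAt_of_mem e hq']

variable (d) in
/-- A local coframe, cut off to a globally defined section of the dual bundle. -/
theorem exists_coframe {ι : Type*} [Fintype ι] (bF : Module.Basis ι ℂ F) (p : M) :
    ∃ τ : ι → CoSect d F E 1, ∀ᶠ q in 𝓝 p, ∀ j v,
      coLin (τ j) q v = bF.repr ((trivializationAt F E p).linearMapAt ℂ q v) j := by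
  set e := trivializationAt F E p
  obtain ⟨b, hb1, -, hb3, hb4⟩ := exists_bump (d := d)
    (e.open_baseSet.mem_nhds (mem_baseSet_trivializationAt F E p))
  refine ⟨fun j => mkCo (fun q => (b q : ℂ) • (bF.coord j ∘ₗ e.linearMapAt ℂ q)) fun s => ?_, ?_⟩
  · have hb : ContMDiff (𝓡 d) 𝓘(ℝ, ℂ) ∞ (fun q => (b q : ℂ)) :=
      Complex.ofRealCLM.contDiff.contMDiff.comp hb1
    refine contMDiff_of_tsupport fun q hq => ?_
    have hqs : q ∈ tsupport b := by
      refine (closure_mono (Function.support_subset_iff'.2 fun x hx => ?_) :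
        tsupport _ ⊆ tsupport b) hq
      simp [Function.notMem_support.1 hx]
    have h := (contDiff_mul (𝕜 := ℝ) (𝔸 := ℂ) (n := ∞)).contMDiff.contMDiffAt.comp q
      (hb.contMDiffAt.prodMk_space (contMDiffAt_repr bF (hb3 hqs) s j))
    exact h
  · filter_upwards [hb4] with q hq j v
    rw [coLin_mkCo]
    simp [hq, e]

variable {H : Type*} [NormedAddCommGroup H] [NormedSpace ℂ H]

/-- The coefficient functions are absorbed into the cutoffs, so the frequency k is untouched and
only the sections S_J remain. -/
theorem norm_toFun_testSection_le_sum {ι : Type*} [Fintype ι] (u : Distr d F E n H)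
    {y : Fin n → M} (χ : Cutoff d y) (T : CoSect d F E n) (a : ι → (Fin n → M) → ℂ)
    (ha : ∀ J, ContMDiff (powModel d n) 𝓘(ℝ, ℂ) ∞ (a J)) (S : ι → CoSect d F E n)
    (h : ∀ x, χ.toFun x ≠ 0 → T.1 x = ∑ J, a J x • (S J).1 x) (k : Fin n → (Coord d →L[ℝ] ℝ)) :
    ‖u.toFun (χ.testSection k T)‖ ≤
      ∑ J, ‖u.toFun ((χ.mul (a J) (ha J)).testSection k (S J))‖ := by
  have h1 : χ.testSection k T = ∑ J, (χ.mul (a J) (ha J)).testSection k (S J) := by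
    refine CoSect₀.ext fun x => ?_
    have h2 : (∑ J, (χ.mul (a J) (ha J)).testSection k (S J)).1.1 x =
        ∑ J, ((χ.mul (a J) (ha J)).testSection k (S J)).1.1 x := by
      simp [Finset.sum_apply]
    rw [h2]
    by_cases hx : χ.toFun x = 0
    · simp [Cutoff.testSection, Cutoff.mul, hx]
    · simp only [Cutoff.testSection, Cutoff.mul, h x hx, Finset.smul_sum, smul_smul]
      refine Finset.sum_congr rfl fun J _ => ?_
      congr 1
      ring
  rw [h1, map_sum]
  exact norm_sum_le _ _

/-- Regularity for external products implies regularity. -/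
theorem regularDirected_of_coProd (u : Distr d F E n H) {ξ : Fin n → CotangentBundle d M}
    (hξ : ∃ i, (ξ i).2 ≠ 0)
    (h : ∀ T : Fin n → CoSect d F E 1, u.RegularDirected (coProd T) ξ) (T : CoSect d F E n) :
    u.RegularDirected T ξ := by
  classical
  let bF := Module.finBasis ℂ F
  set y : Fin n → M := fun i => (ξ i).proj with hy
  choose τ hτ using fun i => exists_coframe d (E := E) bF (y i)
  choose s hs using fun (i : Fin n) (j : Fin (Module.finrank ℂ F)) =>
    exists_sect_eq_symm d (F := F) (E := E) (mem_baseSet_trivializationAt F E (y i)) (bF j)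
  let S : (Fin n → Fin (Module.finrank ℂ F)) → CoSect d F E n :=
    fun J => coProd fun i => τ i (J i)
  let a : (Fin n → Fin (Module.finrank ℂ F)) → (Fin n → M) → ℂ :=
    fun J x => T.1 x fun i => (s i (J i)).1 (x i)
  have ha : ∀ J, ContMDiff (powModel d n) 𝓘(ℝ, ℂ) ∞ (a J) := fun J => T.2 fun i => s i (J i)
  have hloc : ∀ᶠ x in 𝓝 y, T.1 x = ∑ J, a J x • (S J).1 x := by
    have h1 : ∀ᶠ x : Fin n → M in 𝓝 y, ∀ i, x i ∈ (trivializationAt F E (y i)).baseSet :=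
      Filter.eventually_all.2 fun i => (continuous_apply i).continuousAt.eventually
        ((trivializationAt F E (y i)).open_baseSet.mem_nhds
          (mem_baseSet_trivializationAt F E (y i)))
    have h2 : ∀ᶠ x : Fin n → M in 𝓝 y, ∀ i j v, coLin (τ i j) (x i) v =
        bF.repr ((trivializationAt F E (y i)).linearMapAt ℂ (x i) v) j :=
      Filter.eventually_all.2 fun i =>
        ((continuous_apply (A := fun _ => M) i).tendsto y).eventually
          (p := fun q => ∀ j v, coLin (τ i j) q v =
            bF.repr ((trivializationAt F E (y i)).linearMapAt ℂ q v) j) (hτ i)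
    have h3 : ∀ᶠ x : Fin n → M in 𝓝 y, ∀ i j, (s i j).1 (x i) =
        (trivializationAt F E (y i)).symm (x i) (bF j) :=
      Filter.eventually_all.2 fun i => Filter.eventually_all.2 fun j =>
        ((continuous_apply (A := fun _ => M) i).tendsto y).eventually
          (p := fun q => (s i j).1 q = (trivializationAt F E (y i)).symm q (bF j)) (hs i j)
    filter_upwards [h1, h2, h3] with x hx1 hx2 hx3
    refine MultilinearMap.ext fun v => ?_
    -- The coframe followed by the frame is the identity near `y`. Multilinearity therefore expands
    -- T in external products of coframes, with coefficients the components of T.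
    have hv : v = fun i => ∑ j, coLin (τ i j) (x i) (v i) • (s i j).1 (x i) := by
      funext i
      simp only [hx2, hx3, ← (trivializationAt F E (y i)).symmₗ_apply (R := ℂ) (hx1 i),
        ← map_smul, ← map_sum, bF.sum_repr]
      exact ((trivializationAt F E (y i)).symmₗ_linearMapAt (hx1 i) (v i)).symm
    conv_lhs => rw [hv]
    rw [MultilinearMap.map_sum]
    simp only [MultilinearMap.map_smul_univ, sum_apply, smul_apply, smul_eq_mul, S,
      coProd_apply, a]
    refine Finset.sum_congr rfl fun J _ => mul_comm _ _
  choose U hU hUr using fun J : Fin n → Fin (Module.finrank ℂ F) =>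
    exists_nhds_rapidNear (h fun i => τ i (J i))
  -- There are finitely many multi-indices, so one support condition serves every product χ a_J.
  obtain ⟨χ, hχ1, hχ⟩ := exists_cutoff (d := d) (Filter.inter_mem hloc
    (Filter.iInter_mem.2 hU))
  refine (regularDirected_iff u T ξ).2 ⟨χ, by rw [hχ1]; exact one_ne_zero, ?_⟩
  have hne : (fun i => (ξ i).2 : Fin n → (Coord d →L[ℝ] ℝ)) ≠ 0 := by
    obtain ⟨i, hi⟩ := hξ
    exact fun h0 => hi (congrFun h0 i)
  refine RapidNear.mono (RapidNear.sum Finset.univ hne fun J _ =>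
    hUr J (χ.mul (a J) (ha J)) ?_) fun k =>
    norm_toFun_testSection_le_sum u χ T a ha S (fun x hx => ?_) k
  · exact fun x hx => Set.mem_iInter.1 (hχ (tsupport_mul_subset_left hx)).2 J
  · exact (hχ (subset_tsupport _ hx)).1

end Dual

/-! ### The musical isomorphism and the conjugation of dual sections -/

section Musical

variable {d : ℕ} {M : Type*} [TopologicalSpace M] [ChartedSpace (Coord d) M]
  [IsManifold (𝓡 d) ∞ M]
  {F : Type*} [NormedAddCommGroup F] [NormedSpace ℂ F]
  {E : M → Type*} [∀ x, AddCommGroup (E x)] [∀ x, Module ℂ (E x)] [∀ x, TopologicalSpace (E x)]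
  [TopologicalSpace (TotalSpace F E)] [FiberBundle F E] [VectorBundle ℂ F E] [VectorBundle ℝ F E]

/-! ### Smoothness of matrix inversion. -/

section MatrixInverse

variable {ι : Type*} [Fintype ι] [DecidableEq ι]

theorem contDiff_matrix_det : ContDiff ℝ ∞ (fun A : ι → ι → ℂ => (Matrix.of A).det) := by
  simp only [Matrix.det_apply, Matrix.of_apply]
  refine ContDiff.sum fun σ _ => ContDiff.const_smul _ (contDiff_prod fun i _ => ?_)
  exact (contDiff_apply ℝ ℂ i).comp (contDiff_apply ℝ (ι → ℂ) (σ i))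

/-- Cramer's rule: the inverse is the adjugate over the determinant, and both are polynomial in the
entries. -/
theorem contDiffAt_matrix_inv_apply {A : ι → ι → ℂ} (hA : (Matrix.of A).det ≠ 0) (i j : ι) :
    ContDiffAt ℝ ∞ (fun A : ι → ι → ℂ => (Matrix.of A)⁻¹ i j) A := by
  have h1 : ContDiff ℝ ∞ (fun A : ι → ι → ℂ => (Matrix.of A).adjugate i j) := by
    simp only [Matrix.adjugate_apply]
    have h2 : ContDiff ℝ ∞ (fun A : ι → ι → ℂ =>
        (fun r => if r = j then Pi.single i 1 else A r : ι → ι → ℂ)) := by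
      refine contDiff_pi.2 fun r => ?_
      by_cases hr : r = j
      · simpa [hr] using contDiff_const
      · simpa [hr] using contDiff_apply ℝ (ι → ℂ) r
    convert! contDiff_matrix_det.comp h2 using 2 with A
    simp only [Function.comp_apply]
    congr 1
    ext r c
    by_cases hr : r = j <;> simp [Matrix.updateRow_apply, hr]
  refine (((contDiff_matrix_det.contDiffAt).inv hA).mul h1.contDiffAt).congr_of_eventuallyEq ?_
  filter_upwards with B
  rw [Matrix.inv_def, Ring.inverse_eq_inv']
  rfl

end MatrixInverse

namespace HermitianBundle

variable (B : HermitianBundle d F E)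

theorem bil_apply (q : M) (v w : E q) : B.bil q v w = B.herm q (B.conjF q v) w := rfl

theorem eq_zero_of_bil (q : M) (v : E q) (h : ∀ w, B.bil q v w = 0) : v = 0 := by
  have h1 := B.herm_nondegenerate q _ h
  rw [← B.conjF_conjF q v, h1, map_zero]

theorem bil_conjF (q : M) (v w : E q) :
    B.bil q (B.conjF q v) w = conj (B.bil q v (B.conjF q w)) := by
  rw [bil_apply, bil_apply, B.herm_conjF, B.conjF_conjF]
  simp

theorem sharp_apply {n : ℕ} (f : Fin n → Sect₀ d F E) (x : Fin n → M) (v : ∀ i, E (x i)) :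
    (B.sharp f).1.1 x v = ∏ i, B.bil (x i) ((f i).1.1 (x i)) (v i) := by
  simp [sharp]

theorem coLin_sharp (f : Sect₀ d F E) (q : M) (v : E q) :
    coLin (B.sharp fun _ : Fin 1 => f).1 q v = B.bil q (f.1.1 q) v := by
  rw [coLin_apply, sharp_apply]
  simp

/-- The conjugation of sections of the dual bundle. -/
def coConj (T : CoSect d F E 1) : CoSect d F E 1 :=
  mkCo (fun q =>
    { toFun := fun v => conj (coLin T q (B.conjF q v))
      map_add' := fun v w => by simp
      map_smul' := fun c v => by simp })
    fun s => Complex.conjCLE.contDiff.contMDiff.comp (contMDiff_coLin T (B.conjS s))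

theorem coLin_coConj (T : CoSect d F E 1) (q : M) (v : E q) :
    coLin (B.coConj T) q v = conj (coLin T q (B.conjF q v)) := coLin_mkCo _ _ q v

variable [FiniteDimensional ℂ F]

/-- Nondegeneracy makes v ↦ ⟨v, ·⟩ injective, and a finite-dimensional fibre has the dimension of
its dual. -/
theorem exists_bil_eq (q : M) (τ : E q →ₗ[ℂ] ℂ) : ∃ v, B.bil q v = τ := by
  have : FiniteDimensional ℂ (E q) :=
    ((trivializationAt F E q).linearEquivAt ℂ q
      (mem_baseSet_trivializationAt F E q)).symm.finiteDimensional
  have hinj : Function.Injective (B.bil q) := by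
    rw [← LinearMap.ker_eq_bot, LinearMap.ker_eq_bot']
    intro v hv
    exact B.eq_zero_of_bil q v fun w => by rw [hv]; rfl
  exact (LinearMap.injective_iff_surjective_of_finrank_eq_finrank
    (Subspace.dual_finrank_eq (K := ℂ) (V := E q)).symm).1 hinj τ

/-- The section of `B` that corresponds to a section of the dual bundle, as a function. -/
def flatFun (T : CoSect d F E 1) (q : M) : E q := (B.exists_bil_eq q (coLin T q)).choose

theorem bil_flatFun (T : CoSect d F E 1) (q : M) (v : E q) :
    B.bil q (B.flatFun T q) v = coLin T q v := by
  rw [flatFun, (B.exists_bil_eq q (coLin T q)).choose_spec]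

theorem eq_of_bil {q : M} {v w : E q} (h : ∀ z, B.bil q v z = B.bil q w z) : v = w := by
  rw [← sub_eq_zero]
  exact B.eq_zero_of_bil q _ fun z => by simp [h]

variable [T2Space M] [ContMDiffVectorBundle ∞ F E (𝓡 d)]

/-- In a local frame the components solve a linear system whose matrix is the Gram matrix of the
bilinear metric. This matrix is smooth and invertible, so the solution is smooth. -/
theorem flatFun_mem (T : CoSect d F E 1) : B.flatFun T ∈ Sect d F E := by
  classical
  intro p
  let bF := Module.finBasis ℂ F
  set e := trivializationAt F E p with he
  have hp : p ∈ e.baseSet := mem_baseSet_trivializationAt F E p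
  choose s hs using fun j => exists_sect_eq_symm d (F := F) (E := E) hp (bF j)
  let G : M → Fin (Module.finrank ℂ F) → Fin (Module.finrank ℂ F) → ℂ :=
    fun q i j => B.bil q ((s i).1 q) ((s j).1 q)
  have hG : ContMDiff (𝓡 d) 𝓘(ℝ, Fin (Module.finrank ℂ F) → Fin (Module.finrank ℂ F) → ℂ) ∞ G :=
    contMDiff_pi_space.2 fun i => contMDiff_pi_space.2 fun j =>
      B.herm_smooth (B.conjS (s i)) (s j)
  let t : Fin (Module.finrank ℂ F) → M → ℂ := fun j q => coLin T q ((s j).1 q)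
  have ht : ∀ j, ContMDiff (𝓡 d) 𝓘(ℝ, ℂ) ∞ (t j) := fun j => contMDiff_coLin T (s j)
  have hev : ∀ᶠ q in 𝓝 p, q ∈ e.baseSet ∧ ∀ j, (s j).1 q = e.symm q (bF j) :=
    Filter.Eventually.and (e.open_baseSet.mem_nhds hp) (Filter.eventually_all.2 hs)
  have hexp : ∀ q, (q ∈ e.baseSet ∧ ∀ j, (s j).1 q = e.symm q (bF j)) → ∀ w : E q,
      w = ∑ j, bF.repr (e.linearMapAt ℂ q w) j • (s j).1 q := by
    intro q hq w
    simp only [hq.2, ← e.symmₗ_apply (R := ℂ) hq.1, ← map_smul, ← map_sum, bF.sum_repr]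
    exact (e.symmₗ_linearMapAt hq.1 w).symm
  have hlin : ∀ q, (q ∈ e.baseSet ∧ ∀ j, (s j).1 q = e.symm q (bF j)) →
      ∀ c : Fin (Module.finrank ℂ F) → ℂ, (∑ j, c j • (s j).1 q) =
        e.symmₗ ℂ q (∑ j, c j • bF j) := by
    intro q hq c
    simp only [hq.2, ← e.symmₗ_apply (R := ℂ) hq.1, ← map_smul, ← map_sum]
  -- A vector in the kernel of the Gram matrix would give a combination of frame vectors orthogonal
  -- to the whole fibre.
  have hdet : ∀ q, (q ∈ e.baseSet ∧ ∀ j, (s j).1 q = e.symm q (bF j)) →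
      (Matrix.of (G q)).det ≠ 0 := by
    intro q hq h0
    obtain ⟨c, hc, hcG⟩ := Matrix.exists_vecMul_eq_zero_iff.2 h0
    have h1 : ∑ j, c j • (s j).1 q = 0 := by
      refine B.eq_zero_of_bil q _ fun w => ?_
      rw [hexp q hq w, map_sum]
      refine Finset.sum_eq_zero fun k _ => ?_
      have h2 := congrFun hcG k
      simp only [Matrix.vecMul, dotProduct, Matrix.of_apply, G, Pi.zero_apply] at h2
      rw [map_smul, map_sum, LinearMap.sum_apply]
      simp only [map_smul, LinearMap.smul_apply, smul_eq_mul, h2, mul_zero]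
    rw [hlin q hq] at h1
    have h2 : ∑ j, c j • bF j = 0 := by
      have h3 := e.linearMapAt_symmₗ (R := ℂ) hq.1 (∑ j, c j • bF j)
      rw [h1, map_zero] at h3
      exact h3.symm
    exact hc (funext fun j => Fintype.linearIndependent_iff.1 bF.linearIndependent c h2 j)
  -- The solution of c G = t with c and t as row vectors, hence the inverse on the right.
  let c : Fin (Module.finrank ℂ F) → M → ℂ := fun i q => ∑ j, t j q * (Matrix.of (G q))⁻¹ j i
  have hc : ∀ i, ContMDiffAt (𝓡 d) 𝓘(ℝ, ℂ) ∞ (c i) p := by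
    intro i
    have hterm : ∀ j, ContMDiffAt (𝓡 d) 𝓘(ℝ, ℂ) ∞
        (fun q => t j q * (Matrix.of (G q))⁻¹ j i) p := fun j => by
      have h1 : ContMDiffAt (𝓡 d) 𝓘(ℝ, ℂ) ∞ (fun q => (Matrix.of (G q))⁻¹ j i) p :=
        (contDiffAt_matrix_inv_apply (hdet p hev.self_of_nhds) j i).contMDiffAt.comp p
          hG.contMDiffAt
      exact (contDiff_mul (𝕜 := ℝ) (𝔸 := ℂ) (n := ∞)).contMDiff.contMDiffAt.comp p
        ((ht j).contMDiffAt.prodMk_space h1)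
    have hsum : ContDiff ℝ ∞ (fun z : Fin (Module.finrank ℂ F) → ℂ => ∑ j, z j) :=
      ContDiff.sum fun j _ => contDiff_apply ℝ ℂ j
    exact hsum.contMDiff.contMDiffAt.comp p (contMDiffAt_pi_space.2 hterm)
  rw [e.contMDiffAt_section_iff hp]
  have hmain : ContMDiffAt (𝓡 d) 𝓘(ℝ, F) ∞ (fun q => ∑ i, c i q • bF i) p := by
    have hsum : ContDiff ℝ ∞ (fun z : Fin (Module.finrank ℂ F) → ℂ => ∑ j, z j • bF j) :=
      ContDiff.sum fun j _ => (contDiff_apply ℝ ℂ j).smul contDiff_const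
    exact hsum.contMDiff.contMDiffAt.comp p (contMDiffAt_pi_space.2 hc)
  refine hmain.congr_of_eventuallyEq ?_
  filter_upwards [hev] with q hq
  have h1 : B.flatFun T q = ∑ i, c i q • (s i).1 q := by
    refine B.eq_of_bil fun w => ?_
    rw [bil_flatFun, hexp q hq w, map_sum, map_sum]
    refine Finset.sum_congr rfl fun k _ => ?_
    rw [map_smul, map_smul, map_sum, LinearMap.sum_apply]
    congr 1
    simp only [map_smul, LinearMap.smul_apply, smul_eq_mul, c, Finset.sum_mul]
    rw [Finset.sum_comm]
    have h2 : (Matrix.of (G q))⁻¹ * Matrix.of (G q) = 1 :=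
      Matrix.nonsing_inv_mul _ (isUnit_iff_ne_zero.2 (hdet q hq))
    have h3 : ∀ j, ∑ i, (Matrix.of (G q))⁻¹ j i * G q i k = (1 : Matrix _ _ ℂ) j k := by
      intro j
      rw [← h2, Matrix.mul_apply]
      rfl
    calc coLin T q ((s k).1 q) = ∑ j, t j q * (1 : Matrix _ _ ℂ) j k := by
          simp [Matrix.one_apply, t]
      _ = _ := by
          refine Finset.sum_congr rfl fun j _ => ?_
          rw [← h3, Finset.mul_sum]
          refine Finset.sum_congr rfl fun i _ => ?_
          simp only [G]
          ring
  rw [h1, hlin q hq, e.symmₗ_apply (R := ℂ) hq.1, e.apply_mk_symm hq.1]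

/-- The inverse of `f ↦ f^♯` on test sections. -/
def flat₀ : CoSect₀ d F E 1 →ₗ[ℂ] Sect₀ d F E where
  toFun T := ⟨⟨B.flatFun T.1, B.flatFun_mem T.1⟩, by
    have h1 : IsCompact ((fun x : Fin 1 → M => x 0) '' dsupp T.1.1) :=
      IsCompact.image T.2 (continuous_apply 0)
    refine h1.of_isClosed_subset isClosed_closure (closure_minimal ?_ h1.isClosed)
    intro q hq
    refine ⟨fun _ => q, subset_closure fun h0 => hq ?_, rfl⟩
    refine B.eq_zero_of_bil q _ fun w => ?_
    change B.bil q (B.flatFun T.1 q) w = 0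
    rw [bil_flatFun, coLin_apply, h0]
    rfl⟩
  map_add' S T := Subtype.ext <| Subtype.ext <| funext fun q => B.eq_of_bil fun w => by
    change B.bil q (B.flatFun (S.1 + T.1) q) w = B.bil q (B.flatFun S.1 q + B.flatFun T.1 q) w
    simp [bil_flatFun, coLin_apply]
  map_smul' c T := Subtype.ext <| Subtype.ext <| funext fun q => B.eq_of_bil fun w => by
    change B.bil q (B.flatFun (c • T.1) q) w = B.bil q (c • B.flatFun T.1 q) w
    simp [bil_flatFun, coLin_apply]

theorem bil_flat₀ (T : CoSect₀ d F E 1) (q : M) (v : E q) :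
    B.bil q ((B.flat₀ T).1.1 q) v = coLin T.1 q v := B.bil_flatFun T.1 q v

/-- In degree one every test section is some f^♯, so prescribing values on the f^♯ determines a
distribution completely. -/
theorem sharp_flat₀ (T : CoSect₀ d F E 1) : (B.sharp fun _ => B.flat₀ T) = T :=
  CoSect₀.ext fun x => MultilinearMap.ext fun v => by
    rw [apply_eq_coLin, apply_eq_coLin, coLin_sharp, bil_flat₀]

theorem flat₀_sharp (f : Sect₀ d F E) : B.flat₀ (B.sharp fun _ => f) = f :=
  Subtype.ext <| Subtype.ext <| funext fun q => B.eq_of_bil fun w => by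
    rw [bil_flat₀, coLin_sharp]

end HermitianBundle

end Musical

/-! ### Vector-valued distributions from two-point distributions -/

section VectorDistribution

variable {d : ℕ} {M : Type*} [TopologicalSpace M] [ChartedSpace (Coord d) M]
  [IsManifold (𝓡 d) ∞ M] [T2Space M]
  {F : Type*} [NormedAddCommGroup F] [NormedSpace ℂ F] [FiniteDimensional ℂ F]
  {E : M → Type*} [∀ x, AddCommGroup (E x)] [∀ x, Module ℂ (E x)] [∀ x, TopologicalSpace (E x)]
  [TopologicalSpace (TotalSpace F E)] [FiberBundle F E] [VectorBundle ℂ F E] [VectorBundle ℝ F E]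
  [ContMDiffVectorBundle ∞ F E (𝓡 d)]

variable (F) in
-- The seminorms in `Distr.continuous` involve frame vectors of norm at most 1 only; this basis is
-- among them.
theorem exists_basis_norm_le_one :
    ∃ b : Module.Basis (Fin (Module.finrank ℂ F)) ℂ F, ∀ j, ‖b j‖ ≤ 1 := by
  let b := Module.finBasis ℂ F
  have hb : ∀ j, ((‖b j‖⁻¹ : ℝ) : ℂ) ≠ 0 := fun j => by
    simpa using b.ne_zero j
  refine ⟨b.unitsSMul fun j => Units.mk0 _ (hb j), fun j => ?_⟩
  rw [Module.Basis.unitsSMul_apply, Units.smul_mk0, norm_smul]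
  simp [b.ne_zero j]

theorem localRep_one (T : CoSect d F E 1) (y : Fin 1 → M) (v : Fin 1 → F)
    (z : Fin 1 → Coord d) :
    localRep d F E y T.1 v z = coLin T (coordsInv y z 0)
      ((trivializationAt F E (y 0)).symm (coordsInv y z 0) (v 0)) := by
  rw [localRep, apply_eq_coLin]
  rfl

/-- The conjugation of dual sections is bounded with respect to the seminorms of test sections. -/
theorem exists_norm_iteratedFDeriv_coConj_le (B : HermitianBundle d F E) {y : Fin 1 → M}
    {K : Set (Fin 1 → M)} (hK : IsCompact K) (hKy : K ⊆ niceDomain d F E y) (N : ℕ) :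
    ∃ C : ℝ, 0 ≤ C ∧ ∀ T : CoSect d F E 1, ∀ x ∈ K, ∀ b : ℝ,
      (∀ m ≤ N, ∀ v : Fin 1 → F, (∀ i, ‖v i‖ ≤ 1) →
        ‖iteratedFDeriv ℝ m (localRep d F E y T.1 v) (coords d y x)‖ ≤ b) →
      ∀ m ≤ N, ∀ v : Fin 1 → F, (∀ i, ‖v i‖ ≤ 1) →
        ‖iteratedFDeriv ℝ m (localRep d F E y (B.coConj T).1 v) (coords d y x)‖ ≤ C * b := by
  obtain ⟨bF, hbF⟩ := exists_basis_norm_le_one F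
  obtain ⟨C₁, hC₁0, hC₁⟩ := exists_norm_iteratedFDeriv_localRep_le (d := d) (E := E) bF 1
  set e := trivializationAt F E (y 0) with he
  have hO := isOpen_niceRange (d := d) (F := F) (E := E) y
  have hKc : IsCompact (coords d y '' K) := hK.image_of_continuousOn fun x hx =>
    (contMDiffAt_coords (hKy hx).1).continuousAt.continuousWithinAt
  have hKO : coords d y '' K ⊆ niceRange d F E y := by
    rintro _ ⟨x, hx, rfl⟩
    exact coords_mem_niceRange (hKy hx)
  -- The complex conjugates of the matrix entries of 𝒞 in the local frame. The components of the
  -- conjugate section are those of T, conjugated and multiplied by this smooth matrix.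
  let A : Fin (Module.finrank ℂ F) → Fin (Module.finrank ℂ F) → (Fin 1 → Coord d) → ℂ :=
    fun j k z => conj (bF.repr (e.linearMapAt ℂ (coordsInv y z 0)
      (B.conjF _ (e.symm (coordsInv y z 0) (bF j)))) k)
  have hA : ∀ j k, ContDiffOn ℝ ∞ (A j k) (niceRange d F E y) := by
    intro j k z hz
    have hq : coordsInv y z 0 ∈ e.baseSet := hz.2.2 0
    obtain ⟨s, hs⟩ := exists_sect_eq_symm d hq (bF j)
    have h1 := contMDiffAt_repr bF hq (B.conjS s) k
    have h2 : ContMDiffAt (𝓡 d) 𝓘(ℝ, ℂ) ∞ (fun q => bF.repr (e.linearMapAt ℂ q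
        (B.conjF _ (e.symm q (bF j)))) k) (coordsInv y z 0) := by
      refine h1.congr_of_eventuallyEq ?_
      filter_upwards [hs] with q hq
      rw [← hq]
      rfl
    have h3 : ContMDiffAt (powModel d 1) 𝓘(ℝ, ℂ) ∞ (fun x : Fin 1 → M =>
        conj (bF.repr (e.linearMapAt ℂ (x 0) (B.conjF _ (e.symm (x 0) (bF j)))) k))
        (coordsInv y z) :=
      (Complex.conjCLE.contDiff.contMDiff.contMDiffAt.comp (coordsInv y z)
        (h2.comp (coordsInv y z) (contMDiff_powProj (d := d) (0 : Fin 1)).contMDiffAt))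
    exact (contDiffAt_comp_coordsInv hz.1 h3).contDiffWithinAt
  choose a ha0 ha using fun j k => exists_norm_iteratedFDeriv_le hO (hA j k) hKc hKO N
  set a' := ∑ j, ∑ k, a j k with ha'
  have haa : ∀ j k, a j k ≤ a' := fun j k =>
    (Finset.single_le_sum (f := a j) (fun k _ => ha0 j k) (Finset.mem_univ k)).trans
      (Finset.single_le_sum (f := fun j => ∑ k, a j k)
        (fun j _ => Finset.sum_nonneg fun k _ => ha0 j k) (Finset.mem_univ j))
  have ha'0 : 0 ≤ a' := Finset.sum_nonneg fun j _ => Finset.sum_nonneg fun k _ => ha0 j k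
  refine ⟨C₁ * (Module.finrank ℂ F * (2 ^ N * a')), by positivity, fun T x hx b hb m hm v hv => ?_⟩
  have hxO := hKO ⟨x, hx, rfl⟩
  have key : ∀ J : Fin 1 → Fin (Module.finrank ℂ F),
      ‖iteratedFDeriv ℝ m (localRep d F E y (B.coConj T).1 fun i => bF (J i)) (coords d y x)‖ ≤
        Module.finrank ℂ F * (2 ^ N * (a' * b)) := by
    intro J
    let Q : Fin (Module.finrank ℂ F) → (Fin 1 → Coord d) → ℂ :=
      fun k => Complex.conjLIE ∘ localRep d F E y T.1 fun _ => bF k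
    have hQ : ∀ k, ContDiffOn ℝ ∞ (Q k) (niceRange d F E y) := fun k =>
      Complex.conjLIE.contDiff.comp_contDiffOn (contDiffOn_localRep T y _)
    have h1 : localRep d F E y (B.coConj T).1 (fun i => bF (J i)) =ᶠ[𝓝 (coords d y x)]
        fun z => ∑ k, A (J 0) k z * Q k z := by
      filter_upwards [hO.mem_nhds hxO] with z hz
      have hq : coordsInv y z 0 ∈ e.baseSet := hz.2.2 0
      rw [localRep_one, B.coLin_coConj]
      set w := B.conjF _ (e.symm (coordsInv y z 0) (bF (J 0))) with hw
      have hexp : w = ∑ k, bF.repr (e.linearMapAt ℂ (coordsInv y z 0) w) k •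
          e.symm (coordsInv y z 0) (bF k) := by
        simp only [← e.symmₗ_apply (R := ℂ) hq, ← map_smul, ← map_sum, bF.sum_repr]
        exact (e.symmₗ_linearMapAt hq w).symm
      conv_lhs => rw [hexp]
      rw [map_sum, map_sum]
      refine Finset.sum_congr rfl fun k _ => ?_
      simp only [map_smul, smul_eq_mul, map_mul, A, Q, Function.comp_apply, localRep_one]
      rfl
    rw [(h1.iteratedFDeriv ℝ m).self_of_nhds]
    have hterm : ∀ k, ContDiffAt ℝ m (fun z => A (J 0) k z * Q k z) (coords d y x) := fun k =>
      (((hA (J 0) k).mul (hQ k)).contDiffAt (hO.mem_nhds hxO)).of_le (by exact_mod_cast le_top)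
    rw [iteratedFDeriv_fun_sum_apply fun k _ => hterm k]
    refine (norm_sum_le _ _).trans ?_
    refine (Finset.sum_le_sum fun k _ => norm_iteratedFDeriv_mul_le_of_le hO (hA (J 0) k) (hQ k)
      hxO (fun m hm => (ha (J 0) k m hm _ ⟨x, hx, rfl⟩).trans (haa _ _)) (b := b)
      (fun m hm => ?_) m hm).trans ?_
    · rw [LinearIsometryEquiv.norm_iteratedFDeriv_comp_left]
      exact hb m hm _ fun _ => hbF k
    · simp
  refine (hC₁ (B.coConj T) y _ hxO m _ key v hv).trans (le_of_eq ?_)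
  ring

/-- The embedding of the `i`-th factor, as used to pull functions back along a projection. -/
def factorProj (d : ℕ) {n : ℕ} (i : Fin n) : (Fin n → Coord d) →L[ℝ] (Fin 1 → Coord d) :=
  ContinuousLinearMap.pi fun _ => ContinuousLinearMap.proj i

theorem norm_factorProj_le {n : ℕ} (i : Fin n) : ‖factorProj d i‖ ≤ 1 := by
  refine ContinuousLinearMap.opNorm_le_bound _ zero_le_one fun v => ?_
  rw [one_mul]
  exact (pi_norm_le_iff_of_nonneg (norm_nonneg _)).2 fun _ => norm_le_pi_norm v i

theorem norm_iteratedFDeriv_comp_factorProj_le {n : ℕ} (i : Fin n) {O : Set (Fin 1 → Coord d)}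
    (hO : IsOpen O) {A : (Fin 1 → Coord d) → ℂ} (hA : ContDiffOn ℝ ∞ A O) {z : Fin n → Coord d}
    (hz : factorProj d i z ∈ O) (m : ℕ) :
    ‖iteratedFDeriv ℝ m (A ∘ factorProj d i) z‖ ≤ ‖iteratedFDeriv ℝ m A (factorProj d i z)‖ := by
  have hO' : IsOpen (factorProj d i ⁻¹' O) := hO.preimage (factorProj d i).continuous
  rw [← iteratedFDerivWithin_of_isOpen m hO' hz, ← iteratedFDerivWithin_of_isOpen m hO hz,
    ContinuousLinearMap.iteratedFDerivWithin_comp_right _ hA hO.uniqueDiffOn hO'.uniqueDiffOn hz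
      (by exact_mod_cast le_top)]
  refine (ContinuousMultilinearMap.norm_compContinuousLinearMap_le _ _).trans ?_
  refine mul_le_of_le_one_right (norm_nonneg _) ?_
  exact Finset.prod_le_one (fun _ _ => norm_nonneg _) fun _ _ => norm_factorProj_le i

variable {H : Type*} [NormedAddCommGroup H] [InnerProductSpace ℂ H]

/-- If `⟨Φ(𝒞 f), Φ(h)⟩` is given by a distribution, then `Φ` is a vector-valued distribution. -/
theorem exists_vectorDistr (B : HermitianBundle d F E) (Φ : Sect₀ d F E →ₗ[ℂ] H)
    (W : Distr d F E 2 ℂ)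
    (hW : ∀ f h, W.toFun (B.sharp ![f, h]) = inner ℂ (Φ (B.conj₀ f)) (Φ h)) :
    ∃ u : Distr d F E 1 H, ∀ f : Fin 1 → Sect₀ d F E, u.toFun (B.sharp f) = Φ (f 0) := by
  refine ⟨⟨Φ ∘ₗ B.flat₀, fun y K hK hKy => ?_⟩, fun f => ?_⟩
  swap
  · obtain ⟨g, rfl⟩ : ∃ g, f = fun _ => g :=
      ⟨f 0, funext fun i => by rw [Subsingleton.elim i 0]⟩
    simp [B.flat₀_sharp]
  let K₂ : Set (Fin 2 → M) := Set.univ.pi fun _ => (fun x : Fin 1 → M => x 0) '' K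
  have hK₂ : IsCompact K₂ := isCompact_univ_pi fun _ => hK.image (continuous_apply 0)
  have hmem : ∀ x ∈ K₂, ∀ i, (fun _ => x i : Fin 1 → M) ∈ K := by
    intro x hx i
    obtain ⟨x', hx', h⟩ := hx i trivial
    have : x' = fun _ => x i := funext fun j => by rw [Subsingleton.elim j 0]; exact h
    rwa [← this]
  obtain ⟨C, N, hC⟩ := W.continuous (fun _ => y 0) K₂ hK₂ (fun x hx =>
    ⟨fun i => (hKy (hmem x hx i)).1 0, fun i => (hKy (hmem x hx i)).2 0⟩)
  obtain ⟨C₁, hC₁0, hC₁⟩ := exists_norm_iteratedFDeriv_coConj_le B hK hKy N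
  refine ⟨√(|C| * (2 ^ N * C₁)), N, fun T hT b hb0 hb => ?_⟩
  set f := B.flat₀ T with hf
  set S := B.sharp ![B.conj₀ f, f] with hS
  have hWS : W.toFun S = ((‖Φ f‖ ^ 2 : ℝ) : ℂ) := by
    rw [hS, hW, B.conj₀_conj₀, inner_self_eq_norm_sq_to_K]
    push_cast
    rfl
  -- The section `S` is the external product of the conjugate of T with T, on which W takes the
  -- value ‖Φ f‖². Its seminorms are bounded by a constant times b², so a square root gives a bound
  -- linear in b.
  have hSapp : ∀ (x : Fin 2 → M) (v : ∀ i, E (x i)), S.1.1 x v =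
      coLin (B.coConj T.1) (x 0) (v 0) * coLin T.1 (x 1) (v 1) := by
    intro x v
    rw [hS, B.sharp_apply, Fin.prod_univ_two, B.coLin_coConj, ← B.bil_flat₀, ← B.bil_flat₀,
      ← B.bil_conjF]
    rfl
  have hSK : dsupp S.1.1 ⊆ K₂ := by
    refine closure_minimal (fun x hx => ?_) hK₂.isClosed
    have h0 : ∀ i, T.1.1 (fun _ => x i) ≠ 0 := by
      intro i h0
      refine hx (MultilinearMap.ext fun v => ?_)
      rw [hSapp, B.coLin_coConj, coLin_apply, coLin_apply]
      fin_cases i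
      · simp only [Fin.zero_eta] at h0
        simp [h0]
      · simp only [Fin.mk_one] at h0
        simp [h0]
    exact fun i _ => ⟨fun _ => x i, hT (subset_closure (h0 i)), rfl⟩
  have key := hC S hSK (2 ^ N * ((C₁ * b) * b)) (by positivity) (by
    intro m hm x hx v hv
    have hO := isOpen_niceRange (d := d) (F := F) (E := E) y
    let P : (Fin 1 → Coord d) → ℂ := localRep d F E y (B.coConj T.1).1 fun _ => v 0
    let Q : (Fin 1 → Coord d) → ℂ := localRep d F E y T.1.1 fun _ => v 1
    have hP : ContDiffOn ℝ ∞ P (niceRange d F E y) := contDiffOn_localRep _ y _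
    have hQ : ContDiffOn ℝ ∞ Q (niceRange d F E y) := contDiffOn_localRep _ y _
    have hrep : localRep d F E (fun _ : Fin 2 => y 0) S.1.1 v =
        fun z => (P ∘ factorProj d 0) z * (Q ∘ factorProj d 1) z := by
      funext z
      simp only [P, Q, Function.comp_apply, localRep_one]
      rw [localRep, hSapp]
      rfl
    have hpr : ∀ i : Fin 2, factorProj d i (coords d (fun _ : Fin 2 => y 0) x) =
        coords d y (fun _ => x i) := by
      intro i
      funext j
      obtain rfl := Subsingleton.elim j 0
      rfl
    have hz : ∀ i : Fin 2, factorProj d i (coords d (fun _ : Fin 2 => y 0) x) ∈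
        niceRange d F E y := fun i => by
      rw [hpr]
      exact coords_mem_niceRange (hKy (hmem x hx i))
    have hO₂ : IsOpen ((factorProj d (0 : Fin 2)) ⁻¹' niceRange d F E y ∩
        (factorProj d (1 : Fin 2)) ⁻¹' niceRange d F E y) :=
      (hO.preimage (factorProj d 0).continuous).inter (hO.preimage (factorProj d 1).continuous)
    rw [hrep]
    refine norm_iteratedFDeriv_mul_le_of_le hO₂
      (hP.comp (factorProj d 0).contDiff.contDiffOn fun z hz => hz.1)
      (hQ.comp (factorProj d 1).contDiff.contDiffOn fun z hz => hz.2) ⟨hz 0, hz 1⟩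
      (fun m hm => ?_) (fun m hm => ?_) m hm
    · refine (norm_iteratedFDeriv_comp_factorProj_le 0 hO hP (hz 0) m).trans ?_
      rw [hpr]
      exact hC₁ T.1 _ (hmem x hx 0) b (fun m hm v hv => hb m hm _ (hmem x hx 0) v hv) m hm _
        fun _ => hv 0
    · refine (norm_iteratedFDeriv_comp_factorProj_le 1 hO hQ (hz 1) m).trans ?_
      rw [hpr]
      exact hb m hm _ (hmem x hx 1) _ fun _ => hv 1)
  rw [hWS, Complex.norm_real, Real.norm_of_nonneg (by positivity)] at key
  change ‖Φ f‖ ≤ _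
  have h2 : ‖Φ f‖ ^ 2 ≤ (|C| * (2 ^ N * C₁)) * b ^ 2 := by
    calc ‖Φ f‖ ^ 2 ≤ C * (2 ^ N * ((C₁ * b) * b)) := key
      _ ≤ |C| * (2 ^ N * ((C₁ * b) * b)) := by
          gcongr
          exact le_abs_self C
      _ = _ := by ring
  calc ‖Φ f‖ ≤ √((|C| * (2 ^ N * C₁)) * b ^ 2) := Real.le_sqrt_of_sq_le h2
    _ = _ := by rw [Real.sqrt_mul (by positivity), Real.sqrt_sq hb0]

end VectorDistribution

/-! ### Wavefront sets of two-point functions -/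

section TensorCutoff

variable {d : ℕ} {M : Type*} [TopologicalSpace M] [ChartedSpace (Coord d) M] {n : ℕ}

/-- The complex conjugate of a cutoff. -/
def Cutoff.star {y : Fin n → M} (χ : Cutoff d y) : Cutoff d y where
  toFun x := conj (χ.toFun x)
  smooth := Complex.conjCLE.contDiff.contMDiff.comp χ.smooth
  compact := χ.compact.comp_left (g := fun z : ℂ => conj z) (map_zero _)
  support := Set.Subset.trans (closure_mono (t := Function.support χ.toFun)
    fun x hx h0 => hx (by simp [h0])) χ.support

theorem Cutoff.tsupport_star_subset {y : Fin n → M} (χ : Cutoff d y) :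
    tsupport χ.star.toFun ⊆ tsupport χ.toFun :=
  closure_mono fun x hx h0 => hx (by simp [Cutoff.star, h0])

theorem tsupport_prod_subset {y : Fin n → M} (χ : ∀ i, Cutoff d (fun _ : Fin 1 => y i)) :
    tsupport (fun x : Fin n → M => ∏ i, (χ i).toFun fun _ => x i) ⊆
      {x | ∀ i, (fun _ => x i) ∈ tsupport (χ i).toFun} := by
  refine closure_minimal (fun x hx i => subset_tsupport _ fun h0 => hx
    (Finset.prod_eq_zero (Finset.mem_univ i) h0)) ?_
  simp only [Set.ofPred_forall]
  exact isClosed_iInter fun i => (isClosed_tsupport _).preimage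
    (continuous_pi fun _ => continuous_apply i)

variable [IsManifold (𝓡 d) ∞ M]

/-- The tensor product of cutoffs. -/
def Cutoff.tensor {y : Fin n → M} (χ : ∀ i, Cutoff d (fun _ : Fin 1 => y i)) : Cutoff d y where
  toFun x := ∏ i, (χ i).toFun fun _ => x i
  smooth := by
    have h : ∀ i : Fin n, ContMDiff (powModel d n) 𝓘(ℝ, ℂ) ∞
        (fun x : Fin n → M => (χ i).toFun fun _ => x i) := fun i =>
      (χ i).smooth.comp (contMDiff_powDiag.comp (contMDiff_powProj i))
    have hp : ContDiff ℝ ∞ (fun z : Fin n → ℂ => ∏ i, z i) :=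
      contDiff_prod fun i _ => contDiff_apply ℝ ℂ i
    exact hp.contMDiff.comp (contMDiff_pi_space.2 h)
  compact := by
    refine (isCompact_univ_pi fun i => (χ i).compact.image
      (continuous_apply (A := fun _ => M) (0 : Fin 1))).of_isClosed_subset
      (isClosed_tsupport _) ((tsupport_prod_subset χ).trans fun x hx i _ => ⟨_, hx i, rfl⟩)
  support := (tsupport_prod_subset χ).trans fun x hx i => (χ i).support (hx i) 0

/-- The joint support has to be small for regularity on the product, and the factors have to be
small for regularity in each variable. -/
theorem exists_tensor_cutoff [T2Space M] {y : Fin n → M} {U : Set (Fin n → M)} (hU : U ∈ 𝓝 y)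
    {O : Fin n → Set (Fin 1 → M)} (hO : ∀ i, O i ∈ 𝓝 (fun _ => y i)) :
    ∃ χ : ∀ i, Cutoff d (fun _ : Fin 1 => y i), (Cutoff.tensor χ).toFun y = 1 ∧
      tsupport (Cutoff.tensor χ).toFun ⊆ U ∧ ∀ i, tsupport (χ i).toFun ⊆ O i := by
  rw [nhds_pi, Filter.mem_pi'] at hU
  obtain ⟨I, t, ht, htU⟩ := hU
  choose χ h1 h2 using fun i => exists_cutoff (d := d) (Filter.inter_mem (hO i)
    ((continuous_apply (A := fun _ => M) (0 : Fin 1)).continuousAt (ht i)))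
  refine ⟨χ, by simp [Cutoff.tensor, h1], fun x hx => htU fun i _ => ?_,
    fun i x hx => (h2 i hx).1⟩
  exact (h2 i (tsupport_prod_subset χ hx i)).2

end TensorCutoff

/-! ### Wavefront sets of W and of the vector-valued distribution u compared. -/

section TwoPoint

variable {d : ℕ} {M : Type*} [TopologicalSpace M] [ChartedSpace (Coord d) M]
  [IsManifold (𝓡 d) ∞ M] [T2Space M]
  {F : Type*} [NormedAddCommGroup F] [NormedSpace ℂ F] [FiniteDimensional ℂ F]
  {E : M → Type*} [∀ x, AddCommGroup (E x)] [∀ x, Module ℂ (E x)] [∀ x, TopologicalSpace (E x)]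
  [TopologicalSpace (TotalSpace F E)] [FiberBundle F E] [VectorBundle ℂ F E] [VectorBundle ℝ F E]
  [ContMDiffVectorBundle ∞ F E (𝓡 d)] {n : ℕ}

theorem coLin_testSection {y : Fin 1 → M} (χ : Cutoff d y) (k : Fin 1 → (Coord d →L[ℝ] ℝ))
    (T : CoSect d F E 1) (q : M) (v : E q) :
    coLin (χ.testSection k T).1 q v =
      χ.toFun (fun _ => q) * wave y k (fun _ => q) * coLin T q v := rfl

theorem wave_eq_prod (y : Fin n → M) (k : Fin n → (Coord d →L[ℝ] ℝ)) (x : Fin n → M) :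
    wave y k x = ∏ i, wave (fun _ : Fin 1 => y i) (fun _ => k i) (fun _ => x i) := by
  simp only [wave, ← Complex.exp_sum, ← Finset.mul_sum]
  simp [coords]

theorem wave_neg (y : Fin n → M) (k : Fin n → (Coord d →L[ℝ] ℝ)) (x : Fin n → M) :
    wave y (-k) x = conj (wave y k x) := by
  simp [wave, ← Complex.exp_conj]

namespace HermitianBundle

variable (B : HermitianBundle d F E)

/-- The plane wave on the product factorizes, so a product cutoff with an external product of
sections gives a pure tensor. -/
theorem sharp_eq_testSection {y : Fin n → M} (χ : ∀ i, Cutoff d (fun _ : Fin 1 => y i))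
    (k : Fin n → (Coord d →L[ℝ] ℝ)) (T : Fin n → CoSect d F E 1) (g : Fin n → Sect₀ d F E)
    (hg : ∀ i q v, B.bil q ((g i).1.1 q) v = coLin ((χ i).testSection (fun _ => k i) (T i)).1 q v) :
    B.sharp g = (Cutoff.tensor χ).testSection k (coProd T) := by
  refine CoSect₀.ext fun x => MultilinearMap.ext fun v => ?_
  rw [sharp_apply]
  simp only [hg, coLin_testSection, Finset.prod_mul_distrib, ← wave_eq_prod]
  change _ = (_ * _) * (coProd T).1 x v
  rw [coProd_apply]
  rfl

/-- Conjugation reverses the frequency. This is why the first slot of W sees V^+ when u sees V^-. -/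
theorem sharp_conj₀_flat₀ {y : Fin 1 → M} (χ : Cutoff d y) (k : Fin 1 → (Coord d →L[ℝ] ℝ))
    (T : CoSect d F E 1) :
    (B.sharp fun _ => B.conj₀ (B.flat₀ (χ.testSection k T))) =
      χ.star.testSection (-k) (B.coConj T) := by
  refine CoSect₀.ext fun x => MultilinearMap.ext fun v => ?_
  rw [apply_eq_coLin, apply_eq_coLin, coLin_sharp, coLin_testSection, coLin_coConj, wave_neg]
  change B.bil _ (B.conjF _ _) _ = _
  rw [bil_conjF, bil_flat₀, coLin_testSection]
  simp [Cutoff.star]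

end HermitianBundle

/-- The transpose action of a smooth bundle endomorphism on sections of the dual bundle. -/
def coComp (T : CoSect d F E 1) (r : ∀ q, E q →ₗ[ℂ] E q)
    (hr : ∀ s : Sect d F E, (fun q => r q (s.1 q)) ∈ Sect d F E) : CoSect d F E 1 :=
  mkCo (fun q => coLin T q ∘ₗ r q) fun s => contMDiff_coLin T ⟨_, hr s⟩

variable {H : Type*} [NormedAddCommGroup H] [InnerProductSpace ℂ H]

/-- `W` is the two-point distribution `W(f^♯, h^♯) = ⟨u((𝒞 f)^♯), u(h^♯)⟩`. -/
def IsTwoPoint (B : HermitianBundle d F E) (u : Distr d F E 1 H) (W : Distr d F E 2 ℂ) : Prop :=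
  ∀ f h, W.toFun (B.sharp ![f, h]) =
    inner ℂ (u.toFun (B.sharp fun _ => B.conj₀ f)) (u.toFun (B.sharp fun _ => h))

variable {B : HermitianBundle d F E} {u : Distr d F E 1 H} {W : Distr d F E 2 ℂ}

theorem IsTwoPoint.toFun_flat₀ (hW : IsTwoPoint B u W) {y y' : Fin 1 → M} (χ : Cutoff d y)
    (χ' : Cutoff d y') (k k' : Fin 1 → (Coord d →L[ℝ] ℝ)) (T T' : CoSect d F E 1) :
    W.toFun (B.sharp ![B.flat₀ (χ.testSection k T), B.flat₀ (χ'.testSection k' T')]) =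
      inner ℂ (u.toFun (χ.star.testSection (-k) (B.coConj T)))
        (u.toFun (χ'.testSection k' T')) := by
  rw [hW, B.sharp_conj₀_flat₀, B.sharp_flat₀]

theorem sharp_flat₀_pair {y : Fin 2 → M} (χ : ∀ i, Cutoff d (fun _ : Fin 1 => y i))
    (k : Fin 2 → (Coord d →L[ℝ] ℝ)) (T : Fin 2 → CoSect d F E 1) :
    B.sharp ![B.flat₀ ((χ 0).testSection (fun _ => k 0) (T 0)),
        B.flat₀ ((χ 1).testSection (fun _ => k 1) (T 1))] =
      (Cutoff.tensor χ).testSection k (coProd T) := by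
  refine B.sharp_eq_testSection χ k T _ fun i q v => ?_
  fin_cases i <;> exact B.bil_flat₀ _ q v

/-- Both inclusions rest on this formula: on the antidiagonal k₀ = -k₁, with conjugate data in the
first slot, it is a squared norm; in general Cauchy–Schwarz bounds it by a product. -/
theorem IsTwoPoint.toFun_testSection (hW : IsTwoPoint B u W) {y : Fin 2 → M}
    (χ : ∀ i, Cutoff d (fun _ : Fin 1 => y i)) (k : Fin 2 → (Coord d →L[ℝ] ℝ))
    (T : Fin 2 → CoSect d F E 1) :
    W.toFun ((Cutoff.tensor χ).testSection k (coProd T)) =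
      inner ℂ (u.toFun ((χ 0).star.testSection (-fun _ => k 0) (B.coConj (T 0))))
        (u.toFun ((χ 1).testSection (fun _ => k 1) (T 1))) := by
  rw [← sharp_flat₀_pair (B := B), hW.toFun_flat₀]

theorem Distr.regularDirected_of_notMem_negCone {V : Set (CotangentBundle d M)}
    (hu : u.WF ⊆ coneOne (negCone V)) {ζ : CotangentBundle d M} (h0 : ζ.2 ≠ 0)
    (hζ : ζ ∉ negCone V) (T : CoSect d F E 1) : u.RegularDirected T (fun _ => ζ) := by
  by_contra h
  exact hζ (hu ⟨⟨0, h0⟩, T, h⟩)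

/-- The projection of families of covectors to one member. -/
def covProj (d : ℕ) {n : ℕ} (i : Fin n) :
    (Fin n → (Coord d →L[ℝ] ℝ)) →L[ℝ] (Fin 1 → (Coord d →L[ℝ] ℝ)) :=
  ContinuousLinearMap.pi fun _ => ContinuousLinearMap.proj i

theorem norm_covProj_apply_le {n : ℕ} (i : Fin n) (k : Fin n → (Coord d →L[ℝ] ℝ)) :
    ‖covProj d i k‖ ≤ ‖k‖ :=
  (pi_norm_le_iff_of_nonneg (norm_nonneg _)).2 fun _ => norm_le_pi_norm k i

/-- One factor decays rapidly in its own frequency, the other grows at most polynomially. The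
indices are left free so that the estimate also serves for W with its arguments exchanged. -/
theorem exists_nhds_rapidNear_mul {V : Set (CotangentBundle d M)} (B : HermitianBundle d F E)
    (hu : u.WF ⊆ coneOne (negCone V)) (ξ : Fin n → CotangentBundle d M) (i j : Fin n)
    (T : Fin n → CoSect d F E 1)
    (h : ((ξ i).2 ≠ 0 ∧ ξ i ∉ V) ∨ ((ξ j).2 ≠ 0 ∧ ξ j ∉ negCone V)) :
    ∃ O : Fin n → Set (Fin 1 → M), (∀ l, O l ∈ 𝓝 (fun _ => (ξ l).proj)) ∧
      ∀ χ : ∀ l, Cutoff d (fun _ : Fin 1 => (ξ l).proj), (∀ l, tsupport (χ l).toFun ⊆ O l) →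
      RapidNear (fun k : Fin n → (Coord d →L[ℝ] ℝ) =>
        ‖u.toFun ((χ i).star.testSection (-fun _ => k i) (B.coConj (T i)))‖ *
          ‖u.toFun ((χ j).testSection (fun _ => k j) (T j))‖) (fun l => (ξ l).2) := by
  classical
  have hO : ∀ (i : Fin n) (U : Set (Fin 1 → M)), U ∈ 𝓝 (fun _ => (ξ i).proj) →
      ∀ l, (if l = i then U else Set.univ) ∈ 𝓝 (fun _ : Fin 1 => (ξ l).proj) := by
    intro i U hU l
    split_ifs with hl
    · rw [hl]; exact hU
    · exact Filter.univ_mem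
  rcases h with ⟨h0, h1⟩ | ⟨h0, h1⟩
  -- The factor with index `i` is tested at frequency -k_i, so the relevant covector is -ξ_i, which
  -- lies outside V^- exactly because ξ_i lies outside V^+.
  · obtain ⟨U, hU, hUr⟩ := exists_nhds_rapidNear
      (Distr.regularDirected_of_notMem_negCone hu
        (ζ := ⟨(ξ i).proj, -(ξ i).2⟩) (neg_ne_zero.2 h0)
        (by simpa only [negCone, Set.mem_ofPred_eq, neg_neg] using! h1) (B.coConj (T i)))
    refine ⟨_, hO i U hU, fun χ hχ => ?_⟩
    have h2 := hUr (χ i).star ((χ i).tsupport_star_subset.trans (by simpa using hχ i))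
    have h3 := RapidNear.mul_polyBounded (-covProj d i) (covProj d j) (ξ := fun l => (ξ l).2)
      (norm_covProj_apply_le j) (polyBounded_testSection u (χ j) (T j))
      (fun k => norm_nonneg _) h2
    exact h3.mono fun k => (mul_comm _ _).le
  · obtain ⟨U, hU, hUr⟩ := exists_nhds_rapidNear
      (Distr.regularDirected_of_notMem_negCone hu h0 h1 (T j))
    refine ⟨_, hO j U hU, fun χ hχ => ?_⟩
    have h2 := hUr (χ j) (by simpa using hχ j)
    exact RapidNear.mul_polyBounded (covProj d j) (-covProj d i) (ξ := fun l => (ξ l).2)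
      (fun k => by simpa using norm_covProj_apply_le i k)
      (polyBounded_testSection u (χ i).star (B.coConj (T i))) (fun k => norm_nonneg _) h2

theorem Cutoff.star_star {y : Fin n → M} (χ : Cutoff d y) : χ.star.star = χ := by
  cases χ
  simp [Cutoff.star]

theorem HermitianBundle.coConj_coConj (B : HermitianBundle d F E) (T : CoSect d F E 1) :
    B.coConj (B.coConj T) = T := by
  refine Subtype.ext (funext fun x => MultilinearMap.ext fun v => ?_)
  rw [apply_eq_coLin, apply_eq_coLin, coLin_coConj, coLin_coConj, B.conjF_conjF, Complex.conj_conj]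

/-- The isometry `k ↦ (-k, k)`. -/
def negDiag (d : ℕ) : (Fin 1 → (Coord d →L[ℝ] ℝ)) →ₗᵢ[ℝ] (Fin 2 → (Coord d →L[ℝ] ℝ)) where
  toFun k := ![-k 0, k 0]
  map_add' k l := by
    ext i; fin_cases i <;> simp [add_comm]
  map_smul' c k := by
    ext i; fin_cases i <;> simp
  norm_map' k := by
    change ‖(![-k 0, k 0] : Fin 2 → (Coord d →L[ℝ] ℝ))‖ = ‖k‖
    refine le_antisymm ((pi_norm_le_iff_of_nonneg (norm_nonneg _)).2 fun i => ?_)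
      ((pi_norm_le_iff_of_nonneg (norm_nonneg _)).2 fun i => ?_)
    · fin_cases i
      · simpa using norm_le_pi_norm k 0
      · simpa using norm_le_pi_norm k 0
    · obtain rfl := Subsingleton.elim i 0
      exact norm_le_pi_norm (![-k 0, k 0] : Fin 2 → (Coord d →L[ℝ] ℝ)) 1

/-- Regularity of W at (-ζ, ζ) over a diagonal point, restricted to frequencies (-k, k), is rapid
decay of the squared norm of u near ζ. -/
theorem IsTwoPoint.wF_vector_subset (hW : IsTwoPoint B u W) {V : Set (CotangentBundle d M)}
    (h : W.WF ⊆ conePair V (negCone V)) : u.WF ⊆ coneOne (negCone V) := by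
  rintro η ⟨⟨i, hi⟩, T, hT⟩
  obtain ⟨ζ, rfl⟩ : ∃ ζ, η = fun _ => ζ :=
    ⟨η 0, funext fun i => by rw [Subsingleton.elim i 0]⟩
  by_contra hζ
  refine hT ?_
  let ξ : Fin 2 → CotangentBundle d M :=
    fun i => ⟨ζ.proj, (![-ζ.2, ζ.2] : Fin 2 → Cotangent d M ζ.proj) i⟩
  have hξ : W.RegularDirected (coProd ![B.coConj T, T]) ξ := by
    by_contra hr
    exact hζ (h ⟨⟨1, hi⟩, _, hr⟩ : ξ ∈ conePair V (negCone V)).2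
  obtain ⟨U, hU, hUr⟩ := exists_nhds_rapidNear hξ
  rw [nhds_pi, Filter.mem_pi'] at hU
  obtain ⟨I, t, ht, htU⟩ := hU
  -- The same cutoff, up to conjugation, is used in both slots, so its support must fit both sides
  -- of the box inside `U`.
  obtain ⟨χ, hχ1, hχ⟩ := exists_cutoff (d := d) (y := fun _ : Fin 1 => ζ.proj)
    ((continuous_apply (A := fun _ => M) (0 : Fin 1)).continuousAt
      (Filter.inter_mem (ht 0) (ht 1)))
  let χ₂ : ∀ i : Fin 2, Cutoff d (fun _ : Fin 1 => (ξ i).proj) := ![χ.star, χ]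
  have hs : tsupport (Cutoff.tensor χ₂).toFun ⊆ U := by
    refine fun x hx => htU fun i _ => ?_
    have h1 := tsupport_prod_subset χ₂ hx
    fin_cases i
    · exact (hχ (χ.tsupport_star_subset (h1 0))).1
    · exact (hχ (h1 1)).2
  refine (regularDirected_iff u T _).2 ⟨χ, by rw [hχ1]; exact one_ne_zero, RapidNear.of_sq ?_⟩
  have h2 := hUr (Cutoff.tensor χ₂) hs
  have h3 : (fun i => (ξ i).2 : Fin 2 → (Coord d →L[ℝ] ℝ)) = negDiag d fun _ => ζ.2 := by
    funext i; fin_cases i <;> rfl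
  rw [h3] at h2
  refine (h2.comp_isometry (negDiag d)).mono fun k => ?_
  rw [hW.toFun_testSection]
  have h4 : u.toFun ((χ₂ 0).star.testSection (-fun _ => (negDiag d k) 0)
      (B.coConj ((![B.coConj T, T] : Fin 2 → CoSect d F E 1) 0))) =
      u.toFun (χ.testSection k T) := by
    have hk : (-fun _ => (negDiag d k) 0 : Fin 1 → (Coord d →L[ℝ] ℝ)) = k := by
      funext i
      rw [Subsingleton.elim i 0]
      exact neg_neg (k 0)
    rw [hk]
    change u.toFun (χ.star.star.testSection k (B.coConj (B.coConj T))) = _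
    rw [χ.star_star, B.coConj_coConj]
  have h5 : u.toFun ((χ₂ 1).testSection (fun _ => (negDiag d k) 1)
      ((![B.coConj T, T] : Fin 2 → CoSect d F E 1) 1)) = u.toFun (χ.testSection k T) := by
    have hk : (fun _ => (negDiag d k) 1 : Fin 1 → (Coord d →L[ℝ] ℝ)) = k := by
      funext i
      rw [Subsingleton.elim i 0]
      rfl
    rw [hk]
    rfl
  rw [h4, h5, inner_self_eq_norm_sq_to_K]
  simp

/-- Cauchy–Schwarz controls W as soon as one component is nonzero and outside its cone. The
commutation relation handles the remaining covectors, which have one zero component. The map `r` is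
the transpose of `R`, so `R` in the second slot of E_P only changes the dual section being tested.
-/
theorem IsTwoPoint.wF_subset (hW : IsTwoPoint B u W) {V : Set (CotangentBundle d M)}
    (hV : IsPositiveCone V) (hu : u.WF ⊆ coneOne (negCone V)) {uE : Distr d F E 2 ℂ}
    (hE : uE.WF ⊆ conePair V (negCone V) ∪ conePair (negCone V) V)
    {R : Sect₀ d F E → Sect₀ d F E} {r : ∀ q, E q →ₗ[ℂ] E q}
    (hr : ∀ s : Sect d F E, (fun q => r q (s.1 q)) ∈ Sect d F E)
    (hR : ∀ h q v, B.bil q ((R h).1.1 q) v = B.bil q (h.1.1 q) (r q v)) {c : ℤ} (hc : |c| ≤ 1)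
    (hcomm : ∀ f h, W.toFun (B.sharp ![f, h]) =
      c • W.toFun (B.sharp ![h, f]) + Complex.I * uE.toFun (B.sharp ![f, R h])) :
    W.WF ⊆ conePair V (negCone V) := by
  rintro ξ ⟨hξ, T₂, hT₂⟩
  by_contra hmem
  refine hT₂ (regularDirected_of_coProd W hξ (fun T => ?_) T₂)
  have hfin : ∀ {U : Set (Fin 2 → M)} {O : Fin 2 → Set (Fin 1 → M)},
      U ∈ 𝓝 (fun i => (ξ i).proj) → (∀ l, O l ∈ 𝓝 (fun _ => (ξ l).proj)) →
      (∀ χ : ∀ l, Cutoff d (fun _ : Fin 1 => (ξ l).proj), (∀ l, tsupport (χ l).toFun ⊆ O l) →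
        tsupport (Cutoff.tensor χ).toFun ⊆ U →
        RapidNear (fun k : Fin 2 → (Coord d →L[ℝ] ℝ) =>
          ‖W.toFun ((Cutoff.tensor χ).testSection k (coProd T))‖) (fun l => (ξ l).2)) →
      W.RegularDirected (coProd T) ξ := by
    intro U O hU hO h
    obtain ⟨χ, h1, h2, h3⟩ := exists_tensor_cutoff (d := d) hU hO
    exact (regularDirected_iff W _ ξ).2 ⟨_, by rw [h1]; exact one_ne_zero, h χ h3 h2⟩
  by_cases h01 : ((ξ 0).2 ≠ 0 ∧ ξ 0 ∉ V) ∨ ((ξ 1).2 ≠ 0 ∧ ξ 1 ∉ negCone V)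
  · obtain ⟨O, hO, hOr⟩ := exists_nhds_rapidNear_mul B hu ξ 0 1 T h01
    refine hfin Filter.univ_mem hO fun χ hχ _ => (hOr χ hχ).mono fun k => ?_
    rw [hW.toFun_testSection]
    exact norm_inner_le_norm _ _
  have hneg : ∀ ζ ∈ negCone V, ζ ∉ V := fun ζ h1 h2 => Set.disjoint_left.1 hV.disjoint_neg h2 h1
  have hneg0 : ∀ ζ ∈ negCone V, ζ.2 ≠ 0 := fun ζ h1 h2 => hV.ne_zero _ h1 (neg_eq_zero.2 h2)
  -- Each component is now zero or in its cone. They are not both zero, and not both in the cones.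
  have hcases : ((ξ 0).2 = 0 ∧ (ξ 1).2 ≠ 0 ∧ ξ 1 ∈ negCone V) ∨
      ((ξ 1).2 = 0 ∧ (ξ 0).2 ≠ 0 ∧ ξ 0 ∈ V) := by
    simp only [Fin.exists_fin_two] at hξ
    have hmem' : ¬ (ξ 0 ∈ V ∧ ξ 1 ∈ negCone V) := hmem
    tauto
  -- With the slots exchanged, the nonzero component meets the opposite cone, from which it is
  -- excluded because V^+ and V^- are disjoint.
  have h10 : ((ξ 1).2 ≠ 0 ∧ ξ 1 ∉ V) ∨ ((ξ 0).2 ≠ 0 ∧ ξ 0 ∉ negCone V) := by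
    rcases hcases with ⟨-, h1, h2⟩ | ⟨-, h1, h2⟩
    · exact Or.inl ⟨h1, hneg _ h2⟩
    · exact Or.inr ⟨h1, fun h => hneg _ h h2⟩
  -- The cones contain no zero covectors, so a covector with a zero component is not in the
  -- wavefront set of E_P.
  have hEr : uE.RegularDirected (coProd ![T 0, coComp (T 1) r hr]) ξ := by
    by_contra h
    rcases hE ⟨hξ, _, h⟩ with h | h
    · rcases hcases with ⟨h1, -⟩ | ⟨h1, -⟩
      · exact hV.ne_zero _ h.1 h1
      · exact hneg0 _ h.2 h1
    · rcases hcases with ⟨h1, -⟩ | ⟨h1, -⟩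
      · exact hneg0 _ h.1 h1
      · exact hV.ne_zero _ h.2 h1
  obtain ⟨U, hU, hUr⟩ := exists_nhds_rapidNear hEr
  obtain ⟨O, hO, hOr⟩ := exists_nhds_rapidNear_mul B hu ξ 1 0 T h10
  refine hfin hU hO fun χ hχ hχU => ((hOr χ hχ).add (hUr _ hχU)).mono fun k => ?_
  rw [← sharp_flat₀_pair (B := B), hcomm, hW.toFun_flat₀]
  have h1 : B.sharp ![B.flat₀ ((χ 0).testSection (fun _ => k 0) (T 0)),
      R (B.flat₀ ((χ 1).testSection (fun _ => k 1) (T 1)))] =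
      (Cutoff.tensor χ).testSection k (coProd ![T 0, coComp (T 1) r hr]) := by
    refine B.sharp_eq_testSection χ k _ _ fun i q v => ?_
    fin_cases i
    · exact B.bil_flat₀ _ q v
    · change B.bil q ((R _).1.1 q) v =
        coLin ((χ 1).testSection (fun _ => k 1) (coComp (T 1) r hr)).1 q v
      rw [hR, B.bil_flat₀, coLin_testSection, coLin_testSection, coComp, coLin_mkCo]
      rfl
  rw [h1]
  refine (norm_add_le _ _).trans (add_le_add ?_ ?_)
  · rw [← Int.cast_smul_eq_zsmul ℝ, norm_smul, Real.norm_eq_abs]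
    have h2 : |(c : ℝ)| ≤ 1 := by exact_mod_cast hc
    exact (mul_le_of_le_one_left (norm_nonneg _) h2).trans (norm_inner_le_norm _ _)
  · rw [norm_mul, Complex.norm_I, one_mul]

end TwoPoint

/-! ### Field algebras and their representations -/

namespace FieldData

variable {X : Type*} [AddCommGroup X] [Module ℂ X] (D : FieldData X)

theorem quot_eq {a b : FreeAlgebra ℂ X} (h : D.Rel a b) : D.quot a = D.quot b :=
  RingQuot.mkAlgHom_rel ℂ h

theorem field_add (f h : X) : D.field (f + h) = D.field f + D.field h := by
  rw [field, D.quot_eq (Rel.add f h), map_add]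
  rfl

theorem field_smul (c : ℂ) (f : X) : D.field (c • f) = c • D.field f := by
  rw [field, D.quot_eq (Rel.smul c f), map_smul]
  rfl

theorem field_mul_field (f h : X) : D.field f * D.field h =
    D.sign • (D.field h * D.field f) + algebraMap ℂ _ (Complex.I * D.form f h) := by
  have h1 := D.quot_eq (Rel.comm f h)
  rw [map_sub, map_zsmul, map_mul, map_mul, AlgHom.commutes] at h1
  exact sub_eq_iff_eq_add'.1 h1

end FieldData

/-! ### Vector states on field algebras. -/

section Representations

variable {d : ℕ} {M : Type*} [TopologicalSpace M] [ChartedSpace (Coord d) M]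
  [IsManifold (𝓡 d) ∞ M] [T2Space M]
  {F : Type*} [NormedAddCommGroup F] [NormedSpace ℂ F] [FiniteDimensional ℂ F]
  {E : M → Type*} [∀ x, AddCommGroup (E x)] [∀ x, Module ℂ (E x)] [∀ x, TopologicalSpace (E x)]
  [TopologicalSpace (TotalSpace F E)] [FiberBundle F E] [VectorBundle ℂ F E] [VectorBundle ℝ F E]
  [ContMDiffVectorBundle ∞ F E (𝓡 d)]
  {H : Type*} [NormedAddCommGroup H] [InnerProductSpace ℂ H]
  {D : FieldData (Sect₀ d F E)} {B : HermitianBundle d F E}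

theorem State.correlator_two (w : State D.Alg) (f : Fin 2 → Sect₀ d F E) :
    w.correlator 2 f = w.toFun (D.field (f 0) * D.field (f 1)) := by
  simp [State.correlator, List.ofFn_succ]

theorem HilbertRep.IsGNS.vectorState_eq {A : Type*} [Ring A] [Algebra ℂ A] [StarRing A]
    {ρ : HilbertRep A H} {φ : ρ.D} {w : State A} (h : ρ.IsGNS φ w) :
    ρ.vectorState φ h.norm_eq_one = w := by
  have h1 : (ρ.vectorState φ h.norm_eq_one).toFun = w.toFun :=
    LinearMap.ext fun a => (h.apply_eq a).symm
  cases w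
  simpa [vectorState] using h1

namespace HilbertRep

variable (ρ : HilbertRep D.Alg H) (ψ : ρ.D)

/-- The map `f ↦ π(Φ(f)) ψ` as a linear map. -/
def fieldLin : Sect₀ d F E →ₗ[ℂ] H where
  toFun f := (ρ.rep (D.field f) ψ : H)
  map_add' f h := by simp [D.field_add]
  map_smul' c f := by simp [D.field_smul]

/-- Φ(f) is the adjoint of Φ(𝒞f) and can be moved to the left entry of the inner product. -/
theorem vectorState_field_mul (hconj : D.conjV = B.conj₀) (hψ : ‖(ψ : H)‖ = 1)
    (f h : Sect₀ d F E) :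
    (ρ.vectorState ψ hψ).toFun (D.field f * D.field h) =
      inner ℂ (ρ.fieldLin ψ (B.conj₀ f)) (ρ.fieldLin ψ h) := by
  have h1 := ρ.adjoint (D.field (B.conj₀ f)) ψ (ρ.rep (D.field h) ψ)
  rw [D.star_field, hconj, B.conj₀_conj₀, ← ρ.map_mul] at h1
  exact h1.symm

variable {ρ ψ} {W : Distr d F E 2 ℂ} {u : Distr d F E 1 H}

theorem isTwoPoint_of_represents (hconj : D.conjV = B.conj₀) (hψ : ‖(ψ : H)‖ = 1)
    (hW : W.Represents B ((ρ.vectorState ψ hψ).correlator 2))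
    (hu : u.Represents B (ρ.fieldVector ψ)) : IsTwoPoint B u W := by
  intro f h
  rw [hW, hu, hu, State.correlator_two]
  exact ρ.vectorState_field_mul ψ hconj hψ f h

theorem exists_represents_fieldVector (hconj : D.conjV = B.conj₀) (hψ : ‖(ψ : H)‖ = 1)
    (h : (ρ.vectorState ψ hψ).HasDistributionalNPoint B) :
    ∃ u : Distr d F E 1 H, u.Represents B (ρ.fieldVector ψ) := by
  obtain ⟨W, hW⟩ := h 2
  refine exists_vectorDistr B (ρ.fieldLin ψ) W fun f h => ?_
  rw [hW, State.correlator_two]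
  exact ρ.vectorState_field_mul ψ hconj hψ f h

theorem wF_subset_of_isHadamard {V : Set (CotangentBundle d M)} (hconj : D.conjV = B.conj₀)
    (hψ : ‖(ψ : H)‖ = 1) (h : (ρ.vectorState ψ hψ).IsHadamard B V)
    (hu : u.Represents B (ρ.fieldVector ψ)) : u.WF ⊆ coneOne (negCone V) := by
  obtain ⟨-, W, hW, hWV⟩ := h
  exact (isTwoPoint_of_represents hconj hψ hW hu).wF_vector_subset hWV

/-- The sign and the map `R` are kept abstract so that commutators and anticommutators are treated
at once. -/
theorem isHadamard_iff {V : Set (CotangentBundle d M)} (hV : IsPositiveCone V)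
    (hconj : D.conjV = B.conj₀) (hsign : |D.sign| ≤ 1) {uE : Distr d F E 2 ℂ}
    (hE : uE.WF ⊆ conePair V (negCone V) ∪ conePair (negCone V) V)
    {R : Sect₀ d F E → Sect₀ d F E} {r : ∀ q, E q →ₗ[ℂ] E q}
    (hr : ∀ s : Sect d F E, (fun q => r q (s.1 q)) ∈ Sect d F E)
    (hR : ∀ h q v, B.bil q ((R h).1.1 q) v = B.bil q (h.1.1 q) (r q v))
    (hform : ∀ f h, D.form f h = uE.toFun (B.sharp ![f, R h])) (hψ : ‖(ψ : H)‖ = 1)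
    (hn : (ρ.vectorState ψ hψ).HasDistributionalNPoint B)
    (hu : u.Represents B (ρ.fieldVector ψ)) :
    (ρ.vectorState ψ hψ).IsHadamard B V ↔ u.WF ⊆ coneOne (negCone V) := by
  refine ⟨fun h => wF_subset_of_isHadamard hconj hψ h hu, fun h => ⟨hn, ?_⟩⟩
  obtain ⟨W, hW⟩ := hn 2
  refine ⟨W, hW, (isTwoPoint_of_represents hconj hψ hW hu).wF_subset hV h hE hr hR hsign
    fun f h => ?_⟩
  rw [hW, hW, State.correlator_two, State.correlator_two, ← hform]
  simp only [Matrix.cons_val_zero, Matrix.cons_val_one]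
  rw [D.field_mul_field, map_add, map_zsmul, Algebra.algebraMap_eq_smul_one, map_smul,
    State.map_one, smul_eq_mul, mul_one]

/-- The characterisation of Hadamard states by the wavefront sets of vector-valued
distributions. -/
theorem hadamard_characterisation {V : Set (CotangentBundle d M)} (hV : IsPositiveCone V)
    (hconj : D.conjV = B.conj₀) (hsign : |D.sign| ≤ 1) {uE : Distr d F E 2 ℂ}
    (hE : uE.WF ⊆ conePair V (negCone V) ∪ conePair (negCone V) V)
    {R : Sect₀ d F E → Sect₀ d F E} {r : ∀ q, E q →ₗ[ℂ] E q}
    (hr : ∀ s : Sect d F E, (fun q => r q (s.1 q)) ∈ Sect d F E)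
    (hR : ∀ h q v, B.bil q ((R h).1.1 q) v = B.bil q (h.1.1 q) (r q v))
    (hform : ∀ f h, D.form f h = uE.toFun (B.sharp ![f, R h])) :
    (∀ (ρ : HilbertRep D.Alg H) (ψ : ρ.D) (hψ : ‖(ψ : H)‖ = 1),
      (ρ.vectorState ψ hψ).HasDistributionalNPoint B →
      (∃ u : Distr d F E 1 H, u.Represents B (ρ.fieldVector ψ)) ∧
      ∀ u : Distr d F E 1 H, u.Represents B (ρ.fieldVector ψ) →
        ((ρ.vectorState ψ hψ).IsHadamard B V ↔ u.WF ⊆ coneOne (negCone V))) ∧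
    (∀ w : State D.Alg, w.IsHadamard B V →
      ∀ (ρ : HilbertRep D.Alg H) (φ : ρ.D), ρ.IsGNS φ w →
      (∃ u : Distr d F E 1 H, u.Represents B (ρ.fieldVector φ)) ∧
      ∀ u : Distr d F E 1 H, u.Represents B (ρ.fieldVector φ) →
        u.WF ⊆ coneOne (negCone V)) := by
  refine ⟨fun ρ ψ hψ hn => ⟨exists_represents_fieldVector hconj hψ hn, fun u hu =>
    isHadamard_iff hV hconj hsign hE hr hR hform hψ hn hu⟩, fun w hw ρ φ hφ => ?_⟩
  rw [← hφ.vectorState_eq] at hw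
  exact ⟨exists_represents_fieldVector hconj hφ.norm_eq_one hw.1, fun u hu =>
    wF_subset_of_isHadamard hconj hφ.norm_eq_one hw hu⟩

end HilbertRep

end Representations

end HadamardQFT
end

theorem theorem4p9 {d : ℕ} {M : Type*} [TopologicalSpace M] [ChartedSpace (HadamardQFT.Coord d) M]
    [IsManifold (𝓡 d) ∞ M] [T2Space M] [ParacompactSpace M] [Finite (ConnectedComponents M)]
    {F : Type*} [NormedAddCommGroup F] [NormedSpace ℂ F] [FiniteDimensional ℂ F]
    {E : M → Type*} [∀ x, AddCommGroup (E x)] [∀ x, Module ℂ (E x)] [∀ x, TopologicalSpace (E x)]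
    [TopologicalSpace (TotalSpace F E)] [FiberBundle F E] [VectorBundle ℂ F E]
    [VectorBundle ℝ F E] [ContMDiffVectorBundle ∞ F E (𝓡 d)]
    (S : HadamardQFT.Spacetime d M) (B : HadamardQFT.HermitianBundle d F E)
    (V : Set (HadamardQFT.CotangentBundle d M)) (hV : HadamardQFT.IsPositiveCone V)
    {H : Type*} [NormedAddCommGroup H] [InnerProductSpace ℂ H] [CompleteSpace H] :
    -- the bosonic case
    (∀ P : HadamardQFT.RFHGHO S B, P.IsDecomposable V →
      (∀ (ρ : HadamardQFT.HilbertRep P.bosonic.Alg H) (ψ : ρ.D) (hψ : ‖(ψ : H)‖ = 1),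
        (ρ.vectorState ψ hψ).HasDistributionalNPoint B →
        (∃ u : HadamardQFT.Distr d F E 1 H, u.Represents B (ρ.fieldVector ψ)) ∧
        ∀ u : HadamardQFT.Distr d F E 1 H, u.Represents B (ρ.fieldVector ψ) →
          ((ρ.vectorState ψ hψ).IsHadamard B V ↔
            u.WF ⊆ HadamardQFT.coneOne (HadamardQFT.negCone V))) ∧
      (∀ w : HadamardQFT.State P.bosonic.Alg, w.IsHadamard B V →
        ∀ (ρ : HadamardQFT.HilbertRep P.bosonic.Alg H) (φ : ρ.D), ρ.IsGNS φ w →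
        (∃ u : HadamardQFT.Distr d F E 1 H, u.Represents B (ρ.fieldVector φ)) ∧
        ∀ u : HadamardQFT.Distr d F E 1 H, u.Represents B (ρ.fieldVector φ) →
          u.WF ⊆ HadamardQFT.coneOne (HadamardQFT.negCone V))) ∧
    -- the fermionic case
    (∀ Q : HadamardQFT.FermionicRFHGHO S B, Q.IsDecomposable V →
      (∀ (ρ : HadamardQFT.HilbertRep Q.fermionic.Alg H) (ψ : ρ.D) (hψ : ‖(ψ : H)‖ = 1),
        (ρ.vectorState ψ hψ).HasDistributionalNPoint B →
        (∃ u : HadamardQFT.Distr d F E 1 H, u.Represents B (ρ.fieldVector ψ)) ∧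
        ∀ u : HadamardQFT.Distr d F E 1 H, u.Represents B (ρ.fieldVector ψ) →
          ((ρ.vectorState ψ hψ).IsHadamard B V ↔
            u.WF ⊆ HadamardQFT.coneOne (HadamardQFT.negCone V))) ∧
      (∀ w : HadamardQFT.State Q.fermionic.Alg, w.IsHadamard B V →
        ∀ (ρ : HadamardQFT.HilbertRep Q.fermionic.Alg H) (φ : ρ.D), ρ.IsGNS φ w →
        (∃ u : HadamardQFT.Distr d F E 1 H, u.Represents B (ρ.fieldVector φ)) ∧
        ∀ u : HadamardQFT.Distr d F E 1 H, u.Represents B (ρ.fieldVector φ) →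
          u.WF ⊆ HadamardQFT.coneOne (HadamardQFT.negCone V))) := by
  refine ⟨fun P hP => ?_, fun Q hQ => ?_⟩
  · obtain ⟨uE, hE, hWF⟩ := hP
    exact HadamardQFT.HilbertRep.hadamard_characterisation (D := P.bosonic) hV rfl
      (by simp [HadamardQFT.RFHGHO.bosonic]) hWF
      (R := id) (r := fun _ => LinearMap.id) (fun s => s.2) (fun _ _ _ => rfl)
      fun f h => (hE ![f, h]).symm
  · obtain ⟨uE, hE, hWF⟩ := hQ
    refine HadamardQFT.HilbertRep.hadamard_characterisation (D := Q.fermionic) hV rfl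
      (by simp [HadamardQFT.FermionicRFHGHO.fermionic]) hWF
      -- The transpose of R for the bilinear metric is -R: it is hermitian and anticommutes with 𝒞,
      -- so ⟨Rv, w⟩ = (𝒞Rv, w) = -(R𝒞v, w) = -⟨v, Rw⟩.
      (R := Q.R₀) (r := fun q => -(Q.R q).toLinearMap) (fun s => ?_) (fun h q v => ?_)
      fun f h => (hE ![f, Q.R₀ h]).symm
    · exact (HadamardQFT.Sect d F E).neg_mem (Q.R_smooth s)
    · change B.herm q (B.conjF q (Q.R q (h.1.1 q))) v = B.herm q (B.conjF q (h.1.1 q)) (-(Q.R q v))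
      rw [map_neg, Q.R_hermitian, Q.R_conj, map_neg, LinearMap.neg_apply, neg_neg]
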